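/- Let $B\subset\mathbb R^3$ be a bounded open set (in particular, a bounded smooth domain). Indices run over $\{1,2,3\}$, repeated indices are summed, $_{,j}$ is the partial derivative in $x_j$ and a dot is the time derivative. Consider, for the displacement $u_i$, the volume fractions $\varphi,\psi$, the temperature $\theta$ and the microtemperatures $T_i$, the *backward in time* system of linear thermoelasticity with double porosity and microtemperatures $$\rho\ddot u_i=\left(C_{ijkl}u_{k,l}+B_{ij}\varphi+D_{ij}\psi-\beta_{ij}\theta\right)_{,j},$$ $$k_1\ddot\varphi=\left(\alpha_{ij}\varphi_{,i}+b_{ij}\psi_{,i}-N_{ij}T_i\right)_{,j}-B_{ij}u_{i,j}-\alpha_1\varphi-\alpha_3\psi+\gamma_1\theta,$$ $$k_2\ddot\psi=\left(b_{ij}\varphi_{,i}+\gamma_{ij}\psi_{,i}-M_{ij}T_i\right)_{,j}-D_{ij}u_{i,j}-\alpha_3\varphi-\alpha_2\psi+\gamma_2\theta,$$ $$a\dot\theta=-\beta_{ij}\dot u_{i,j}-\gamma_1\dot\varphi-\gamma_2\dot\psi-\tfrac1{T_0}\left(\kappa_{ij}\theta_{,j}+L_{ij}T_j\right)_{,i},$$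 $$P_{ij}\dot T_j=-\left(A_{jirs}T_{s,r}\right)_{,j}+R_{ij}T_j+\lambda_{ij}\theta_{,j}-N_{ij}\dot\varphi_{,j}-M_{ij}\dot\psi_{,j}.$$ The *forward* system has the same first three equations, while in the last two the terms $\tfrac1{T_0}(\kappa_{ij}\theta_{,j}+L_{ij}T_j)_{,i}$, $(A_{jirs}T_{s,r})_{,j}$, $R_{ij}T_j$ and $\lambda_{ij}\theta_{,j}$ have the opposite signs. The coefficients are functions on $B$, continuous and bounded; those that stand under a spatial derivative ($C,A,B,D,\beta,\alpha_{ij},b,\gamma_{ij},N,M,\kappa,L$) are $C^1$ with bounded first derivatives. Assume $T_0>0$ constant; the symmetries $C_{ijkl}=C_{klij}$ and $\alpha_{ij}=\alpha_{ji}$, likewise for $b,B,D,P,M,L,N,R,\lambda$; and, for some positive constants $\rho_0,k_0^1,k_0^2,a_0,p_0,C_0,C^*,C_1$, everywhere in $B$ and for all real $\xi_i,\zeta_i,\xi_{ij}$: * $\rho\ge\rho_0$, $k_1\ge k_0^1$, $k_2\ge k_0^2$, $a\ge a_0$, $P_{ij}\xi_i\xi_j\ge p_0\xi_i\xi_i$;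 * $\kappa_{ij}\xi_i\xi_j+(L_{ij}+T_0\lambda_{ij})\xi_j\zeta_i+T_0R_{ij}\zeta_i\zeta_j\ge C_0(\xi_i\xi_i+\zeta_i\zeta_i)$; * $\int_B\big(C_{ijkl}v_{i,j}v_{k,l}+\alpha_{ij}f_{,i}f_{,j}+\gamma_{ij}g_{,i}g_{,j}+2b_{ij}f_{,i}g_{,j}+2B_{ij}v_{i,j}f+2D_{ij}v_{i,j}g+\alpha_1f^2+\alpha_2g^2+2\alpha_3fg\big)\,dV\ge C^*\int_B\big(v_{i,j}v_{i,j}+f_{,i}f_{,i}+g_{,i}g_{,i}+f^2+g^2\big)\,dV$ for all $v_i,f,g$ that are continuous on $\overline B$, zero on $\partial B$ and $C^1$ with bounded gradient in $B$; moreover $\alpha_{ij}\xi_i\xi_j\ge0$ and $b_{ij}\xi_i\xi_j\ge0$; * $A_{jirs}\xi_{ij}\xi_{sr}\ge C_1\xi_{ij}\xi_{ij}$. A solution on a time interval $I$ is a classical one: all fields are continuous on $I\times\overline B$; $u_i,\varphi,\psi$ are $C^2$ on $I\times B$; $\theta,T_i$ are $C^1$ on $I\times B$ with continuous second space derivatives;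 for $u_i,\varphi,\psi$ the derivatives $\dot f,\ddot f,f_{,j},\dot f_{,j},f_{,jk}$, and for $\theta,T_i$ the derivatives $\dot f,f_{,j},f_{,jk}$, are bounded on $K\times B$ for each compact $K\subset I$; and the equations hold on $I\times B$. Then: 1. Let $I\subset[0,\infty)$ be an interval containing $0$ and another point (for example $[0,\infty)$ or $[0,\tau]$). If a solution of the backward system on $I$ satisfies the null initial conditions $u_i=\dot u_i=\varphi=\dot\varphi=\psi=\dot\psi=\theta=T_i=0$ on $B$ at $t=0$ and the null boundary conditions $u_i=\varphi=\psi=\theta=T_i=0$ on $\partial B$ for all $t\in I$, then $u_i=\varphi=\psi=\theta=T_i=0$ on $I\times\overline B$. 2. Two solutions of the backward system on such an $I$ with the same initial data $(u_i,\dot u_i,\varphi,\dot\varphi,\psi,\dot\psi,\theta,T_i)$ on $B$ at $t=0$ and the same boundary values of $(u_i,\varphi,\psi,\theta,T_i)$ on $I\times\partial B$ coincide on $I\times\overline B$. 3. (Impossibility of localization in time.) Let $J\subset\mathbb R$ be an interval and $t_0$ an interior point of $J$. If a solution of the forward system on $J$ with null boundary conditions vanishes on $B$ for all $t\in J$ with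 $t\ge t_0$, then it vanishes on $J\times\overline B$. -/

import Mathlib

namespace DoublePorosity

noncomputable section

/-- The reference configuration lives in three-dimensional Euclidean space. -/
abbrev Space := EuclideanSpace ℝ (Fin 3)

/-- The partial derivative `f_{,j}` of a function of the space variable. -/
def pd (j : Fin 3) (f : Space → ℝ) (x : Space) : ℝ :=
  fderiv ℝ f x (EuclideanSpace.single j 1)

/-- The time derivative, relative to the time interval `I` (one-sided at an end point of `I`). -/
def dt (I : Set ℝ) (f : ℝ → Space → ℝ) (t : ℝ) (x : Space) : ℝ :=
  derivWithin (fun s => f s x) I t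

/-- The constitutive coefficients, functions of the material point, and the constant absolute
temperature `T0` of the reference configuration. -/
structure Coeffs where
  T0 : ℝ
  rho : Space → ℝ
  k1 : Space → ℝ
  k2 : Space → ℝ
  a : Space → ℝ
  alpha1 : Space → ℝ
  alpha2 : Space → ℝ
  alpha3 : Space → ℝ
  gamma1 : Space → ℝ
  gamma2 : Space → ℝ
  C : Fin 3 → Fin 3 → Fin 3 → Fin 3 → Space → ℝ
  A : Fin 3 → Fin 3 → Fin 3 → Fin 3 → Space → ℝ
  B : Fin 3 → Fin 3 → Space → ℝ
  D : Fin 3 → Fin 3 → Space → ℝ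
  beta : Fin 3 → Fin 3 → Space → ℝ
  alpha : Fin 3 → Fin 3 → Space → ℝ
  b : Fin 3 → Fin 3 → Space → ℝ
  gamma : Fin 3 → Fin 3 → Space → ℝ
  N : Fin 3 → Fin 3 → Space → ℝ
  M : Fin 3 → Fin 3 → Space → ℝ
  kappa : Fin 3 → Fin 3 → Space → ℝ
  L : Fin 3 → Fin 3 → Space → ℝ
  P : Fin 3 → Fin 3 → Space → ℝ
  R : Fin 3 → Fin 3 → Space → ℝ
  lam : Fin 3 → Fin 3 → Space → ℝ

/-- The unknowns: displacement `u`, volume fractions `phi` and `psi`, temperature `theta`,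
microtemperatures `T`. -/
structure Fields where
  u : Fin 3 → ℝ → Space → ℝ
  phi : ℝ → Space → ℝ
  psi : ℝ → Space → ℝ
  theta : ℝ → Space → ℝ
  T : Fin 3 → ℝ → Space → ℝ

/-- Continuous and bounded on `Ω`. -/
def CoeffC0 (Ω : Set Space) (f : Space → ℝ) : Prop :=
  ContinuousOn f Ω ∧ ∃ K : ℝ, ∀ x ∈ Ω, |f x| ≤ K

/-- Continuously differentiable on `Ω`, bounded together with the first derivatives. -/
def CoeffC1 (Ω : Set Space) (f : Space → ℝ) : Prop :=
  ContDiffOn ℝ 1 f Ω ∧ ∃ K : ℝ, ∀ x ∈ Ω, |f x| ≤ K ∧ ∀ j, |pd j f x| ≤ K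

/-- Regularity of the coefficients: those under a divergence are `C¹`, the others are `C⁰`. -/
structure Coeffs.Regular (c : Coeffs) (Ω : Set Space) : Prop where
  rho : CoeffC0 Ω c.rho
  k1 : CoeffC0 Ω c.k1
  k2 : CoeffC0 Ω c.k2
  a : CoeffC0 Ω c.a
  alpha1 : CoeffC0 Ω c.alpha1
  alpha2 : CoeffC0 Ω c.alpha2
  alpha3 : CoeffC0 Ω c.alpha3
  gamma1 : CoeffC0 Ω c.gamma1
  gamma2 : CoeffC0 Ω c.gamma2
  P : ∀ i j, CoeffC0 Ω (c.P i j)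
  R : ∀ i j, CoeffC0 Ω (c.R i j)
  lam : ∀ i j, CoeffC0 Ω (c.lam i j)
  C : ∀ i j k l, CoeffC1 Ω (c.C i j k l)
  A : ∀ i j k l, CoeffC1 Ω (c.A i j k l)
  B : ∀ i j, CoeffC1 Ω (c.B i j)
  D : ∀ i j, CoeffC1 Ω (c.D i j)
  beta : ∀ i j, CoeffC1 Ω (c.beta i j)
  alpha : ∀ i j, CoeffC1 Ω (c.alpha i j)
  b : ∀ i j, CoeffC1 Ω (c.b i j)
  gamma : ∀ i j, CoeffC1 Ω (c.gamma i j)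
  N : ∀ i j, CoeffC1 Ω (c.N i j)
  M : ∀ i j, CoeffC1 Ω (c.M i j)
  kappa : ∀ i j, CoeffC1 Ω (c.kappa i j)
  L : ∀ i j, CoeffC1 Ω (c.L i j)

/-- The symmetries of the constitutive coefficients. -/
structure Coeffs.Symmetric (c : Coeffs) (Ω : Set Space) : Prop where
  C : ∀ x ∈ Ω, ∀ i j k l, c.C i j k l x = c.C k l i j x
  alpha : ∀ x ∈ Ω, ∀ i j, c.alpha i j x = c.alpha j i x
  b : ∀ x ∈ Ω, ∀ i j, c.b i j x = c.b j i x
  B : ∀ x ∈ Ω, ∀ i j, c.B i j x = c.B j i x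
  D : ∀ x ∈ Ω, ∀ i j, c.D i j x = c.D j i x
  P : ∀ x ∈ Ω, ∀ i j, c.P i j x = c.P j i x
  M : ∀ x ∈ Ω, ∀ i j, c.M i j x = c.M j i x
  L : ∀ x ∈ Ω, ∀ i j, c.L i j x = c.L j i x
  N : ∀ x ∈ Ω, ∀ i j, c.N i j x = c.N j i x
  R : ∀ x ∈ Ω, ∀ i j, c.R i j x = c.R j i x
  lam : ∀ x ∈ Ω, ∀ i j, c.lam i j x = c.lam j i x

/-- Twice the density of internal energy of the static fields `v` (displacement), `f` and `g`
(volume fractions). -/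
def Coeffs.energy (c : Coeffs) (v : Fin 3 → Space → ℝ) (f g : Space → ℝ) (x : Space) : ℝ :=
  (∑ i, ∑ j, ∑ k, ∑ l, c.C i j k l x * pd j (v i) x * pd l (v k) x)
    + (∑ i, ∑ j, c.alpha i j x * pd i f x * pd j f x)
    + (∑ i, ∑ j, c.gamma i j x * pd i g x * pd j g x)
    + 2 * (∑ i, ∑ j, c.b i j x * pd i f x * pd j g x)
    + 2 * (∑ i, ∑ j, c.B i j x * pd j (v i) x * f x)
    + 2 * (∑ i, ∑ j, c.D i j x * pd j (v i) x * g x)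
    + c.alpha1 x * f x ^ 2 + c.alpha2 x * g x ^ 2 + 2 * c.alpha3 x * f x * g x

/-- Admissible static fields: continuous on the closure of `Ω`, null on its boundary, `C¹` with
bounded first derivatives in `Ω`. -/
structure StaticField (Ω : Set Space) (f : Space → ℝ) : Prop where
  cont : ContinuousOn f (closure Ω)
  null : ∀ x ∈ frontier Ω, f x = 0
  diff : ContDiffOn ℝ 1 f Ω
  bdd : ∀ j, ∃ K : ℝ, ∀ x ∈ Ω, |pd j f x| ≤ K

/-- The positivity hypotheses on the coefficients. -/
structure Coeffs.Positive (c : Coeffs) (Ω : Set Space) : Prop where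
  T0 : 0 < c.T0
  rho : ∃ r : ℝ, 0 < r ∧ ∀ x ∈ Ω, r ≤ c.rho x
  k1 : ∃ r : ℝ, 0 < r ∧ ∀ x ∈ Ω, r ≤ c.k1 x
  k2 : ∃ r : ℝ, 0 < r ∧ ∀ x ∈ Ω, r ≤ c.k2 x
  a : ∃ r : ℝ, 0 < r ∧ ∀ x ∈ Ω, r ≤ c.a x
  P : ∃ r : ℝ, 0 < r ∧ ∀ x ∈ Ω, ∀ ξ : Fin 3 → ℝ,
    r * ∑ i, ξ i ^ 2 ≤ ∑ i, ∑ j, c.P i j x * ξ i * ξ j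
  conduction : ∃ r : ℝ, 0 < r ∧ ∀ x ∈ Ω, ∀ ξ ζ : Fin 3 → ℝ,
    r * ((∑ i, ξ i ^ 2) + ∑ i, ζ i ^ 2) ≤
      (∑ i, ∑ j, c.kappa i j x * ξ i * ξ j)
        + (∑ i, ∑ j, (c.L i j x + c.T0 * c.lam i j x) * ξ j * ζ i)
        + c.T0 * ∑ i, ∑ j, c.R i j x * ζ i * ζ j
  /-- The internal energy is coercive over `Ω`; implied by the pointwise inequality between the
  integrands, and, through Korn's inequality, satisfied by the usual elasticity tensors. -/
  energy : ∃ r : ℝ, 0 < r ∧ ∀ (v : Fin 3 → Space → ℝ) (f g : Space → ℝ),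
    (∀ i, StaticField Ω (v i)) → StaticField Ω f → StaticField Ω g →
      r * (∫ x in Ω, ((∑ i, ∑ j, pd j (v i) x ^ 2) + (∑ i, pd i f x ^ 2)
          + (∑ i, pd i g x ^ 2) + f x ^ 2 + g x ^ 2)) ≤
        ∫ x in Ω, c.energy v f g x
  alpha : ∀ x ∈ Ω, ∀ ξ : Fin 3 → ℝ, 0 ≤ ∑ i, ∑ j, c.alpha i j x * ξ i * ξ j
  b : ∀ x ∈ Ω, ∀ ξ : Fin 3 → ℝ, 0 ≤ ∑ i, ∑ j, c.b i j x * ξ i * ξ j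
  A : ∃ r : ℝ, 0 < r ∧ ∀ x ∈ Ω, ∀ ξ : Fin 3 → Fin 3 → ℝ,
    r * (∑ i, ∑ j, ξ i j ^ 2) ≤
      ∑ i, ∑ j, ∑ p, ∑ q, c.A j i p q x * ξ i j * ξ q p

/-- Bounded on `K × Ω` for every compact set `K` of times in `I`. -/
def LocBdd (I : Set ℝ) (Ω : Set Space) (f : ℝ → Space → ℝ) : Prop :=
  ∀ K ⊆ I, IsCompact K → ∃ m : ℝ, ∀ t ∈ K, ∀ x ∈ Ω, |f t x| ≤ m

/-- Regularity of the displacement components and of the volume fractions. -/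
structure MechRegular (I : Set ℝ) (Ω : Set Space) (f : ℝ → Space → ℝ) : Prop where
  cont : ContinuousOn (fun p : ℝ × Space => f p.1 p.2) (I ×ˢ closure Ω)
  diff : ContDiffOn ℝ 2 (fun p : ℝ × Space => f p.1 p.2) (I ×ˢ Ω)
  bdd_dt : LocBdd I Ω (dt I f)
  bdd_dtt : LocBdd I Ω (dt I (dt I f))
  bdd_dx : ∀ j, LocBdd I Ω (fun t => pd j (f t))
  bdd_dtx : ∀ j, LocBdd I Ω (fun t => pd j (dt I f t))
  bdd_dxx : ∀ j k, LocBdd I Ω (fun t => pd k (pd j (f t)))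

/-- Regularity of the temperature and of the microtemperatures. -/
structure ThermRegular (I : Set ℝ) (Ω : Set Space) (f : ℝ → Space → ℝ) : Prop where
  cont : ContinuousOn (fun p : ℝ × Space => f p.1 p.2) (I ×ˢ closure Ω)
  diff : ContDiffOn ℝ 1 (fun p : ℝ × Space => f p.1 p.2) (I ×ˢ Ω)
  diff_space : ∀ t ∈ I, ContDiffOn ℝ 2 (f t) Ω
  cont_dxx : ∀ j k,
    ContinuousOn (fun p : ℝ × Space => pd k (pd j (f p.1)) p.2) (I ×ˢ Ω)
  bdd_dt : LocBdd I Ω (dt I f)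
  bdd_dx : ∀ j, LocBdd I Ω (fun t => pd j (f t))
  bdd_dxx : ∀ j k, LocBdd I Ω (fun t => pd k (pd j (f t)))

structure Fields.Regular (U : Fields) (I : Set ℝ) (Ω : Set Space) : Prop where
  u : ∀ i, MechRegular I Ω (U.u i)
  phi : MechRegular I Ω U.phi
  psi : MechRegular I Ω U.psi
  theta : ThermRegular I Ω U.theta
  T : ∀ i, ThermRegular I Ω (U.T i)

/-- Stress: the `j`-th component of the flux in the `i`-th momentum equation. -/
def Coeffs.stress (c : Coeffs) (U : Fields) (i j : Fin 3) (t : ℝ) (x : Space) : ℝ :=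
  (∑ k, ∑ l, c.C i j k l x * pd l (U.u k t) x)
    + c.B i j x * U.phi t x + c.D i j x * U.psi t x - c.beta i j x * U.theta t x

/-- The equilibrated stress associated with `phi`. -/
def Coeffs.sigma (c : Coeffs) (U : Fields) (j : Fin 3) (t : ℝ) (x : Space) : ℝ :=
  ∑ i, (c.alpha i j x * pd i (U.phi t) x + c.b i j x * pd i (U.psi t) x - c.N i j x * U.T i t x)

/-- The equilibrated stress associated with `psi`. -/
def Coeffs.tau (c : Coeffs) (U : Fields) (j : Fin 3) (t : ℝ) (x : Space) : ℝ :=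
  ∑ i, (c.b i j x * pd i (U.phi t) x + c.gamma i j x * pd i (U.psi t) x - c.M i j x * U.T i t x)

/-- The heat flux. -/
def Coeffs.heatFlux (c : Coeffs) (U : Fields) (i : Fin 3) (t : ℝ) (x : Space) : ℝ :=
  ∑ j, (c.kappa i j x * pd j (U.theta t) x + c.L i j x * U.T j t x)

/-- Minus the first heat flux moment: `A_{jirs} T_{s,r}`. -/
def Coeffs.fluxMoment (c : Coeffs) (U : Fields) (j i : Fin 3) (t : ℝ) (x : Space) : ℝ :=
  ∑ r, ∑ s, c.A j i r s x * pd r (U.T s t) x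

/-- The three mechanical balance equations, common to the forward and the backward problem. -/
structure MechanicalEqs (c : Coeffs) (Ω : Set Space) (I : Set ℝ) (U : Fields) : Prop where
  momentum : ∀ t ∈ I, ∀ x ∈ Ω, ∀ i,
    c.rho x * dt I (dt I (U.u i)) t x = ∑ j, pd j (c.stress U i j t) x
  phi : ∀ t ∈ I, ∀ x ∈ Ω,
    c.k1 x * dt I (dt I U.phi) t x =
      (∑ j, pd j (c.sigma U j t) x)
        - (∑ i, ∑ j, c.B i j x * pd j (U.u i t) x)
        - c.alpha1 x * U.phi t x - c.alpha3 x * U.psi t x + c.gamma1 x * U.theta t x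
  psi : ∀ t ∈ I, ∀ x ∈ Ω,
    c.k2 x * dt I (dt I U.psi) t x =
      (∑ j, pd j (c.tau U j t) x)
        - (∑ i, ∑ j, c.D i j x * pd j (U.u i t) x)
        - c.alpha3 x * U.phi t x - c.alpha2 x * U.psi t x + c.gamma2 x * U.theta t x

/-- Classical solution, on the time interval `I`, of the forward in time system. -/
structure ForwardSolution (c : Coeffs) (Ω : Set Space) (I : Set ℝ) (U : Fields) : Prop where
  regular : U.Regular I Ω
  mechanical : MechanicalEqs c Ω I U
  heat : ∀ t ∈ I, ∀ x ∈ Ω,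
    c.a x * dt I U.theta t x =
      -(∑ i, ∑ j, c.beta i j x * pd j (dt I (U.u i) t) x)
        - c.gamma1 x * dt I U.phi t x - c.gamma2 x * dt I U.psi t x
        + 1 / c.T0 * ∑ i, pd i (c.heatFlux U i t) x
  micro : ∀ t ∈ I, ∀ x ∈ Ω, ∀ i,
    (∑ j, c.P i j x * dt I (U.T j) t x) =
      (∑ j, pd j (c.fluxMoment U j i t) x)
        - (∑ j, c.R i j x * U.T j t x) - (∑ j, c.lam i j x * pd j (U.theta t) x)
        - (∑ j, c.N i j x * pd j (dt I U.phi t) x) - (∑ j, c.M i j x * pd j (dt I U.psi t) x)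

/-- Classical solution, on the time interval `I`, of the backward in time system. -/
structure BackwardSolution (c : Coeffs) (Ω : Set Space) (I : Set ℝ) (U : Fields) : Prop where
  regular : U.Regular I Ω
  mechanical : MechanicalEqs c Ω I U
  heat : ∀ t ∈ I, ∀ x ∈ Ω,
    c.a x * dt I U.theta t x =
      -(∑ i, ∑ j, c.beta i j x * pd j (dt I (U.u i) t) x)
        - c.gamma1 x * dt I U.phi t x - c.gamma2 x * dt I U.psi t x
        - 1 / c.T0 * ∑ i, pd i (c.heatFlux U i t) x
  micro : ∀ t ∈ I, ∀ x ∈ Ω, ∀ i,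
    (∑ j, c.P i j x * dt I (U.T j) t x) =
      -(∑ j, pd j (c.fluxMoment U j i t) x)
        + (∑ j, c.R i j x * U.T j t x) + (∑ j, c.lam i j x * pd j (U.theta t) x)
        - (∑ j, c.N i j x * pd j (dt I U.phi t) x) - (∑ j, c.M i j x * pd j (dt I U.psi t) x)

/-- The values of all fields of `U` and `V` agree at time `t` and point `x`. -/
structure AgreeAt (U V : Fields) (t : ℝ) (x : Space) : Prop where
  u : ∀ i, U.u i t x = V.u i t x
  phi : U.phi t x = V.phi t x
  psi : U.psi t x = V.psi t x
  theta : U.theta t x = V.theta t x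
  T : ∀ i, U.T i t x = V.T i t x

/-- The null fields. -/
def nullFields : Fields where
  u := fun _ _ _ => 0
  phi := fun _ _ => 0
  psi := fun _ _ => 0
  theta := fun _ _ => 0
  T := fun _ _ _ => 0

/-- `U` and `V` have the same initial data at time `0`; for `V = nullFields`, these are the null
initial conditions. -/
structure SameInitialData (Ω : Set Space) (I : Set ℝ) (U V : Fields) : Prop where
  fields : ∀ x ∈ Ω, AgreeAt U V 0 x
  du : ∀ x ∈ Ω, ∀ i, dt I (U.u i) 0 x = dt I (V.u i) 0 x
  dphi : ∀ x ∈ Ω, dt I U.phi 0 x = dt I V.phi 0 x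
  dpsi : ∀ x ∈ Ω, dt I U.psi 0 x = dt I V.psi 0 x

/-- `U` and `V` have the same Dirichlet boundary data at all times in `I`; for `V = nullFields`,
these are the null boundary conditions. -/
def SameBoundaryData (Ω : Set Space) (I : Set ℝ) (U V : Fields) : Prop :=
  ∀ t ∈ I, ∀ x ∈ frontier Ω, AgreeAt U V t x

end

end DoublePorosity

/-!
# Uniqueness backward in time for thermoelasticity with double porosity and microtemperatures

The impossibility of localization follows from uniqueness by reversal of time: a solution of the
forward problem that vanishes from `t₀` on gives, on an interval `[t, t₀]` read backwards, a solution
of the backward problem with null data. The statement on null data is uniqueness for a null second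
solution. So let `z` be the difference of the mechanical fields of two solutions of the backward
problem with the same data, `y` that of the thermal fields, on `[0, τ]`.

In weak form the equations are `K z'' = -W z - G z + b y` and `(Θ y + bᵀ z)' = D y`, with `K`
(inertia), `W` (internal energy) and `Θ` (heat capacity) symmetric and, on the admissible fields,
`K` and `W` coercive and `D` (dissipation) coercive modulo `Θ`. The tensor `γ` need not be symmetric;
its skew part is a term `G` of lower order, because second derivatives commute
(`sum_gammaSkew_weak`). Nor is `D` symmetric, as identities of Lagrange type and logarithmic
convexity would require. Instead one studies the transforms `ẑ(λ) = ∫₀^τ exp (λ (τ - t)) z(t) dt`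
and `ŷ(λ)`, which are entire functions of `λ = μ + i ν` of exponential type. Because the initial data
are null, they solve the stationary equations with the final values as right-hand sides. Tested with
the transforms themselves, these equations give three inequalities, up to lower order terms: the
real part of the first bounds `μ (‖v̂‖² + ‖ẑ‖²)`, where `v̂` is the transform of `z'`; the real part
of the second bounds `‖ŷ‖²` by `(μ + 1) Θ(ŷ, ŷ)`, and its imaginary part bounds `|ν| Θ(ŷ, ŷ)` by
`‖ŷ‖²`. Together they keep the transforms bounded for large `μ` with `|ν| ≥ κ μ`
(`exists_bound_of_resolvent_inequalities`, `EvolutionForms.exists_resolvent_bound`). For `μ` bounded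
above they are bounded trivially. The remaining sector has an opening less than `π`, so that the
principle of Phragmén and Lindelöf bounds them everywhere (`bounded_of_bounded_off_sector`). By
Liouville's theorem they are constant, the constant is the limit `0` at `λ → -∞`, and Fourier
inversion gives `z = 0` and `y = 0` (`eq_zero_of_transforms_bounded`, `IsWeakSolution.eq_zero`).

The boundary of `Ω` is arbitrary. Integration by parts is possible all the same, since an admissible
field, extended by zero, is Lipschitz (`StaticField.exists_lipschitz`), and hence has line derivatives
almost everywhere whose integral is zero (`StaticField.integral_pd`, `inner_toL2_pd`). The hypothesis
on the internal energy controls the displacement gradient only; the displacement itself is controlled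
by the Poincaré inequality (`exists_poincare`).
-/

namespace DoublePorosity
open Set Filter Topology MeasureTheory
open scoped ENNReal RealInnerProductSpace

/-! ### Algebra of the resolvent estimate -/

/-- The elementary inequalities behind the resolvent estimate at `λ = μ + i ν`. Here `a`, `d` and `n`
stand for the norms of the transforms of the velocity, of the second order unknown and of the first
order unknown, and `Θ` for the capacity form of the latter. The first inequality makes
`a ^ 2 + d ^ 2` small compared with `1 + n ^ 2` for large `μ`; the second bounds `n ^ 2` by `μ Θ`;
the third bounds `|ν| Θ` by `1 + n ^ 2`, which is absurd for large `n` if `|ν| / μ` is large. -/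
theorem exists_bound_of_resolvent_inequalities {m C : ℝ} (hm : 0 < m) (hC : 0 ≤ C) :
    ∃ μ₀ κ R : ℝ, 0 < μ₀ ∧ 0 < κ ∧ ∀ μ ν a d n Θ : ℝ, μ₀ ≤ μ → κ * μ ≤ |ν| →
      0 ≤ a → 0 ≤ d → 0 ≤ n → 0 ≤ Θ →
      μ * (m * (a ^ 2 + d ^ 2)) ≤ C * (a + d + d * a + n * a) →
      m * n ^ 2 ≤ (μ + 1) * Θ + C * (n + n * a) →
      |ν| * Θ ≤ C * (n + n * a + n ^ 2) → n ≤ R ∧ d ≤ R := by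
  -- `ε` is the factor with which the first inequality bounds `a ^ 2 + d ^ 2` by `1 + n ^ 2`
  obtain ⟨ε, hε0, hε1, hε⟩ : ∃ ε : ℝ, 0 < ε ∧ ε ≤ 1 ∧ C ^ 2 * ε ≤ m ^ 2 / 4 := by
    refine ⟨min 1 (m ^ 2 / (4 * (C ^ 2 + 1))), by positivity, min_le_left _ _, ?_⟩
    calc C ^ 2 * min 1 (m ^ 2 / (4 * (C ^ 2 + 1)))
        ≤ (C ^ 2 + 1) * (m ^ 2 / (4 * (C ^ 2 + 1))) := by
          gcongr
          · linarith
          · exact min_le_right _ _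
      _ = m ^ 2 / 4 := by field_simp
  set C₁ : ℝ := C ^ 2 / m + m / 4 with hC₁
  have hC₁0 : 0 < C₁ := by positivity
  set P : ℝ := C * (1 + 12 * C₁ / m) with hP
  have hP0 : 0 ≤ P := by positivity
  set Q : ℝ := 24 * C / m with hQ
  have hQ0 : 0 ≤ Q := by positivity
  set N : ℝ := 4 / m * (2 * P + C₁) with hN
  refine ⟨(2 * C + 2 * C / ε) / m + 1, Q + 1, 2 + N, by positivity, by positivity, ?_⟩
  intro μ ν a d n Θ hμ hν ha hd hn hΘ h1 h2 h3
  have hμ1 : 1 ≤ μ := by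
    have : 0 ≤ (2 * C + 2 * C / ε) / m := by positivity
    linarith
  have hμm : 2 * C + 2 * C / ε ≤ μ * m := by
    have : (2 * C + 2 * C / ε) / m ≤ μ := by linarith
    rwa [div_le_iff₀ hm] at this
  have hq : a ^ 2 + d ^ 2 ≤ ε * (1 + n ^ 2) := by
    have e1 : C * (a + d + d * a + n * a) ≤ C * (2 * (a ^ 2 + d ^ 2) + 2 * (1 + n ^ 2)) := by
      refine mul_le_mul_of_nonneg_left ?_ hC
      linarith only [sq_nonneg (a - 1), sq_nonneg (d - 1), sq_nonneg (d - a), sq_nonneg (n - a),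
        sq_nonneg n, sq_nonneg a, sq_nonneg d]
    have e2 : (2 * C + 2 * C / ε) * (a ^ 2 + d ^ 2) ≤ μ * m * (a ^ 2 + d ^ 2) := by gcongr
    have e3 : 2 * C / ε * (a ^ 2 + d ^ 2) ≤ 2 * C * (1 + n ^ 2) := by linarith
    rcases hC.eq_or_lt with h0 | h0
    · have : μ * (m * (a ^ 2 + d ^ 2)) ≤ 0 := by simpa [← h0] using h1
      have h' : a ^ 2 + d ^ 2 ≤ 0 := by
        by_contra hcon
        push Not at hcon
        have : 0 < μ * (m * (a ^ 2 + d ^ 2)) := by positivity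
        linarith
      have : 0 ≤ ε * (1 + n ^ 2) := by positivity
      linarith
    · have e4 : (2 * C) * (a ^ 2 + d ^ 2) ≤ (2 * C) * (ε * (1 + n ^ 2)) := by
        have := mul_le_mul_of_nonneg_left e3 hε0.le
        have e5 : ε * (2 * C / ε * (a ^ 2 + d ^ 2)) = 2 * C * (a ^ 2 + d ^ 2) := by field_simp
        linarith
      exact le_of_mul_le_mul_left e4 (by positivity)
  have ha2 : a ^ 2 ≤ ε * (1 + n ^ 2) := by nlinarith [sq_nonneg d]
  have hd2 : d ^ 2 ≤ 1 + n ^ 2 := by nlinarith [sq_nonneg a, sq_nonneg n]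
  have ha2' : a ^ 2 ≤ 1 + n ^ 2 := by nlinarith [sq_nonneg d, sq_nonneg n]
  have hCn : C * n ≤ m / 4 * n ^ 2 + C ^ 2 / m := by
    have : 0 ≤ (m / 2 * n - C) ^ 2 / m := by positivity
    have e : (m / 2 * n - C) ^ 2 / m = m / 4 * n ^ 2 + C ^ 2 / m - C * n := by field_simp; ring
    linarith
  have hCna : C * (n * a) ≤ m / 4 * n ^ 2 + C ^ 2 / m * a ^ 2 := by
    have : 0 ≤ (m / 2 * n - C * a) ^ 2 / m := by positivity
    have e : (m / 2 * n - C * a) ^ 2 / m = m / 4 * n ^ 2 + C ^ 2 / m * a ^ 2 - C * (n * a) := by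
      field_simp; ring
    linarith
  have hCa : C ^ 2 / m * a ^ 2 ≤ m / 4 * (1 + n ^ 2) := by
    calc C ^ 2 / m * a ^ 2 ≤ C ^ 2 / m * (ε * (1 + n ^ 2)) := by gcongr
      _ = C ^ 2 * ε / m * (1 + n ^ 2) := by ring
      _ ≤ m ^ 2 / 4 / m * (1 + n ^ 2) := by gcongr
      _ = m / 4 * (1 + n ^ 2) := by field_simp
  have h4 : m / 4 * n ^ 2 ≤ 2 * (μ * Θ) + C₁ := by
    have e1 : (μ + 1) * Θ ≤ 2 * (μ * Θ) := by
      have : 0 ≤ (μ - 1) * Θ := mul_nonneg (by linarith) hΘ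
      linarith
    have e2 : C * (n + n * a) = C * n + C * (n * a) := by ring
    rw [hC₁]
    linarith only [e1, e2, h2, hCn, hCna, hCa]
  have h4' : n ^ 2 ≤ 4 / m * (2 * (μ * Θ) + C₁) := by
    calc n ^ 2 = 4 / m * (m / 4 * n ^ 2) := by field_simp
      _ ≤ _ := by gcongr
  have h5 : |ν| * Θ ≤ C * (1 + 3 * n ^ 2) := by
    refine h3.trans (mul_le_mul_of_nonneg_left ?_ hC)
    linarith only [ha2', sq_nonneg (n - 1), sq_nonneg (n - a), sq_nonneg n]
  have h6 : |ν| * Θ ≤ P + Q * (μ * Θ) := by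
    calc |ν| * Θ ≤ C * (1 + 3 * n ^ 2) := h5
      _ ≤ C * (1 + 3 * (4 / m * (2 * (μ * Θ) + C₁))) := by gcongr
      _ = P + Q * (μ * Θ) := by rw [hP, hQ]; field_simp; ring
  have h7 : μ * Θ ≤ P := by
    have : (Q + 1) * μ * Θ ≤ |ν| * Θ := by gcongr
    linarith only [this, h6]
  have h8 : n ^ 2 ≤ N := by
    refine h4'.trans ?_
    rw [hN]; gcongr
  constructor
  · linarith only [h8, sq_nonneg (n - 1), sq_nonneg n]
  · linarith only [h8, hd2, sq_nonneg (d - 1), sq_nonneg d]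

/-! ### Curves with bounded transforms -/

section
open Complex

/-- The function `λ ↦ ∫₀^τ exp (λ (τ - t)) h t dt`. -/
noncomputable def expTransform (τ : ℝ) (h : ℝ → ℂ) (l : ℂ) : ℂ :=
  ∫ t in (0 : ℝ)..τ, exp (l * (τ - t : ℝ)) * h t

section
variable {τ : ℝ} {h : ℝ → ℂ}

theorem norm_expTransform_le (hτ : 0 ≤ τ) {M : ℝ} (hM : ∀ t ∈ Icc 0 τ, ‖h t‖ ≤ M)
    (l : ℂ) {a : ℝ} (ha : 0 ≤ a) (hl : l.re ≤ a) :
    ‖expTransform τ h l‖ ≤ τ * M * Real.exp (τ * a) := by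
  have hM0 : 0 ≤ M := (norm_nonneg _).trans (hM 0 ⟨le_rfl, hτ⟩)
  have := intervalIntegral.norm_integral_le_of_norm_le_const (a := 0) (b := τ)
    (C := Real.exp (τ * a) * M) (f := fun t : ℝ => exp (l * (τ - t : ℝ)) * h t) (by
      intro t ht
      rw [uIoc_of_le hτ] at ht
      rw [norm_mul, Complex.norm_exp]
      gcongr
      · simp only [mul_re, ofReal_re, ofReal_im, mul_zero, sub_zero]
        have h1 : 0 ≤ τ - t := by linarith [ht.2]
        calc l.re * (τ - t) ≤ a * (τ - t) := by gcongr
          _ ≤ a * τ := by gcongr; linarith [ht.1]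
          _ = τ * a := mul_comm _ _
      · exact hM t ⟨ht.1.le, ht.2⟩)
  refine this.trans (le_of_eq ?_)
  rw [sub_zero, abs_of_nonneg hτ]
  ring

theorem differentiable_expTransform (hτ : 0 ≤ τ) (hh : ContinuousOn h (Icc 0 τ)) :
    Differentiable ℂ (expTransform τ h) := by
  intro l
  obtain ⟨M, hM⟩ := isCompact_Icc.exists_bound_of_continuousOn hh
  have hcont : ∀ f : ℝ → ℂ, Continuous f →
      AEStronglyMeasurable (fun t => f t * h t) (volume.restrict (uIoc 0 τ)) := by
    intro f hf
    rw [uIoc_of_le hτ]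
    exact ((hf.continuousOn.mul hh).mono Ioc_subset_Icc_self).aestronglyMeasurable
      measurableSet_Ioc
  have key := intervalIntegral.hasDerivAt_integral_of_dominated_loc_of_deriv_le
    (μ := volume) (a := 0) (b := τ)
    (F := fun (l : ℂ) (t : ℝ) => exp (l * (τ - t : ℝ)) * h t)
    (F' := fun (l : ℂ) (t : ℝ) => (exp (l * (τ - t : ℝ)) * (τ - t : ℝ)) * h t)
    (x₀ := l) (bound := fun _ => Real.exp (τ * (‖l‖ + 1)) * τ * M)
    (Metric.ball_mem_nhds l one_pos)
    (Eventually.of_forall fun l => hcont (fun t : ℝ => exp (l * (τ - t : ℝ))) (by fun_prop)) (by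
      rw [intervalIntegrable_iff_integrableOn_Icc_of_le hτ]
      exact ContinuousOn.integrableOn_Icc (ContinuousOn.mul (by fun_prop) hh))
    (hcont (fun t : ℝ => exp (l * (τ - t : ℝ)) * (τ - t : ℝ)) (by fun_prop)) (by
      refine Eventually.of_forall fun t ht z hz => ?_
      rw [uIoc_of_le hτ] at ht
      have h1 : 0 ≤ τ - t := by linarith [ht.2]
      have hz' : ‖z‖ ≤ ‖l‖ + 1 := by
        have := norm_sub_norm_le z l
        rw [Metric.mem_ball, dist_eq_norm] at hz
        linarith
      rw [norm_mul, norm_mul, Complex.norm_exp, norm_real, Real.norm_of_nonneg h1]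
      have := hM t ⟨ht.1.le, ht.2⟩
      have h2 : (z * (τ - t : ℝ)).re ≤ τ * (‖l‖ + 1) := by
        simp only [mul_re, ofReal_re, ofReal_im, mul_zero, sub_zero]
        calc z.re * (τ - t) ≤ (‖l‖ + 1) * (τ - t) := by
              gcongr; exact (re_le_norm z).trans hz'
          _ ≤ (‖l‖ + 1) * τ := by gcongr; linarith [ht.1]
          _ = τ * (‖l‖ + 1) := mul_comm _ _
      gcongr
      linarith [ht.1])
    (by simp) (by
      refine Eventually.of_forall fun t _ z _ => ?_
      have := ((hasDerivAt_id z).mul_const ((τ - t : ℝ) : ℂ)).cexp.mul_const (h t)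
      simpa using this)
  exact key.2.differentiableAt

/-- On the imaginary axis the transform is, up to a factor of modulus one, the Fourier transform. -/
theorem eq_zero_of_expTransform_eq_zero (hτ : 0 < τ) (hh : ContinuousOn h (Icc 0 τ))
    (h0 : ∀ l, expTransform τ h l = 0) : ∀ t ∈ Icc 0 τ, h t = 0 := by
  set g : ℝ → ℂ := indicator (Ioc 0 τ) h with hg
  have hgi : Integrable g := by
    rw [hg, integrable_indicator_iff measurableSet_Ioc]
    exact (hh.integrableOn_Icc).mono_set Ioc_subset_Icc_self
  have hF : FourierTransform.fourier g = 0 := by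
    ext w
    rw [Real.fourier_real_eq_integral_exp_smul]
    have h1 := h0 (2 * Real.pi * w * I)
    rw [expTransform, intervalIntegral.integral_of_le hτ.le,
      ← integral_indicator measurableSet_Ioc] at h1
    have h2 : ∀ v : ℝ, cexp (↑(-2 * Real.pi * v * w) * I) • g v =
        exp (-(2 * Real.pi * w * τ * I)) *
          (Ioc 0 τ).indicator (fun t : ℝ => exp (2 * Real.pi * w * I * (τ - t : ℝ)) * h t) v := by
      intro v
      by_cases hv : v ∈ Ioc 0 τ
      · rw [hg, indicator_of_mem hv, indicator_of_mem hv, ← mul_assoc, ← Complex.exp_add,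
          smul_eq_mul]
        congr 2
        push_cast
        ring
      · simp [hg, indicator_of_notMem hv]
    simp_rw [h2]
    rw [integral_const_mul, h1, mul_zero]
    rfl
  have hIoo : ∀ t ∈ Ioo 0 τ, h t = 0 := by
    intro t ht
    have hca : ContinuousAt g t := by
      have : ContinuousAt h t := hh.continuousAt (Icc_mem_nhds ht.1 ht.2)
      refine this.congr ?_
      filter_upwards [Ioo_mem_nhds ht.1 ht.2] with s hs
      rw [hg, indicator_of_mem (Ioo_subset_Ioc_self hs)]
    have := hgi.fourierInv_fourier_eq (by rw [hF]; exact integrable_zero _ _ _) hca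
    rw [hF] at this
    have h3 : g t = h t := indicator_of_mem (Ioo_subset_Ioc_self ht) _
    rw [← h3, ← this, Real.fourierInv_eq']
    simp
  have hcl : EqOn h 0 (closure (Ioo 0 τ)) := by
    refine EqOn.of_subset_closure (s := Ioo 0 τ) (fun t ht => hIoo t ht) ?_ continuousOn_const
      subset_closure subset_rfl
    rwa [closure_Ioo hτ.ne]
  rw [closure_Ioo hτ.ne] at hcl
  exact fun t ht => hcl ht

/-- A function of exponential type that is bounded on a left half-plane and on the part, outside
a sector `|Im λ| < κ Re λ`, of the complementary half-plane, is bounded: this is the principle of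
Phragmén and Lindelöf on the sector, whose opening is less than `π`. -/
theorem bounded_of_bounded_off_sector {F : ℂ → ℂ} (hF : Differentiable ℂ F) {κ A B R : ℝ}
    (hκ : 0 < κ) (hexp : ∀ l, ‖F l‖ ≤ A * Real.exp (B * ‖l‖))
    (hR : ∀ l : ℂ, κ * l.re ≤ |l.im| → ‖F l‖ ≤ R) (l : ℂ) : ‖F l‖ ≤ R := by
  by_cases hl : κ * l.re ≤ |l.im|
  · exact hR l hl
  push Not at hl
  have hre : 0 < l.re := by
    by_contra hcon
    have : κ * l.re ≤ 0 := mul_nonpos_of_nonneg_of_nonpos hκ.le (not_lt.1 hcon)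
    linarith [abs_nonneg l.im]
  set θ : ℝ := Real.arctan κ with hθ
  have hθ0 : 0 < θ := Real.arctan_pos.2 hκ
  have hθ1 : θ < Real.pi / 2 := Real.arctan_lt_pi_div_two κ
  have hπ := Real.pi_pos
  set q : ℝ := 4 * θ / Real.pi with hq
  have hq0 : 0 < q := by positivity
  have hq2 : q < 2 := by rw [hq, div_lt_iff₀ hπ]; linarith
  have hqc : (q : ℂ) ≠ 0 := by exact_mod_cast hq0.ne'
  have hcosθ : 0 < Real.cos θ := Real.cos_arctan_pos κ
  have hsinθ : Real.sin θ = κ * Real.cos θ := by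
    rw [← Real.tan_mul_cos hcosθ.ne', hθ, Real.tan_arctan]
  -- `w ↦ w ^ q exp (-i θ)` maps the first quadrant onto the sector `|arg| ≤ θ`
  set G : ℂ → ℂ := fun w => F (w ^ (q : ℂ) * exp (-(θ * I))) with hG
  have hnorm : ∀ w : ℂ, w ≠ 0 → ‖w ^ (q : ℂ) * exp (-(θ * I))‖ = ‖w‖ ^ q := by
    intro w hw
    rw [norm_mul, Complex.norm_cpow_real]
    have : ‖exp (-(θ * I))‖ = 1 := by
      rw [← neg_mul, ← ofReal_neg]; exact norm_exp_ofReal_mul_I _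
    rw [this, mul_one]
  -- both sides of the quadrant are sent to the two sides of the sector
  have hside : ∀ (r s : ℝ), 0 ≤ r → |s| = 1 →
      ‖F ((r : ℂ) * exp (s * θ * I))‖ ≤ R := by
    intro r s hr hs
    apply hR
    rw [show (s * θ * I : ℂ) = ((s * θ : ℝ) : ℂ) * I by push_cast; ring, exp_mul_I,
      ← ofReal_cos, ← ofReal_sin]
    have hc : Real.cos (s * θ) = Real.cos θ := by
      rcases abs_eq (zero_le_one' ℝ) |>.1 hs with h | h <;> simp [h]
    have hsn : |Real.sin (s * θ)| = Real.sin θ := by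
      have : 0 < Real.sin θ := by rw [hsinθ]; positivity
      rcases abs_eq (zero_le_one' ℝ) |>.1 hs with h | h <;> simp [h, abs_of_pos this]
    simp only [mul_re, ofReal_re, add_re, I_re, mul_zero, ofReal_im, I_im, mul_one, sub_self,
      add_zero, add_im, mul_im, zero_add, zero_mul, sub_zero]
    rw [hc, abs_mul, hsn, abs_of_nonneg hr, hsinθ]
    apply le_of_eq; ring
  have hGre : ∀ x : ℝ, 0 ≤ x → ‖G x‖ ≤ R := by
    intro x hx
    have := hside (x ^ q) (-1) (Real.rpow_nonneg hx _) (by simp)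
    simpa [hG, ofReal_cpow hx] using this
  have hGim : ∀ x : ℝ, 0 ≤ x → ‖G (x * I)‖ ≤ R := by
    intro x hx
    have := hside (x ^ q) 1 (Real.rpow_nonneg hx _) (by simp)
    have e : ((x * I : ℂ) ^ (q : ℂ)) * exp (-(θ * I)) = (x ^ q : ℝ) * exp ((1 : ℝ) * θ * I) := by
      rcases hx.eq_or_lt with rfl | hx
      · simp [hqc, hq0.ne']
      have hxI : (x : ℂ) * I ≠ 0 := mul_ne_zero (by exact_mod_cast hx.ne') I_ne_zero
      rw [ofReal_cpow hx.le, cpow_def_of_ne_zero hxI, log_ofReal_mul hx I_ne_zero, log_I,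
        cpow_def_of_ne_zero (by exact_mod_cast hx.ne'), ofReal_log hx.le, ← Complex.exp_add,
        ← Complex.exp_add]
      congr 1
      have : (Real.pi : ℂ) ≠ 0 := by exact_mod_cast hπ.ne'
      rw [hq]; push_cast
      field_simp
      ring
    simp only [hG]
    rw [e]; exact this
  have hd : DiffContOnCl ℂ G (Ioi 0 ×ℂ Ioi 0) := by
    constructor
    · intro w hw
      have hw' : w ∈ slitPlane := Or.inl hw.1
      refine DifferentiableAt.differentiableWithinAt ?_
      exact (hF _).comp w ((differentiableAt_id.cpow_const hw').mul_const _)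
    · rw [closure_reProdIm, _root_.closure_Ioi]
      intro w hw
      refine ContinuousAt.continuousWithinAt ?_
      refine hF.continuous.continuousAt.comp ?_
      refine ContinuousAt.mul ?_ continuousAt_const
      exact continuousAt_cpow_const_of_re_pos (Or.inl hw.1) (by simpa using hq0)
  have hgrow : ∃ c < (2 : ℝ), ∃ B, G =O[Bornology.cobounded ℂ ⊓ 𝓟 (Ioi 0 ×ℂ Ioi 0)]
      fun z => Real.exp (B * ‖z‖ ^ c) := by
    refine ⟨q, hq2, B, Asymptotics.IsBigO.of_bound A ?_⟩
    refine Filter.eventually_inf_principal.2 (Eventually.of_forall fun w hw => ?_)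
    have hw0 : w ≠ 0 := by rintro rfl; simpa using hw.1
    have := hexp (w ^ (q : ℂ) * exp (-(θ * I)))
    rw [hnorm w hw0] at this
    rwa [Real.norm_of_nonneg (Real.exp_pos _).le]
  have hl0 : l ≠ 0 := by rintro rfl; simp at hre
  -- the point of the quadrant that is sent to `l`
  set w : ℂ := exp ((log l + θ * I) / q) with hw
  have harg : |arg l| ≤ θ := by
    rw [abs_le]
    have e : arg l = Real.arctan (l.im / l.re) := by
      have h2 := abs_lt.1 (abs_arg_lt_pi_div_two_iff.2 (Or.inl hre))
      rw [← tan_arg, Real.arctan_tan h2.1 h2.2]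
    have h1 : |l.im / l.re| ≤ κ := by
      rw [abs_div, abs_of_pos hre, div_le_iff₀ hre]; exact hl.le
    rw [abs_le] at h1
    rw [e, hθ, ← Real.arctan_neg]
    exact ⟨Real.arctan_strictMono.monotone h1.1, Real.arctan_strictMono.monotone h1.2⟩
  rw [abs_le] at harg
  have him : ((log l + θ * I) / q).im = (arg l + θ) / q := by
    rw [div_ofReal_im]; simp [log_im]
  have him0 : 0 ≤ (arg l + θ) / q := by
    apply div_nonneg _ hq0.le; linarith [harg.1]
  have him1 : (arg l + θ) / q ≤ Real.pi / 2 := by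
    rw [div_le_iff₀ hq0, hq]
    have : Real.pi / 2 * (4 * θ / Real.pi) = 2 * θ := by field_simp; ring
    linarith [harg.2]
  have hwq : w ^ (q : ℂ) * exp (-(θ * I)) = l := by
    rw [hw, cpow_def_of_ne_zero (exp_ne_zero _), log_exp (by rw [him]; linarith)
      (by rw [him]; linarith), div_mul_cancel₀ _ hqc, ← Complex.exp_add]
    simp [exp_log hl0]
  have hwre : 0 ≤ w.re := by
    rw [hw, exp_re, him]
    exact mul_nonneg (Real.exp_pos _).le
      (Real.cos_nonneg_of_neg_pi_div_two_le_of_le (by linarith) him1)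
  have hwim : 0 ≤ w.im := by
    rw [hw, exp_im, him]
    exact mul_nonneg (Real.exp_pos _).le
      (Real.sin_nonneg_of_nonneg_of_le_pi him0 (by linarith))
  have := PhragmenLindelof.quadrant_I hd hgrow hGre hGim hwre hwim
  simpa only [hG, hwq] using this

/-- The transform is entire. If it is bounded outside a sector of a right half-plane, it is bounded
everywhere, hence constant by Liouville's theorem, and it tends to `0` at `-∞`. -/
theorem eq_zero_of_expTransform_bounded (hτ : 0 < τ) (hh : ContinuousOn h (Icc 0 τ))
    {μ₀ κ R : ℝ} (hκ : 0 < κ)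
    (hR : ∀ l : ℂ, μ₀ ≤ l.re → κ * l.re ≤ |l.im| → ‖expTransform τ h l‖ ≤ R) :
    ∀ t ∈ Icc 0 τ, h t = 0 := by
  obtain ⟨M, hM⟩ := isCompact_Icc.exists_bound_of_continuousOn hh
  have hM0 : 0 ≤ M := (norm_nonneg _).trans (hM 0 ⟨le_rfl, hτ.le⟩)
  have hd := differentiable_expTransform hτ.le hh
  have hbdd : ∀ l, ‖expTransform τ h l‖ ≤ max R (τ * M * Real.exp (τ * max μ₀ 0)) := by
    refine bounded_of_bounded_off_sector hd hκ (A := τ * M) (B := τ)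
      (fun l => norm_expTransform_le hτ.le hM l (norm_nonneg l) (re_le_norm l)) ?_
    intro l hl
    rcases le_total μ₀ l.re with h1 | h1
    · exact (hR l h1 hl).trans (le_max_left _ _)
    · exact (norm_expTransform_le hτ.le hM l (le_max_right _ _)
        (h1.trans (le_max_left _ _))).trans (le_max_right _ _)
  have hconst : ∀ l l', expTransform τ h l = expTransform τ h l' := fun l l' =>
    hd.apply_eq_apply_of_bounded (isBounded_iff_forall_norm_le.2
      ⟨_, by rintro _ ⟨x, rfl⟩; exact hbdd x⟩) l l'
  -- the constant is the limit at `-∞`, which is zero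
  have hlim : Tendsto (fun x : ℝ => expTransform τ h (-x : ℝ)) atTop (𝓝 0) := by
    have h0 : (0 : ℂ) = ∫ t in (0 : ℝ)..τ, (0 : ℂ) := by simp
    rw [h0]
    refine intervalIntegral.tendsto_integral_filter_of_dominated_convergence (fun _ => M) ?_ ?_
      (by simp) ?_
    · refine Eventually.of_forall fun x => ?_
      rw [uIoc_of_le hτ.le]
      exact (ContinuousOn.mul (by fun_prop) (hh.mono Ioc_subset_Icc_self)).aestronglyMeasurable
        measurableSet_Ioc
    · filter_upwards [eventually_ge_atTop 0] with x hx
      refine Eventually.of_forall fun t ht => ?_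
      rw [uIoc_of_le hτ.le] at ht
      rw [norm_mul, ← ofReal_mul, norm_exp_ofReal]
      have h1 : Real.exp (-x * (τ - t)) ≤ 1 := by
        rw [Real.exp_le_one_iff]
        have : 0 ≤ τ - t := by linarith [ht.2]
        nlinarith
      calc Real.exp (-x * (τ - t)) * ‖h t‖ ≤ 1 * M := by
            gcongr; exact hM t ⟨ht.1.le, ht.2⟩
        _ = M := one_mul M
    · have hne : ∀ᵐ t : ℝ, t ≠ τ := by simp [ae_iff, measure_singleton]
      filter_upwards [hne] with t htne ht
      rw [uIoc_of_le hτ.le] at ht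
      have h1 : 0 < τ - t := sub_pos.2 (lt_of_le_of_ne ht.2 htne)
      rw [show (0 : ℂ) = ((0 : ℝ) : ℂ) * h t by simp]
      refine Tendsto.mul_const _ ?_
      simp_rw [← ofReal_mul, ← ofReal_exp]
      refine (continuous_ofReal.tendsto _).comp ?_
      refine Real.tendsto_exp_atBot.comp ?_
      exact (tendsto_neg_atTop_atBot).atBot_mul_const h1
  refine eq_zero_of_expTransform_eq_zero hτ hh fun l => ?_
  refine tendsto_nhds_unique ?_ hlim
  simp_rw [fun x : ℝ => hconst (-x : ℝ) l]
  exact tendsto_const_nhds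

end

/-- A continuous curve is null as soon as its transforms along the kernels
`exp (μ (τ - t)) cos (ν (τ - t))` and `exp (μ (τ - t)) sin (ν (τ - t))` remain bounded for large
`μ` and `|ν| ≥ κ μ`. -/
theorem eq_zero_of_transforms_bounded {H : Type*} [NormedAddCommGroup H] [NormedSpace ℝ H]
    [CompleteSpace H] {τ : ℝ} {z : ℝ → H} (hτ : 0 < τ) (hz : ContinuousOn z (Icc 0 τ))
    {μ₀ κ R : ℝ} (hκ : 0 < κ)
    (hR : ∀ μ ν : ℝ, μ₀ ≤ μ → κ * μ ≤ |ν| →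
      ‖∫ t in (0 : ℝ)..τ, (Real.exp (μ * (τ - t)) * Real.cos (ν * (τ - t))) • z t‖ ≤ R ∧
      ‖∫ t in (0 : ℝ)..τ, (Real.exp (μ * (τ - t)) * Real.sin (ν * (τ - t))) • z t‖ ≤ R) :
    ∀ t ∈ Icc 0 τ, z t = 0 := by
  intro t ht
  refine SeparatingDual.eq_zero_of_forall_dual_eq_zero (R := ℝ) fun ℓ => ?_
  have hh : ContinuousOn (fun s => ((ℓ (z s) : ℝ) : ℂ)) (Icc 0 τ) :=
    continuous_ofReal.comp_continuousOn (ℓ.continuous.comp_continuousOn hz)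
  have key := eq_zero_of_expTransform_bounded hτ hh (μ₀ := μ₀) (κ := κ)
    (R := ‖ℓ‖ * R + ‖ℓ‖ * R) hκ ?_ t ht
  · exact_mod_cast key
  intro l h1 h2
  obtain ⟨hc, hs⟩ := hR l.re l.im h1 h2
  have hint : ∀ f : ℝ → ℝ, Continuous f →
      IntervalIntegrable (fun t => f t • z t) volume 0 τ := by
    intro f hf
    apply ContinuousOn.intervalIntegrable
    rw [uIcc_of_le hτ.le]
    exact hf.continuousOn.smul hz
  have hpull : ∀ f : ℝ → ℝ, Continuous f →
      ∫ t in (0 : ℝ)..τ, f t * ℓ (z t) = ℓ (∫ t in (0 : ℝ)..τ, f t • z t) := by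
    intro f hf
    rw [← ContinuousLinearMap.intervalIntegral_comp_comm ℓ (hint f hf)]
    simp
  have hint' : ∀ f : ℝ → ℝ, Continuous f →
      IntervalIntegrable (fun t => ((f t * ℓ (z t) : ℝ) : ℂ)) volume 0 τ := by
    intro f hf
    apply ContinuousOn.intervalIntegrable
    rw [uIcc_of_le hτ.le]
    exact continuous_ofReal.comp_continuousOn
      (hf.continuousOn.mul (ℓ.continuous.comp_continuousOn hz))
  set kc : ℝ → ℝ := fun t => Real.exp (l.re * (τ - t)) * Real.cos (l.im * (τ - t)) with hkc
  set ks : ℝ → ℝ := fun t => Real.exp (l.re * (τ - t)) * Real.sin (l.im * (τ - t)) with hks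
  have hkcc : Continuous kc := by fun_prop
  have hksc : Continuous ks := by fun_prop
  have e : expTransform τ (fun s => ((ℓ (z s) : ℝ) : ℂ)) l =
      ((ℓ (∫ t in (0 : ℝ)..τ, kc t • z t) : ℝ) : ℂ)
        + ((ℓ (∫ t in (0 : ℝ)..τ, ks t • z t) : ℝ) : ℂ) * I := by
    rw [← hpull kc hkcc, ← hpull ks hksc, ← intervalIntegral.integral_ofReal,
      ← intervalIntegral.integral_ofReal, ← intervalIntegral.integral_mul_const,
      ← intervalIntegral.integral_add (hint' kc hkcc) ((hint' ks hksc).mul_const I)]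
    refine intervalIntegral.integral_congr fun t _ => ?_
    have : l * (τ - t : ℝ) = ((l.re * (τ - t) : ℝ) : ℂ) + ((l.im * (τ - t) : ℝ) : ℂ) * I := by
      conv_lhs => rw [← re_add_im l]
      push_cast; ring
    simp only [this, Complex.exp_add, exp_mul_I, hkc, hks, ← ofReal_exp, ← ofReal_cos,
      ← ofReal_sin]
    push_cast; ring
  rw [e]
  refine (norm_add_le _ _).trans (add_le_add ?_ ?_)
  · rw [norm_real]
    exact (ℓ.le_opNorm _).trans (by gcongr)
  · rw [norm_mul, norm_I, mul_one, norm_real]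
    exact (ℓ.le_opNorm _).trans (by gcongr)

end

/-! ### Weak formulation of coupled evolution problems -/

/-- The bilinear forms of a weakly formulated evolution problem that couples an unknown `z` of
second order in time with an unknown `y` of first order. `H` and `Y` carry the energy norms, `X`
carries the norm of the velocities, and `val : H → X` forgets the space derivatives. Test fields
range over `V` and `VY`, on which the coercivity estimates hold. `K` is the inertia, `W` the energy
of `z`, `G` a perturbation of lower order, `b` the coupling, `Θ` the capacity, and `D` the
dissipation, which need not be symmetric. -/
structure EvolutionForms (H X Y : Type*) [NormedAddCommGroup H] [NormedSpace ℝ H]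
    [NormedAddCommGroup X] [NormedSpace ℝ X] [NormedAddCommGroup Y] [NormedSpace ℝ Y] where
  V : Submodule ℝ H
  VY : Submodule ℝ Y
  val : H →L[ℝ] X
  K : X →L[ℝ] X →L[ℝ] ℝ
  W : H →L[ℝ] H →L[ℝ] ℝ
  G : H →L[ℝ] X →L[ℝ] ℝ
  b : Y →L[ℝ] X →L[ℝ] ℝ
  Θ : Y →L[ℝ] Y →L[ℝ] ℝ
  D : Y →L[ℝ] Y →L[ℝ] ℝ
  K_symm : ∀ v w, K v w = K w v
  W_symm : ∀ v w, W v w = W w v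
  Θ_symm : ∀ v w, Θ v w = Θ w v
  K_coercive : ∃ r : ℝ, 0 < r ∧ ∀ w ∈ V, r * ‖val w‖ ^ 2 ≤ K (val w) (val w)
  W_coercive : ∃ r : ℝ, 0 < r ∧ ∀ w ∈ V, r * ‖w‖ ^ 2 ≤ W w w
  Θ_nonneg : ∀ η ∈ VY, 0 ≤ Θ η η
  D_coercive : ∃ r : ℝ, 0 < r ∧ ∀ η ∈ VY, r * ‖η‖ ^ 2 ≤ D η η + Θ η η

section
variable {H X Y : Type*} [NormedAddCommGroup H] [NormedSpace ℝ H]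
    [NormedAddCommGroup X] [NormedSpace ℝ X] [NormedAddCommGroup Y] [NormedSpace ℝ Y]

/-- Weak solutions on the time interval `S`; `v` is the time derivative of `z`. The sign `σ` of the
dissipative form is `1` for the backward and `-1` for the forward problem. -/
structure IsWeakSolution (E : EvolutionForms H X Y) (σ : ℝ) (S : Set ℝ)
    (z : ℝ → H) (v : ℝ → X) (y : ℝ → Y) : Prop where
  cont_z : ContinuousOn z S
  cont_y : ContinuousOn y S
  deriv_z : ∀ t ∈ S, HasDerivWithinAt (fun s => E.val (z s)) (v t) S t
  momentum : ∀ w ∈ E.V, ∀ t ∈ S, HasDerivWithinAt (fun s => E.K (v s) (E.val w))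
    (-E.W (z t) w - E.G (z t) (E.val w) + E.b (y t) (E.val w)) S t
  heat : ∀ η ∈ E.VY, ∀ t ∈ S, HasDerivWithinAt (fun s => E.Θ (y s) η + E.b η (E.val (z s)))
    (σ * E.D (y t) η) S t

namespace IsWeakSolution
variable {E : EvolutionForms H X Y} {σ : ℝ} {S : Set ℝ}
  {z z' : ℝ → H} {v v' : ℝ → X} {y y' : ℝ → Y}

theorem sub (h : IsWeakSolution E σ S z v y) (h' : IsWeakSolution E σ S z' v' y') :
    IsWeakSolution E σ S (fun t => z t - z' t) (fun t => v t - v' t) (fun t => y t - y' t) where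
  cont_z := h.cont_z.sub h'.cont_z
  cont_y := h.cont_y.sub h'.cont_y
  deriv_z t ht := by simpa using (h.deriv_z t ht).fun_sub (h'.deriv_z t ht)
  momentum w hw t ht := by
    have := (h.momentum w hw t ht).fun_sub (h'.momentum w hw t ht)
    simp only [map_sub, sub_apply]
    exact this.congr_deriv (by ring)
  heat η hη t ht := by
    have := (h.heat η hη t ht).fun_sub (h'.heat η hη t ht)
    simp only [map_sub, sub_apply]
    have e : ∀ s, E.Θ (y s) η + E.b η (E.val (z s)) - (E.Θ (y' s) η + E.b η (E.val (z' s))) =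
        E.Θ (y s) η - E.Θ (y' s) η + (E.b η (E.val (z s)) - E.b η (E.val (z' s))) :=
      fun s => by ring
    simp only [e] at this
    exact this.congr_deriv (by ring)

/-- Reversal of time turns forward into backward solutions. -/
theorem reverse {p q : ℝ} (h : IsWeakSolution E σ (Icc p q) z v y) :
    IsWeakSolution E (-σ) (Icc 0 (q - p)) (fun t => z (q - t)) (fun t => -v (q - t))
      (fun t => y (q - t)) := by
  have hm : MapsTo (fun t => q - t) (Icc 0 (q - p)) (Icc p q) := by
    intro t ht
    simp only [mem_Icc] at ht ⊢
    constructor <;> linarith [ht.1, ht.2]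
  have hd : ∀ t, HasDerivWithinAt (fun t => q - t) (-1) (Icc 0 (q - p)) t := fun t =>
    ((hasDerivAt_id t).const_sub q).hasDerivWithinAt
  have hc : ContinuousOn (fun t => q - t) (Icc 0 (q - p)) := by fun_prop
  refine ⟨h.cont_z.comp hc hm, h.cont_y.comp hc hm, fun t ht => ?_, fun w hw t ht => ?_,
    fun η hη t ht => ?_⟩
  · simpa [Function.comp_def] using (h.deriv_z _ (hm ht)).scomp t (hd t) hm
  · have := ((h.momentum w hw _ (hm ht)).scomp t (hd t) hm).fun_neg
    simp only [map_neg, neg_apply]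
    refine HasDerivWithinAt.congr_deriv this ?_
    simp
    ring
  · have := (h.heat η hη _ (hm ht)).scomp t (hd t) hm
    simpa [Function.comp_def] using this

end IsWeakSolution

/-- Integration by parts against `exp (μ (τ - t)) cos (ν (τ - t))` and
`exp (μ (τ - t)) sin (ν (τ - t))`. -/
theorem integral_kernel_mul_deriv {τ : ℝ} (hτ : 0 ≤ τ) {g g' : ℝ → ℝ}
    (hg : ∀ t ∈ Icc 0 τ, HasDerivWithinAt g (g' t) (Icc 0 τ) t)
    (hg' : ContinuousOn g' (Icc 0 τ)) (h0 : g 0 = 0) (μ ν : ℝ) :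
    (∫ t in (0 : ℝ)..τ, Real.exp (μ * (τ - t)) * Real.cos (ν * (τ - t)) * g' t) =
        g τ + μ * (∫ t in (0 : ℝ)..τ, Real.exp (μ * (τ - t)) * Real.cos (ν * (τ - t)) * g t)
          - ν * (∫ t in (0 : ℝ)..τ, Real.exp (μ * (τ - t)) * Real.sin (ν * (τ - t)) * g t) ∧
    (∫ t in (0 : ℝ)..τ, Real.exp (μ * (τ - t)) * Real.sin (ν * (τ - t)) * g' t) =
        μ * (∫ t in (0 : ℝ)..τ, Real.exp (μ * (τ - t)) * Real.sin (ν * (τ - t)) * g t)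
          + ν * (∫ t in (0 : ℝ)..τ, Real.exp (μ * (τ - t)) * Real.cos (ν * (τ - t)) * g t) := by
  have hgc : ContinuousOn g (Icc 0 τ) := fun t ht => (hg t ht).continuousWithinAt
  have hinn : ∀ t, HasDerivAt (fun s : ℝ => τ - s) (-1) t := fun t =>
    (hasDerivAt_id t).const_sub τ
  have hE : ∀ t, HasDerivAt (fun s => Real.exp (μ * (τ - s)))
      (Real.exp (μ * (τ - t)) * (μ * -1)) t := fun t => ((hinn t).const_mul μ).exp
  have hC : ∀ t, HasDerivAt (fun s => Real.exp (μ * (τ - s)) * Real.cos (ν * (τ - s)))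
      (Real.exp (μ * (τ - t)) * (μ * -1) * Real.cos (ν * (τ - t))
        + Real.exp (μ * (τ - t)) * (-Real.sin (ν * (τ - t)) * (ν * -1))) t := fun t =>
    (hE t).mul ((hinn t).const_mul ν).cos
  have hS : ∀ t, HasDerivAt (fun s => Real.exp (μ * (τ - s)) * Real.sin (ν * (τ - s)))
      (Real.exp (μ * (τ - t)) * (μ * -1) * Real.sin (ν * (τ - t))
        + Real.exp (μ * (τ - t)) * (Real.cos (ν * (τ - t)) * (ν * -1))) t := fun t =>
    (hE t).mul ((hinn t).const_mul ν).sin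
  have hint : ∀ k f : ℝ → ℝ, Continuous k → ContinuousOn f (Icc 0 τ) →
      IntervalIntegrable (fun t => k t * f t) volume 0 τ := by
    intro k f hk hf
    apply ContinuousOn.intervalIntegrable
    rw [uIcc_of_le hτ]
    exact hk.continuousOn.mul hf
  have hI : ∀ k : ℝ → ℝ, Continuous k → IntervalIntegrable k volume 0 τ := fun k hk =>
    hk.intervalIntegrable _ _
  have hgi : IntervalIntegrable g' volume 0 τ := by
    apply ContinuousOn.intervalIntegrable
    rwa [uIcc_of_le hτ]
  have hd : ∀ t ∈ Ioo (min 0 τ) (max 0 τ), HasDerivWithinAt g (g' t) (Ioi t) t := by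
    intro t ht
    rw [min_eq_left hτ, max_eq_right hτ] at ht
    exact ((hg t (Ioo_subset_Icc_self ht)).hasDerivAt (Icc_mem_nhds ht.1 ht.2)).hasDerivWithinAt
  have hgu : ContinuousOn g (uIcc 0 τ) := by rwa [uIcc_of_le hτ]
  constructor
  · have := intervalIntegral.integral_mul_deriv_eq_deriv_mul_of_hasDeriv_right
      (u := fun s => Real.exp (μ * (τ - s)) * Real.cos (ν * (τ - s)))
      (fun t _ => (hC t).continuousAt.continuousWithinAt) hgu
      (fun t _ => (hC t).hasDerivWithinAt) hd (hI _ (by fun_prop)) hgi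
    rw [this, ← intervalIntegral.integral_const_mul, ← intervalIntegral.integral_const_mul, h0,
      add_sub_assoc, ← intervalIntegral.integral_sub, sub_eq_add_neg _ (∫ t in (0 : ℝ)..τ, _),
      ← intervalIntegral.integral_neg]
    · congr 1
      · simp
      · refine intervalIntegral.integral_congr fun t _ => ?_
        ring
    · exact (hint _ g (by fun_prop) hgc).const_mul μ
    · exact (hint _ g (by fun_prop) hgc).const_mul ν
  · have := intervalIntegral.integral_mul_deriv_eq_deriv_mul_of_hasDeriv_right
      (u := fun s => Real.exp (μ * (τ - s)) * Real.sin (ν * (τ - s)))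
      (fun t _ => (hS t).continuousAt.continuousWithinAt) hgu
      (fun t _ => (hS t).hasDerivWithinAt) hd (hI _ (by fun_prop)) hgi
    rw [this, ← intervalIntegral.integral_const_mul, ← intervalIntegral.integral_const_mul, h0,
      ← intervalIntegral.integral_add, sub_eq_add_neg _ (∫ t in (0 : ℝ)..τ, _),
      ← intervalIntegral.integral_neg]
    · simp only [sub_self, mul_zero, Real.sin_zero, zero_mul, zero_add]
      refine intervalIntegral.integral_congr fun t _ => ?_
      ring
    · exact (hint _ g (by fun_prop) hgc).const_mul μ
    · exact (hint _ g (by fun_prop) hgc).const_mul ν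

/-- The integral of `k • z`, where `z` takes its values in `V`, lies in the closure of `V`. -/
theorem intervalIntegral_smul_mem_topologicalClosure [CompleteSpace H] {V : Submodule ℝ H} {τ : ℝ}
    (hτ : 0 ≤ τ) {z : ℝ → H} (hz : ContinuousOn z (Icc 0 τ)) (hV : ∀ t ∈ Icc 0 τ, z t ∈ V)
    {k : ℝ → ℝ} (hk : Continuous k) :
    (∫ t in (0 : ℝ)..τ, k t • z t) ∈ V.topologicalClosure := by
  have : IsClosed (V.topologicalClosure : Set H) := V.isClosed_topologicalClosure
  have hint : IntervalIntegrable (fun t => k t • z t) volume 0 τ := by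
    apply ContinuousOn.intervalIntegrable
    rw [uIcc_of_le hτ]
    exact hk.continuousOn.smul hz
  have h1 := ContinuousLinearMap.intervalIntegral_comp_comm V.topologicalClosure.mkQL hint
  have h2 : ∫ t in (0 : ℝ)..τ, V.topologicalClosure.mkQL (k t • z t) = 0 := by
    rw [intervalIntegral.integral_congr (g := fun _ => 0)]
    · simp
    · intro t ht
      rw [uIcc_of_le hτ] at ht
      simp only [Submodule.mkQL_apply]
      exact (Submodule.Quotient.mk_eq_zero _).2
        (Submodule.smul_mem _ _ (V.le_topologicalClosure (hV t ht)))
  rw [h2] at h1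
  exact (Submodule.Quotient.mk_eq_zero _).1 h1.symm

end

/-! ### Uniqueness for the weak backward problem -/

section
variable {H X Y : Type*} [NormedAddCommGroup H] [NormedSpace ℝ H]
    [NormedAddCommGroup X] [NormedSpace ℝ X] [NormedAddCommGroup Y] [NormedSpace ℝ Y]

theorem intervalIntegral_mul_apply [CompleteSpace H] {τ : ℝ} (hτ : 0 ≤ τ) {f : ℝ → H}
    (hf : ContinuousOn f (Icc 0 τ)) (ℓ : H →L[ℝ] ℝ) {k : ℝ → ℝ} (hk : Continuous k) :
    ∫ t in (0 : ℝ)..τ, k t * ℓ (f t) = ℓ (∫ t in (0 : ℝ)..τ, k t • f t) := by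
  rw [← ContinuousLinearMap.intervalIntegral_comp_comm]
  · simp
  · apply ContinuousOn.intervalIntegrable
    rw [uIcc_of_le hτ]
    exact hk.continuousOn.smul hf

theorem le_of_mem_closure {V : Submodule ℝ H} {f g : H → ℝ} (hf : Continuous f)
    (hg : Continuous g) (h : ∀ w ∈ V, f w ≤ g w) : ∀ w ∈ V.topologicalClosure, f w ≤ g w :=
  fun _ hw => closure_minimal (fun w hw => h w hw) (isClosed_le hf hg) hw

theorem eq_of_mem_closure {V : Submodule ℝ H} {f g : H → ℝ} (hf : Continuous f)
    (hg : Continuous g) (h : ∀ w ∈ V, f w = g w) : ∀ w ∈ V.topologicalClosure, f w = g w :=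
  fun _ hw => closure_minimal (fun w hw => h w hw) (isClosed_eq hf hg) hw

theorem norm_apply_add_le {A B : Type*} [NormedAddCommGroup A] [NormedSpace ℝ A]
    [NormedAddCommGroup B] [NormedSpace ℝ B] (T : A →L[ℝ] B →L[ℝ] ℝ) (a₁ a₂ : A) (b₁ b₂ : B) :
    |T a₁ b₁| + |T a₂ b₂| ≤ ‖T‖ * ((‖a₁‖ + ‖a₂‖) * (‖b₁‖ + ‖b₂‖)) := by
  have h1 : |T a₁ b₁| ≤ ‖T‖ * ‖a₁‖ * ‖b₁‖ := T.le_opNorm₂ a₁ b₁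
  have h2 : |T a₂ b₂| ≤ ‖T‖ * ‖a₂‖ * ‖b₂‖ := T.le_opNorm₂ a₂ b₂
  have h3 : 0 ≤ ‖T‖ * (‖a₁‖ * ‖b₂‖) := by positivity
  have h4 : 0 ≤ ‖T‖ * (‖a₂‖ * ‖b₁‖) := by positivity
  nlinarith

namespace EvolutionForms
variable (E : EvolutionForms H X Y)

/-- The resolvent estimate. The pairs `(zc, zs)`, `(yc, ys)`, `(vc, vs)` are the real and imaginary
parts of the transforms of `z`, `y` and of the velocity at `μ + i ν`; `z₁`, `x₁`, `y₁` are
the values of `z`, of the velocity and of `y` at the final time. The transforms stay bounded for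
large `μ` and `|ν| ≥ κ μ`. -/
theorem exists_resolvent_bound (z₁ : H) (x₁ : X) (y₁ : Y) :
    ∃ μ₀ κ R : ℝ, 0 < μ₀ ∧ 0 < κ ∧ ∀ μ ν : ℝ, μ₀ ≤ μ → κ * μ ≤ |ν| →
      ∀ zc ∈ E.V.topologicalClosure, ∀ zs ∈ E.V.topologicalClosure,
      ∀ yc ∈ E.VY.topologicalClosure, ∀ ys ∈ E.VY.topologicalClosure,
      ∀ vc ∈ E.V.topologicalClosure, ∀ vs ∈ E.V.topologicalClosure,
      vc = z₁ + μ • zc - ν • zs → vs = μ • zs + ν • zc →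
      (∀ w ∈ E.V, E.K x₁ (E.val w) + μ * E.K (E.val vc) (E.val w) - ν * E.K (E.val vs) (E.val w)
        = -E.W zc w - E.G zc (E.val w) + E.b yc (E.val w)) →
      (∀ w ∈ E.V, μ * E.K (E.val vs) (E.val w) + ν * E.K (E.val vc) (E.val w)
        = -E.W zs w - E.G zs (E.val w) + E.b ys (E.val w)) →
      (∀ η ∈ E.VY, E.Θ y₁ η + μ * E.Θ yc η - ν * E.Θ ys η + E.b η (E.val vc) = E.D yc η) →
      (∀ η ∈ E.VY, μ * E.Θ ys η + ν * E.Θ yc η + E.b η (E.val vs) = E.D ys η) →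
      ‖zc‖ ≤ R ∧ ‖zs‖ ≤ R ∧ ‖yc‖ ≤ R ∧ ‖ys‖ ≤ R := by
  obtain ⟨rK, hrK, hK⟩ := E.K_coercive
  obtain ⟨rW, hrW, hW⟩ := E.W_coercive
  obtain ⟨rD, hrD, hD⟩ := E.D_coercive
  have hK := le_of_mem_closure (by fun_prop) (by fun_prop) hK
  have hW := le_of_mem_closure (by fun_prop) (by fun_prop) hW
  have hD := le_of_mem_closure (by fun_prop) (by fun_prop) hD
  have hΘ := le_of_mem_closure (f := fun _ => 0) (by fun_prop) (by fun_prop) E.Θ_nonneg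
  set m : ℝ := min rK (min rW rD) / 2 with hm
  have hm0 : 0 < m := by positivity
  have hmK : 2 * m ≤ rK := by rw [hm]; linarith [min_le_left rK (min rW rD)]
  have hmW : 2 * m ≤ rW := by
    rw [hm]; linarith [min_le_right rK (min rW rD), min_le_left rW rD]
  have hmD : 2 * m ≤ rD := by
    rw [hm]; linarith [min_le_right rK (min rW rD), min_le_right rW rD]
  set C : ℝ := ‖E.K‖ * ‖x₁‖ + ‖E.W‖ * ‖z₁‖ + ‖E.G‖ + ‖E.b‖ + ‖E.Θ‖ * ‖y₁‖ + ‖E.D‖ with hC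
  have hC0 : 0 ≤ C := by positivity
  obtain ⟨hC1, hC2, hC3, hC4, hC5, hC6⟩ : ‖E.K‖ * ‖x₁‖ ≤ C ∧ ‖E.W‖ * ‖z₁‖ ≤ C ∧ ‖E.G‖ ≤ C ∧
      ‖E.b‖ ≤ C ∧ ‖E.Θ‖ * ‖y₁‖ ≤ C ∧ ‖E.D‖ ≤ C := by
    have h1 : 0 ≤ ‖E.K‖ * ‖x₁‖ := by positivity
    have h2 : 0 ≤ ‖E.W‖ * ‖z₁‖ := by positivity
    have h3 : 0 ≤ ‖E.Θ‖ * ‖y₁‖ := by positivity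
    have h4 := norm_nonneg E.G
    have h5 := norm_nonneg E.b
    have h6 := norm_nonneg E.D
    refine ⟨?_, ?_, ?_, ?_, ?_, ?_⟩ <;> rw [hC] <;> linarith
  clear_value m C
  obtain ⟨μ₀, κ, R, hμ₀, hκ, hR⟩ := exists_bound_of_resolvent_inequalities hm0 hC0
  refine ⟨μ₀, κ, R, hμ₀, hκ, ?_⟩
  intro μ ν hμ hν zc hzc zs hzs yc hyc ys hys vc hvc vs hvs evc evs eMc eMs eTc eTs
  have hμ0 : 0 < μ := hμ₀.trans_le hμ
  have eMc := eq_of_mem_closure (by fun_prop) (by fun_prop) eMc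
  have eMs := eq_of_mem_closure (by fun_prop) (by fun_prop) eMs
  have eTc := eq_of_mem_closure (by fun_prop) (by fun_prop) eTc
  have eTs := eq_of_mem_closure (by fun_prop) (by fun_prop) eTs
  have hsq : ∀ p q : ℝ, (p + q) ^ 2 ≤ 2 * (p ^ 2 + q ^ 2) := fun p q => by
    linarith [sq_nonneg (p - q)]
  have hTh0 : 0 ≤ E.Θ yc yc + E.Θ ys ys := add_nonneg (hΘ yc hyc) (hΘ ys hys)
  have key := hR μ ν (‖E.val vc‖ + ‖E.val vs‖) (‖zc‖ + ‖zs‖) (‖yc‖ + ‖ys‖)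
    (E.Θ yc yc + E.Θ ys ys) hμ hν (by positivity) (by positivity) (by positivity) hTh0 ?_ ?_ ?_
  · have h1 := norm_nonneg zc
    have h2 := norm_nonneg zs
    have h3 := norm_nonneg yc
    have h4 := norm_nonneg ys
    refine ⟨?_, ?_, ?_, ?_⟩ <;> linarith [key.1, key.2]
  · -- the real part of the momentum equation, tested with the velocity
    have e1 := eMc vc hvc
    have e2 := eMs vs hvs
    have eW : E.W zc vc + E.W zs vs = E.W z₁ zc + μ * (E.W zc zc + E.W zs zs) := by
      rw [evc, evs]
      simp only [map_sub, map_add, map_smul, smul_eq_mul]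
      rw [E.W_symm zs zc, E.W_symm zc z₁]
      ring
    rw [E.K_symm (E.val vs) (E.val vc)] at e1
    have e3 : μ * (E.K (E.val vc) (E.val vc) + E.K (E.val vs) (E.val vs)
        + (E.W zc zc + E.W zs zs)) = -E.K x₁ (E.val vc) - E.W z₁ zc
          - E.G zc (E.val vc) - E.G zs (E.val vs) + E.b yc (E.val vc) + E.b ys (E.val vs) := by
      linarith
    have l1 := hK vc hvc
    have l2 := hK vs hvs
    have l3 := hW zc hzc
    have l4 := hW zs hzs
    have l5 : m * ((‖E.val vc‖ + ‖E.val vs‖) ^ 2 + (‖zc‖ + ‖zs‖) ^ 2) ≤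
        E.K (E.val vc) (E.val vc) + E.K (E.val vs) (E.val vs) + (E.W zc zc + E.W zs zs) := by
      have i1 := mul_le_mul_of_nonneg_left (hsq ‖E.val vc‖ ‖E.val vs‖) hm0.le
      have i2 := mul_le_mul_of_nonneg_left (hsq ‖zc‖ ‖zs‖) hm0.le
      have i3 : 2 * m * (‖E.val vc‖ ^ 2 + ‖E.val vs‖ ^ 2) ≤
        rK * (‖E.val vc‖ ^ 2 + ‖E.val vs‖ ^ 2) := by gcongr
      have i4 : 2 * m * (‖zc‖ ^ 2 + ‖zs‖ ^ 2) ≤ rW * (‖zc‖ ^ 2 + ‖zs‖ ^ 2) := by gcongr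
      linarith
    refine (mul_le_mul_of_nonneg_left l5 hμ0.le).trans ?_
    rw [e3]
    have b1 : |E.K x₁ (E.val vc)| ≤ C * (‖E.val vc‖ + ‖E.val vs‖) := by
      refine (E.K.le_opNorm₂ _ _).trans ?_
      gcongr
      linarith [norm_nonneg (E.val vs)]
    have b2 : |E.W z₁ zc| ≤ C * (‖zc‖ + ‖zs‖) := by
      refine (E.W.le_opNorm₂ _ _).trans ?_
      gcongr
      linarith [norm_nonneg zs]
    have b3 : |E.G zc (E.val vc)| + |E.G zs (E.val vs)| ≤
        C * ((‖zc‖ + ‖zs‖) * (‖E.val vc‖ + ‖E.val vs‖)) :=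
      (norm_apply_add_le _ _ _ _ _).trans (by gcongr)
    have b4 : |E.b yc (E.val vc)| + |E.b ys (E.val vs)| ≤
        C * ((‖yc‖ + ‖ys‖) * (‖E.val vc‖ + ‖E.val vs‖)) :=
      (norm_apply_add_le _ _ _ _ _).trans (by gcongr)
    linarith [neg_le_abs (E.K x₁ (E.val vc)), neg_le_abs (E.W z₁ zc),
      neg_le_abs (E.G zc (E.val vc)), neg_le_abs (E.G zs (E.val vs)),
      le_abs_self (E.b yc (E.val vc)), le_abs_self (E.b ys (E.val vs))]
  · -- the real part of the heat equation, tested with `y`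
    have e1 := eTc yc hyc
    have e2 := eTs ys hys
    rw [E.Θ_symm ys yc] at e1
    have l1 := hD yc hyc
    have l2 := hD ys hys
    have i1 := mul_le_mul_of_nonneg_left (hsq ‖yc‖ ‖ys‖) hm0.le
    have i2 : 2 * m * (‖yc‖ ^ 2 + ‖ys‖ ^ 2) ≤ rD * (‖yc‖ ^ 2 + ‖ys‖ ^ 2) := by gcongr
    have b1 : |E.Θ y₁ yc| ≤ C * (‖yc‖ + ‖ys‖) := by
      refine (E.Θ.le_opNorm₂ _ _).trans ?_
      gcongr
      linarith [norm_nonneg ys]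
    have b2 : |E.b yc (E.val vc)| + |E.b ys (E.val vs)| ≤
        C * ((‖yc‖ + ‖ys‖) * (‖E.val vc‖ + ‖E.val vs‖)) :=
      (norm_apply_add_le _ _ _ _ _).trans (by gcongr)
    linarith [le_abs_self (E.Θ y₁ yc), le_abs_self (E.b yc (E.val vc)),
      le_abs_self (E.b ys (E.val vs))]
  · -- the imaginary part of the heat equation, tested with `y`
    have e1 := eTc ys hys
    have e2 := eTs yc hyc
    rw [E.Θ_symm ys yc] at e2
    have e3 : ν * (E.Θ yc yc + E.Θ ys ys) = E.Θ y₁ ys + E.b ys (E.val vc) - E.b yc (E.val vs)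
        - E.D yc ys + E.D ys yc := by linarith
    have e4 : |ν| * (E.Θ yc yc + E.Θ ys ys) = |ν * (E.Θ yc yc + E.Θ ys ys)| := by
      rw [abs_mul, abs_of_nonneg hTh0]
    rw [e4, e3]
    have b1 : |E.Θ y₁ ys| ≤ C * (‖yc‖ + ‖ys‖) := by
      refine (E.Θ.le_opNorm₂ _ _).trans ?_
      gcongr
      linarith [norm_nonneg yc]
    have b2 : |E.b yc (E.val vs)| + |E.b ys (E.val vc)| ≤
        C * ((‖yc‖ + ‖ys‖) * (‖E.val vc‖ + ‖E.val vs‖)) := by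
      rw [add_comm ‖E.val vc‖]
      exact (norm_apply_add_le _ _ _ _ _).trans (by gcongr)
    have b3 : |E.D yc ys| + |E.D ys yc| ≤ C * (‖yc‖ + ‖ys‖) ^ 2 := by
      rw [sq]
      refine (norm_apply_add_le _ _ _ _ _).trans ?_
      rw [add_comm ‖ys‖]
      gcongr
    have n1 := abs_le.1 (le_refl |E.Θ y₁ ys|)
    have n2 := abs_le.1 (le_refl |E.b ys (E.val vc)|)
    have n3 := abs_le.1 (le_refl |E.b yc (E.val vs)|)
    have n4 := abs_le.1 (le_refl |E.D yc ys|)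
    have n5 := abs_le.1 (le_refl |E.D ys yc|)
    rw [abs_le]
    constructor <;> linarith [n1.1, n1.2, n2.1, n2.2, n3.1, n3.2, n4.1, n4.2, n5.1, n5.2]

end EvolutionForms

/-- Weak solutions of the backward problem with null initial data are null. The velocity `v` takes its
values in `X` and need not be `val` of a test field; but its transforms are tested through `K`,
where integration by parts expresses them by those of `z` and the final value `z τ`. -/
theorem IsWeakSolution.eq_zero [CompleteSpace H] [CompleteSpace Y]
    {E : EvolutionForms H X Y} {τ : ℝ} (hτ : 0 < τ)
    {z : ℝ → H} {v : ℝ → X} {y : ℝ → Y} (h : IsWeakSolution E 1 (Icc 0 τ) z v y)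
    (hz : ∀ t ∈ Icc 0 τ, z t ∈ E.V) (hy : ∀ t ∈ Icc 0 τ, y t ∈ E.VY)
    (hz0 : z 0 = 0) (hv0 : v 0 = 0) (hy0 : y 0 = 0) :
    ∀ t ∈ Icc 0 τ, z t = 0 ∧ y t = 0 := by
  obtain ⟨μ₀, κ, R, hμ₀, hκ, hR⟩ := E.exists_resolvent_bound (z τ) (v τ) (y τ)
  have hmemτ : τ ∈ Icc 0 τ := ⟨hτ.le, le_rfl⟩
  suffices hb : ∀ μ ν : ℝ, μ₀ ≤ μ → κ * μ ≤ |ν| →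
      ‖∫ t in (0 : ℝ)..τ, (Real.exp (μ * (τ - t)) * Real.cos (ν * (τ - t))) • z t‖ ≤ R ∧
      ‖∫ t in (0 : ℝ)..τ, (Real.exp (μ * (τ - t)) * Real.sin (ν * (τ - t))) • z t‖ ≤ R ∧
      ‖∫ t in (0 : ℝ)..τ, (Real.exp (μ * (τ - t)) * Real.cos (ν * (τ - t))) • y t‖ ≤ R ∧
      ‖∫ t in (0 : ℝ)..τ, (Real.exp (μ * (τ - t)) * Real.sin (ν * (τ - t))) • y t‖ ≤ R from
    fun t ht => ⟨eq_zero_of_transforms_bounded hτ h.cont_z hκ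
        (fun μ ν h1 h2 => ⟨(hb μ ν h1 h2).1, (hb μ ν h1 h2).2.1⟩) t ht,
      eq_zero_of_transforms_bounded hτ h.cont_y hκ
        (fun μ ν h1 h2 => (hb μ ν h1 h2).2.2) t ht⟩
  intro μ ν hμ hν
  set kc : ℝ → ℝ := fun t => Real.exp (μ * (τ - t)) * Real.cos (ν * (τ - t)) with hkc
  set ks : ℝ → ℝ := fun t => Real.exp (μ * (τ - t)) * Real.sin (ν * (τ - t)) with hks
  have hkcc : Continuous kc := by fun_prop
  have hksc : Continuous ks := by fun_prop
  have hci : ∀ f : ℝ → ℝ, ContinuousOn f (Icc 0 τ) → ∀ k : ℝ → ℝ, Continuous k →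
      IntervalIntegrable (fun t => k t * f t) volume 0 τ := by
    intro f hf k hk
    apply ContinuousOn.intervalIntegrable
    rw [uIcc_of_le hτ.le]
    exact hk.continuousOn.mul hf
  set zc := ∫ t in (0 : ℝ)..τ, kc t • z t with hzc
  set zs := ∫ t in (0 : ℝ)..τ, ks t • z t with hzs
  set yc := ∫ t in (0 : ℝ)..τ, kc t • y t with hyc
  set ys := ∫ t in (0 : ℝ)..τ, ks t • y t with hys
  have mzc := intervalIntegral_smul_mem_topologicalClosure hτ.le h.cont_z hz hkcc
  have mzs := intervalIntegral_smul_mem_topologicalClosure hτ.le h.cont_z hz hksc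
  have myc := intervalIntegral_smul_mem_topologicalClosure hτ.le h.cont_y hy hkcc
  have mys := intervalIntegral_smul_mem_topologicalClosure hτ.le h.cont_y hy hksc
  have mz1 := E.V.le_topologicalClosure (hz τ hmemτ)
  -- right-hand side of the momentum equation
  have hrhs : ∀ w (k : ℝ → ℝ), Continuous k →
      ∫ t in (0 : ℝ)..τ, k t * (-E.W (z t) w - E.G (z t) (E.val w) + E.b (y t) (E.val w)) =
        -E.W (∫ t in (0 : ℝ)..τ, k t • z t) w - E.G (∫ t in (0 : ℝ)..τ, k t • z t) (E.val w)
          + E.b (∫ t in (0 : ℝ)..τ, k t • y t) (E.val w) := by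
    intro w k hk
    have a1 := intervalIntegral_mul_apply hτ.le h.cont_z (-(E.W.flip w) - E.G.flip (E.val w)) hk
    have a2 := intervalIntegral_mul_apply hτ.le h.cont_y (E.b.flip (E.val w)) hk
    simp only [neg_apply, sub_apply, ContinuousLinearMap.flip_apply] at a1 a2
    rw [← a1, ← a2, ← intervalIntegral.integral_add]
    · simp only [mul_add]
    · exact hci _ (((E.W.flip w).continuous.comp_continuousOn h.cont_z).neg.sub
        ((E.G.flip (E.val w)).continuous.comp_continuousOn h.cont_z)) k hk
    · exact hci _ ((E.b.flip (E.val w)).continuous.comp_continuousOn h.cont_y) k hk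
  -- the transforms of the velocity, read off from `K`
  have hvel : ∀ w ∈ E.V,
      ∫ t in (0 : ℝ)..τ, kc t * E.K (v t) (E.val w) =
          E.K (E.val (z τ + μ • zc - ν • zs)) (E.val w) ∧
      ∫ t in (0 : ℝ)..τ, ks t * E.K (v t) (E.val w) =
          E.K (E.val (μ • zs + ν • zc)) (E.val w) := by
    intro w hw
    have hd : ∀ t ∈ Icc 0 τ, HasDerivWithinAt (fun s => E.K (E.val (z s)) (E.val w))
        (E.K (v t) (E.val w)) (Icc 0 τ) t := fun t ht =>
      (E.K.flip (E.val w)).hasFDerivAt.comp_hasDerivWithinAt t (h.deriv_z t ht)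
    have := integral_kernel_mul_deriv hτ.le hd
      (fun t ht => (h.momentum w hw t ht).continuousWithinAt) (by simp [hz0]) μ ν
    have a1 := intervalIntegral_mul_apply hτ.le h.cont_z ((E.K.flip (E.val w)).comp E.val) hkcc
    have a2 := intervalIntegral_mul_apply hτ.le h.cont_z ((E.K.flip (E.val w)).comp E.val) hksc
    simp only [ContinuousLinearMap.comp_apply, ContinuousLinearMap.flip_apply, hkc, hks] at a1 a2
    rw [a1, a2] at this
    simpa using this
  refine hR μ ν hμ hν zc mzc zs mzs yc myc ys mys _
    (Submodule.sub_mem _ (Submodule.add_mem _ mz1 (Submodule.smul_mem _ μ mzc))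
      (Submodule.smul_mem _ ν mzs)) _
    (Submodule.add_mem _ (Submodule.smul_mem _ μ mzs) (Submodule.smul_mem _ ν mzc))
    rfl rfl ?_ ?_ ?_ ?_
  · intro w hw
    rw [← hrhs w kc hkcc, (integral_kernel_mul_deriv hτ.le (h.momentum w hw)
      ?_ (by simp [hv0]) μ ν).1, (hvel w hw).1, (hvel w hw).2]
    exact (((E.W.flip w).continuous.comp_continuousOn h.cont_z).neg.sub
        ((E.G.flip (E.val w)).continuous.comp_continuousOn h.cont_z)).add
          ((E.b.flip (E.val w)).continuous.comp_continuousOn h.cont_y)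
  · intro w hw
    rw [← hrhs w ks hksc, (integral_kernel_mul_deriv hτ.le (h.momentum w hw)
      ?_ (by simp [hv0]) μ ν).2, (hvel w hw).1, (hvel w hw).2]
    exact (((E.W.flip w).continuous.comp_continuousOn h.cont_z).neg.sub
        ((E.G.flip (E.val w)).continuous.comp_continuousOn h.cont_z)).add
          ((E.b.flip (E.val w)).continuous.comp_continuousOn h.cont_y)
  all_goals
    intro η hη
    have cD : ContinuousOn (fun t => 1 * E.D (y t) η) (Icc 0 τ) := by
      simpa [Function.comp_def] using (E.D.flip η).continuous.comp_continuousOn h.cont_y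
    have key := integral_kernel_mul_deriv hτ.le (h.heat η hη) cD (by simp [hz0, hy0]) μ ν
    have cΘ : ContinuousOn (fun t => E.Θ (y t) η) (Icc 0 τ) :=
      (E.Θ.flip η).continuous.comp_continuousOn h.cont_y
    have cb : ContinuousOn (fun t => E.b η (E.val (z t))) (Icc 0 τ) :=
      ((E.b η).comp E.val).continuous.comp_continuousOn h.cont_z
    have split : ∀ k : ℝ → ℝ, Continuous k →
        ∫ t in (0 : ℝ)..τ, k t * (E.Θ (y t) η + E.b η (E.val (z t))) =
          E.Θ (∫ t in (0 : ℝ)..τ, k t • y t) η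
            + E.b η (E.val (∫ t in (0 : ℝ)..τ, k t • z t)) := by
      intro k hk
      have a1 := intervalIntegral_mul_apply hτ.le h.cont_y (E.Θ.flip η) hk
      have a2 := intervalIntegral_mul_apply hτ.le h.cont_z ((E.b η).comp E.val) hk
      simp only [ContinuousLinearMap.comp_apply, ContinuousLinearMap.flip_apply] at a1 a2
      rw [← a1, ← a2, ← intervalIntegral.integral_add (hci _ cΘ k hk) (hci _ cb k hk)]
      simp only [mul_add]
    have d1 := intervalIntegral_mul_apply hτ.le h.cont_y (E.D.flip η) hkcc
    have d2 := intervalIntegral_mul_apply hτ.le h.cont_y (E.D.flip η) hksc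
    have s1 := split kc hkcc
    have s2 := split ks hksc
    simp only [ContinuousLinearMap.flip_apply, hkc, hks] at d1 d2 s1 s2
    simp only [one_mul, d1, d2, s1, s2] at key
    simp only [map_add, map_sub, map_smul, smul_eq_mul, hyc, hys, hkc, hks]
  · linarith [key.1]
  · linarith [key.2]

end

/-! ### Partial derivatives and static fields -/

/-- Bounded open sets, as a class, so that both properties of `Ω` are found by inference. -/
class BoundedOpen (Ω : Set Space) : Prop where
  isOpen : IsOpen Ω
  isBounded : Bornology.IsBounded Ω

section
variable {Ω : Set Space} {f g c : Space → ℝ} {x : Space} {j : Fin 3}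

theorem pd_add (hf : DifferentiableAt ℝ f x) (hg : DifferentiableAt ℝ g x) :
    pd j (fun y => f y + g y) x = pd j f x + pd j g x := by
  simp [pd, fderiv_fun_add hf hg]

theorem pd_sub (hf : DifferentiableAt ℝ f x) (hg : DifferentiableAt ℝ g x) :
    pd j (fun y => f y - g y) x = pd j f x - pd j g x := by
  simp [pd, fderiv_fun_sub hf hg]

theorem pd_mul (hf : DifferentiableAt ℝ f x) (hg : DifferentiableAt ℝ g x) :
    pd j (fun y => f y * g y) x = pd j f x * g x + f x * pd j g x := by
  simp only [pd, fderiv_fun_mul hf hg, add_apply, smul_apply, smul_eq_mul]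
  ring

theorem pd_sum {ι : Type*} {s : Finset ι} {F : ι → Space → ℝ}
    (hF : ∀ i ∈ s, DifferentiableAt ℝ (F i) x) :
    pd j (fun y => ∑ i ∈ s, F i y) x = ∑ i ∈ s, pd j (F i) x := by
  simp [pd, fderiv_fun_sum hF, sum_apply]

theorem pd_congr (hΩ : IsOpen Ω) (h : ∀ y ∈ Ω, f y = g y) (hx : x ∈ Ω) : pd j f x = pd j g x := by
  have : f =ᶠ[𝓝 x] g := by filter_upwards [hΩ.mem_nhds hx] with y hy using h y hy
  rw [pd, pd, this.fderiv_eq]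

/-- The operator norm of the derivative is controlled by the partial derivatives. -/
theorem norm_fderiv_le_of_pd_le {K : ℝ} (h : ∀ j, |pd j f x| ≤ K) : ‖fderiv ℝ f x‖ ≤ 3 * K := by
  have hK : 0 ≤ K := (abs_nonneg _).trans (h 0)
  refine ContinuousLinearMap.opNorm_le_bound _ (by positivity) fun v => ?_
  have hv : v = ∑ j, v j • EuclideanSpace.single j (1 : ℝ) := by
    have := (EuclideanSpace.basisFun (Fin 3) ℝ).sum_repr v
    simpa using this.symm
  conv_lhs => rw [hv]
  simp only [map_sum, map_smul, smul_eq_mul]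
  refine (norm_sum_le _ _).trans ?_
  calc ∑ i, ‖v i * fderiv ℝ f x (EuclideanSpace.single i 1)‖ ≤ ∑ _i : Fin 3, ‖v‖ * K := by
        refine Finset.sum_le_sum fun i _ => ?_
        rw [norm_mul]
        gcongr
        · exact PiLp.norm_apply_le v i
        · exact h i
    _ = 3 * K * ‖v‖ := by simp; ring

theorem CoeffC0.const (a : ℝ) : CoeffC0 Ω fun _ => a :=
  ⟨continuousOn_const, |a|, fun _ _ => le_rfl⟩

theorem CoeffC0.congr (hf : CoeffC0 Ω f) (h : ∀ x ∈ Ω, g x = f x) : CoeffC0 Ω g :=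
  ⟨hf.1.congr h, hf.2.imp fun K hK x hx => by rw [h x hx]; exact hK x hx⟩

theorem CoeffC0.add (hf : CoeffC0 Ω f) (hg : CoeffC0 Ω g) : CoeffC0 Ω fun x => f x + g x := by
  obtain ⟨hf, K, hK⟩ := hf
  obtain ⟨hg, L, hL⟩ := hg
  exact ⟨hf.add hg, K + L, fun x hx => (abs_add_le _ _).trans (add_le_add (hK x hx) (hL x hx))⟩

theorem CoeffC0.neg (hf : CoeffC0 Ω f) : CoeffC0 Ω fun x => -f x :=
  ⟨hf.1.neg, hf.2.imp fun K hK x hx => by rw [abs_neg]; exact hK x hx⟩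

theorem CoeffC0.sub (hf : CoeffC0 Ω f) (hg : CoeffC0 Ω g) : CoeffC0 Ω fun x => f x - g x := by
  simpa only [sub_eq_add_neg] using hf.add hg.neg

theorem CoeffC0.mul (hf : CoeffC0 Ω f) (hg : CoeffC0 Ω g) : CoeffC0 Ω fun x => f x * g x := by
  obtain ⟨hf, K, hK⟩ := hf
  obtain ⟨hg, L, hL⟩ := hg
  refine ⟨hf.mul hg, K * L, fun x hx => ?_⟩
  rw [abs_mul]
  exact mul_le_mul (hK x hx) (hL x hx) (abs_nonneg _) ((abs_nonneg _).trans (hK x hx))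

theorem CoeffC0.sum {ι : Type*} {s : Finset ι} {F : ι → Space → ℝ}
    (hF : ∀ i ∈ s, CoeffC0 Ω (F i)) : CoeffC0 Ω fun x => ∑ i ∈ s, F i x := by
  classical
  induction s using Finset.induction_on with
  | empty => simpa using CoeffC0.const (Ω := Ω) 0
  | insert i s hi ih =>
    simp_rw [Finset.sum_insert hi]
    exact (hF i (Finset.mem_insert_self i s)).add
      (ih fun k hk => hF k (Finset.mem_insert_of_mem hk))

theorem CoeffC1.c0 (hf : CoeffC1 Ω f) : CoeffC0 Ω f :=
  ⟨hf.1.continuousOn, hf.2.imp fun _ hK x hx => (hK x hx).1⟩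

theorem CoeffC1.of_pd (hf : ContDiffOn ℝ 1 f Ω) (h0 : CoeffC0 Ω f)
    (h : ∀ j, ∃ K, ∀ x ∈ Ω, |DoublePorosity.pd j f x| ≤ K) : CoeffC1 Ω f := by
  obtain ⟨-, K, hK⟩ := h0
  choose L hL using h
  refine ⟨hf, |K| + ∑ j, |L j|, fun x hx => ⟨?_, fun j => ?_⟩⟩
  · have : 0 ≤ ∑ j, |L j| := Finset.sum_nonneg fun j _ => abs_nonneg _
    linarith [hK x hx, le_abs_self K]
  · have : |L j| ≤ ∑ j, |L j| :=
      Finset.single_le_sum (f := fun j => |L j|) (fun j _ => abs_nonneg _) (Finset.mem_univ j)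
    linarith [hL j x hx, le_abs_self (L j), abs_nonneg K]

theorem CoeffC1.const (a : ℝ) : CoeffC1 Ω fun _ => a :=
  .of_pd contDiffOn_const (.const a) fun j => ⟨0, fun x _ => by simp [DoublePorosity.pd]⟩

variable [hΩ : BoundedOpen Ω]

theorem CoeffC1.differentiableAt (hf : CoeffC1 Ω f) (hx : x ∈ Ω) : DifferentiableAt ℝ f x :=
  (hf.1.differentiableOn one_ne_zero).differentiableAt (hΩ.isOpen.mem_nhds hx)

theorem continuousOn_pd (hf : ContDiffOn ℝ 1 f Ω) (j : Fin 3) : ContinuousOn (pd j f) Ω :=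
  (hf.continuousOn_fderiv_of_isOpen hΩ.isOpen le_rfl).clm_apply continuousOn_const

theorem CoeffC1.pd (hf : CoeffC1 Ω f) (j : Fin 3) : CoeffC0 Ω (pd j f) :=
  ⟨continuousOn_pd hf.1 j, hf.2.imp fun _ hK x hx => (hK x hx).2 j⟩

theorem CoeffC1.add (hf : CoeffC1 Ω f) (hg : CoeffC1 Ω g) : CoeffC1 Ω fun x => f x + g x := by
  refine .of_pd (hf.1.add hg.1) (hf.c0.add hg.c0) fun j => ?_
  refine (((hf.pd j).add (hg.pd j)).congr fun x hx => ?_).2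
  exact pd_add (hf.differentiableAt hx) (hg.differentiableAt hx)

theorem CoeffC1.sub (hf : CoeffC1 Ω f) (hg : CoeffC1 Ω g) : CoeffC1 Ω fun x => f x - g x := by
  refine .of_pd (hf.1.sub hg.1) (hf.c0.sub hg.c0) fun j => ?_
  refine (((hf.pd j).sub (hg.pd j)).congr fun x hx => ?_).2
  exact pd_sub (hf.differentiableAt hx) (hg.differentiableAt hx)

theorem CoeffC1.mul (hf : CoeffC1 Ω f) (hg : CoeffC1 Ω g) : CoeffC1 Ω fun x => f x * g x := by
  refine .of_pd (hf.1.mul hg.1) (hf.c0.mul hg.c0) fun j => ?_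
  refine ((((hf.pd j).mul hg.c0).add (hf.c0.mul (hg.pd j))).congr fun x hx => ?_).2
  exact pd_mul (hf.differentiableAt hx) (hg.differentiableAt hx)

theorem CoeffC1.sum {ι : Type*} {s : Finset ι} {F : ι → Space → ℝ}
    (hF : ∀ i ∈ s, CoeffC1 Ω (F i)) : CoeffC1 Ω fun x => ∑ i ∈ s, F i x := by
  classical
  induction s using Finset.induction_on with
  | empty => simpa using CoeffC1.const (Ω := Ω) 0
  | insert i s hi ih =>
    simp_rw [Finset.sum_insert hi]
    exact (hF i (Finset.mem_insert_self i s)).add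
      (ih fun k hk => hF k (Finset.mem_insert_of_mem hk))

theorem StaticField.c1 (hf : StaticField Ω f) : CoeffC1 Ω f := by
  have hc : IsCompact (closure Ω) := hΩ.isBounded.isCompact_closure
  obtain ⟨K, hK⟩ := hc.exists_bound_of_continuousOn hf.cont
  exact .of_pd hf.diff ⟨hf.cont.mono subset_closure, K, fun x hx => hK x (subset_closure hx)⟩
    hf.bdd

/-- The product of a `C¹` function with bounded derivatives and an admissible static field is
an admissible static field, once it is given the value `0` off `Ω`. -/
theorem CoeffC1.staticField_mul {w : Space → ℝ} (hf : CoeffC1 Ω f) (hw : StaticField Ω w) :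
    StaticField Ω (Ω.indicator fun x => f x * w x) := by
  have hm := hf.mul hw.c1
  obtain ⟨K, hK⟩ := hf.c0.2
  have heq : ∀ x ∈ Ω, Ω.indicator (fun x => f x * w x) x = f x * w x :=
    fun x hx => indicator_of_mem hx _
  have hfr : ∀ x ∈ frontier Ω, x ∉ Ω := fun x hx => by
    rw [hΩ.isOpen.frontier_eq] at hx; exact hx.2
  refine ⟨?_, fun x hx => indicator_of_notMem (hfr x hx) _, hm.1.congr heq, fun j => ?_⟩
  · intro x hx
    by_cases hxΩ : x ∈ Ω
    · have : ContinuousAt (fun x => f x * w x) x :=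
        hm.c0.1.continuousAt (hΩ.isOpen.mem_nhds hxΩ)
      refine (this.congr ?_).continuousWithinAt
      filter_upwards [hΩ.isOpen.mem_nhds hxΩ] with y hy using (heq y hy).symm
    · have hxf : x ∈ frontier Ω := by rw [hΩ.isOpen.frontier_eq]; exact ⟨hx, hxΩ⟩
      have hwx : Tendsto w (𝓝[closure Ω] x) (𝓝 0) := by
        have := hw.cont x hx
        rwa [ContinuousWithinAt, hw.null x hxf] at this
      rw [ContinuousWithinAt, indicator_of_notMem hxΩ]
      refine squeeze_zero_norm' (a := fun y => |K| * |w y|) ?_ (by simpa using hwx.abs.const_mul |K|)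
      refine Eventually.of_forall fun y => ?_
      by_cases hy : y ∈ Ω
      · rw [heq y hy, norm_mul]
        exact mul_le_mul_of_nonneg_right ((hK y hy).trans (le_abs_self K)) (abs_nonneg _)
      · rw [indicator_of_notMem hy, norm_zero]; positivity
  · exact ((hm.pd j).congr fun x hx => pd_congr hΩ.isOpen heq hx).2

/-- An admissible static field at `x ∈ Ω` is bounded by a multiple of the distance from `x` to any
point outside `Ω`. -/
theorem StaticField.abs_le_dist {K : ℝ} (hf : StaticField Ω f)
    (hK : ∀ x ∈ Ω, ‖fderiv ℝ f x‖ ≤ K) {x y : Space} (hx : x ∈ Ω) (hy : y ∉ Ω) :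
    |f x| ≤ K * ‖y - x‖ := by
  set γ : ℝ → Space := fun s => x + s • (y - x) with hγ
  have hγc : Continuous γ := by fun_prop
  set A : Set ℝ := Icc 0 1 ∩ γ ⁻¹' Ωᶜ with hA
  have hAc : IsClosed A := isClosed_Icc.inter (hΩ.isOpen.isClosed_compl.preimage hγc)
  have hAn : A.Nonempty := ⟨1, by simp, by simpa [hγ] using hy⟩
  have hAb : BddBelow A := ⟨0, fun s hs => hs.1.1⟩
  -- `s₀` is the first time at which the segment leaves `Ω`
  set s₀ := sInf A with hs₀
  have hs₀A : s₀ ∈ A := hAc.csInf_mem hAn hAb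
  have hin : ∀ s ∈ Ico 0 s₀, γ s ∈ Ω := by
    intro s hs
    by_contra hcon
    exact absurd (csInf_le hAb ⟨⟨hs.1, hs.2.le.trans hs₀A.1.2⟩, hcon⟩) (not_le.2 hs.2)
  have hpos : 0 < s₀ := by
    rcases hs₀A.1.1.eq_or_lt with h | h
    · exact absurd (show γ s₀ ∈ Ω by rw [← h]; simpa [hγ] using hx) hs₀A.2
    · exact h
  have hcl : γ s₀ ∈ closure Ω := by
    have h1 : s₀ ∈ closure (Ico 0 s₀) := by
      rw [closure_Ico hpos.ne]; exact right_mem_Icc.2 hpos.le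
    exact map_mem_closure hγc h1 hin
  have hfr : γ s₀ ∈ frontier Ω := by rw [hΩ.isOpen.frontier_eq]; exact ⟨hcl, hs₀A.2⟩
  have hcont : ContinuousOn (f ∘ γ) (Icc 0 s₀) := by
    refine hf.cont.comp hγc.continuousOn fun s hs => ?_
    rcases hs.2.eq_or_lt with h | h
    · rw [h]; exact hcl
    · exact subset_closure (hin s ⟨hs.1, h⟩)
  have hγd : ∀ s, HasDerivAt γ (y - x) s := fun s =>
    (((hasDerivAt_id s).smul_const (y - x)).const_add x).congr_deriv (one_smul _ _)
  obtain ⟨s, hs, hsl⟩ := exists_hasDerivAt_eq_slope (f ∘ γ)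
    (fun s => fderiv ℝ f (γ s) (y - x)) hpos hcont fun s hs =>
      (hf.c1.differentiableAt (hin s ⟨hs.1.le, hs.2⟩)).hasFDerivAt.comp_hasDerivAt s (hγd s)
  have e0 : (f ∘ γ) 0 = f x := by simp [hγ]
  have e1 : (f ∘ γ) s₀ = 0 := hf.null _ hfr
  rw [e0, e1, sub_zero, eq_div_iff hpos.ne'] at hsl
  have hb : |fderiv ℝ f (γ s) (y - x)| ≤ K * ‖y - x‖ :=
    ((fderiv ℝ f (γ s)).le_opNorm _).trans
      (mul_le_mul_of_nonneg_right (hK _ (hin s ⟨hs.1.le, hs.2⟩)) (norm_nonneg _))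
  have : |f x| = |fderiv ℝ f (γ s) (y - x)| * s₀ := by
    rw [← abs_neg (f x), show -f x = fderiv ℝ f (γ s) (y - x) * s₀ by linarith, abs_mul,
      abs_of_pos hpos]
  rw [this]
  calc |fderiv ℝ f (γ s) (y - x)| * s₀ ≤ |fderiv ℝ f (γ s) (y - x)| * 1 := by
        gcongr; exact hs₀A.1.2
    _ ≤ K * ‖y - x‖ := by rw [mul_one]; exact hb

/-- The extension by zero of an admissible static field is Lipschitz, however rough the boundary
of `Ω` may be. -/
theorem StaticField.exists_lipschitz (hf : StaticField Ω f) :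
    ∃ K, LipschitzWith K (Ω.indicator f) := by
  obtain ⟨K, hK⟩ := hf.c1.2
  have hK' : ∀ x ∈ Ω, ‖fderiv ℝ f x‖ ≤ 3 * |K| := fun x hx =>
    norm_fderiv_le_of_pd_le fun j => ((hK x hx).2 j).trans (le_abs_self K)
  have hone : ∀ x ∈ Ω, ∀ y ∉ Ω, |f x| ≤ 3 * |K| * ‖y - x‖ := fun x hx y hy =>
    hf.abs_le_dist hK' hx hy
  refine ⟨Real.toNNReal (3 * |K|), LipschitzWith.of_dist_le_mul fun x y => ?_⟩
  rw [dist_eq_norm, dist_eq_norm, Real.coe_toNNReal _ (by positivity)]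
  by_cases hx : x ∈ Ω <;> by_cases hy : y ∈ Ω
  · rw [indicator_of_mem hx, indicator_of_mem hy]
    by_cases hseg : segment ℝ x y ⊆ Ω
    · rw [norm_sub_rev, norm_sub_rev x]
      exact (convex_segment x y).norm_image_sub_le_of_norm_fderiv_le
        (fun p hp => hf.c1.differentiableAt (hseg hp)) (fun p hp => hK' p (hseg hp))
        (left_mem_segment ℝ x y) (right_mem_segment ℝ x y)
    · obtain ⟨p, hp, hpΩ⟩ := not_subset.1 hseg
      have h1 := hone x hx p hpΩ
      have h2 := hone y hy p hpΩ
      have h3 := dist_add_dist_of_mem_segment hp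
      rw [dist_eq_norm, dist_eq_norm, dist_eq_norm, norm_sub_rev x p] at h3
      calc ‖f x - f y‖ ≤ |f x| + |f y| := norm_sub_le _ _
        _ ≤ 3 * |K| * (‖p - x‖ + ‖p - y‖) := by linarith
        _ = 3 * |K| * ‖x - y‖ := by rw [h3]
  · rw [indicator_of_mem hx, indicator_of_notMem hy, sub_zero, norm_sub_rev]
    exact hone x hx y hy
  · rw [indicator_of_notMem hx, indicator_of_mem hy, zero_sub, norm_neg]
    exact hone y hy x hx
  · rw [indicator_of_notMem hx, indicator_of_notMem hy, sub_self, norm_zero]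
    positivity

/-- A partial derivative of an admissible static field has mean zero. -/
theorem StaticField.integral_pd (hf : StaticField Ω f) (j : Fin 3) : ∫ x in Ω, pd j f x = 0 := by
  obtain ⟨K, hL⟩ := hf.exists_lipschitz
  set F := Ω.indicator f with hF
  set e : Space := EuclideanSpace.single j 1
  have hcs : HasCompactSupport F :=
    HasCompactSupport.intro hΩ.isBounded.isCompact_closure fun x hx =>
      indicator_of_notMem (fun h => hx (subset_closure h)) _
  have h0 : ∫ x, lineDeriv ℝ F x e = 0 := by
    have := (LipschitzWith.const (α := Space) (1 : ℝ)).integral_lineDeriv_mul_eq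
      (μ := (volume : Measure Space)) hL hcs (-e)
    have hc : ∀ x v : Space, lineDeriv ℝ (fun _ : Space => (1 : ℝ)) x v = 0 := fun x v => by
      simp [lineDeriv]
    simp only [hc, zero_mul, integral_zero, neg_neg, mul_one] at this
    exact this.symm
  -- almost everywhere off `Ω` both `F` and `|F|` have a line derivative, and `|F|` is minimal
  have hae : ∀ᵐ x : Space, x ∉ Ω → lineDeriv ℝ F x e = 0 := by
    filter_upwards [hL.ae_lineDifferentiableAt (μ := (volume : Measure Space)) e,
      (lipschitzWith_one_norm.comp hL).ae_lineDifferentiableAt (μ := (volume : Measure Space)) e]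
      with x h1 h2 hx
    have hFx : F x = 0 := indicator_of_notMem hx _
    set g : ℝ → ℝ := fun t => F (x + t • e)
    have hg0 : g 0 = 0 := by simp [g, hFx]
    have d1 : HasDerivAt g (deriv g 0) 0 := DifferentiableAt.hasDerivAt h1
    have d2 : HasDerivAt (fun t => ‖g t‖) (deriv (fun t => ‖g t‖) 0) 0 :=
      DifferentiableAt.hasDerivAt h2
    have hmin : IsLocalMin (fun t => ‖g t‖) 0 :=
      Eventually.of_forall fun t => by simp [hg0]
    rw [hmin.hasDerivAt_eq_zero d2, hasDerivAt_iff_tendsto_slope] at d2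
    have h3 : Tendsto (slope g 0) (𝓝[≠] 0) (𝓝 0) := by
      refine squeeze_zero_norm (fun t => ?_) (by simpa using d2.norm)
      simp [slope, hg0]
    exact tendsto_nhds_unique (hasDerivAt_iff_tendsto_slope.1 d1) h3
  have h1 : ∫ x, lineDeriv ℝ F x e = ∫ x in Ω, lineDeriv ℝ F x e :=
    (setIntegral_eq_integral_of_ae_compl_eq_zero hae).symm
  rw [← h0, h1]
  refine setIntegral_congr_fun hΩ.isOpen.measurableSet fun x hx => ?_
  have : F =ᶠ[𝓝 x] f := by
    filter_upwards [hΩ.isOpen.mem_nhds hx] with y hy using indicator_of_mem hy _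
  have hd : DifferentiableAt ℝ F x := (hf.c1.differentiableAt hx).congr_of_eventuallyEq this
  simp only [hd.lineDeriv_eq_fderiv, pd, this.fderiv_eq, e]

end

/-! ### Square integrable functions -/

/-- The space of square integrable functions on `Ω`. -/
noncomputable abbrev L2 (Ω : Set Space) := Lp ℝ 2 (volume.restrict Ω : Measure Space)

open Classical in
/-- The class in `L²(Ω)` of a function; it is `0` for functions that are not square integrable. -/
noncomputable def toL2 (Ω : Set Space) (f : Space → ℝ) : L2 Ω :=
  if h : MemLp f 2 (volume.restrict Ω) then h.toLp f else 0

open Classical in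
/-- Multiplication by a bounded function `c`, as an operator on `L²(Ω)`; it is `0` for functions
that are not essentially bounded. -/
noncomputable def mulL (Ω : Set Space) (c : Space → ℝ) : L2 Ω →L[ℝ] L2 Ω :=
  if h : MemLp c ∞ (volume.restrict Ω) then
    (ContinuousLinearMap.mul ℝ ℝ).holderL (volume.restrict Ω) ∞ 2 2 (h.toLp c) else 0

section
variable {Ω : Set Space} [hΩ : BoundedOpen Ω] {f g c d : Space → ℝ} {j : Fin 3}

instance : IsFiniteMeasure (volume.restrict Ω : Measure Space) :=
  ⟨by rw [Measure.restrict_apply_univ]; exact hΩ.isBounded.measure_lt_top⟩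

theorem CoeffC0.aestronglyMeasurable (hf : CoeffC0 Ω f) :
    AEStronglyMeasurable f (volume.restrict Ω) :=
  hf.1.aestronglyMeasurable hΩ.isOpen.measurableSet

theorem CoeffC0.memLp (hf : CoeffC0 Ω f) (p : ℝ≥0∞) : MemLp f p (volume.restrict Ω) := by
  obtain ⟨K, hK⟩ := hf.2
  refine MemLp.of_bound hf.aestronglyMeasurable K ?_
  exact ae_restrict_of_forall_mem hΩ.isOpen.measurableSet hK

theorem CoeffC0.integrableOn (hf : CoeffC0 Ω f) : IntegrableOn f Ω :=
  memLp_one_iff_integrable.1 (hf.memLp 1)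

theorem CoeffC0.coeFn_toL2 (hf : CoeffC0 Ω f) : toL2 Ω f =ᵐ[volume.restrict Ω] f := by
  rw [toL2, dif_pos (hf.memLp 2)]
  exact MemLp.coeFn_toLp _

theorem toL2_congr (h : ∀ x ∈ Ω, f x = g x) : toL2 Ω f = toL2 Ω g := by
  have hae : f =ᵐ[volume.restrict Ω] g := ae_restrict_of_forall_mem hΩ.isOpen.measurableSet h
  by_cases hf : MemLp f 2 (volume.restrict Ω)
  · rw [toL2, toL2, dif_pos hf, dif_pos (hf.ae_eq hae)]
    exact MemLp.toLp_congr _ _ hae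
  · rw [toL2, toL2, dif_neg hf, dif_neg fun hg => hf (hg.ae_eq hae.symm)]

theorem mulL_congr (h : ∀ x ∈ Ω, c x = d x) : mulL Ω c = mulL Ω d := by
  have hae : c =ᵐ[volume.restrict Ω] d := ae_restrict_of_forall_mem hΩ.isOpen.measurableSet h
  by_cases hf : MemLp c ∞ (volume.restrict Ω)
  · rw [mulL, mulL, dif_pos hf, dif_pos (hf.ae_eq hae), MemLp.toLp_congr hf _ hae]
  · rw [mulL, mulL, dif_neg hf, dif_neg fun hg => hf (hg.ae_eq hae.symm)]

theorem toL2_add (hf : CoeffC0 Ω f) (hg : CoeffC0 Ω g) :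
    toL2 Ω (fun x => f x + g x) = toL2 Ω f + toL2 Ω g := by
  rw [toL2, toL2, toL2, dif_pos (hf.memLp 2), dif_pos (hg.memLp 2),
    dif_pos ((hf.add hg).memLp 2)]
  rfl

theorem toL2_neg (hf : CoeffC0 Ω f) : toL2 Ω (fun x => -f x) = -toL2 Ω f := by
  rw [toL2, toL2, dif_pos (hf.memLp 2), dif_pos (hf.neg.memLp 2)]
  rfl

theorem toL2_sub (hf : CoeffC0 Ω f) (hg : CoeffC0 Ω g) :
    toL2 Ω (fun x => f x - g x) = toL2 Ω f - toL2 Ω g := by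
  rw [toL2, toL2, toL2, dif_pos (hf.memLp 2), dif_pos (hg.memLp 2),
    dif_pos ((hf.sub hg).memLp 2)]
  rfl

theorem toL2_const_mul (a : ℝ) (hf : CoeffC0 Ω f) :
    toL2 Ω (fun x => a * f x) = a • toL2 Ω f := by
  rw [toL2, toL2, dif_pos (hf.memLp 2), dif_pos (((CoeffC0.const a).mul hf).memLp 2)]
  rfl

theorem toL2_zero : toL2 Ω (fun _ => 0) = 0 := by
  have := toL2_const_mul 0 (CoeffC0.const (Ω := Ω) 0)
  simpa using this

theorem toL2_sum {ι : Type*} {s : Finset ι} {F : ι → Space → ℝ}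
    (hF : ∀ i ∈ s, CoeffC0 Ω (F i)) :
    toL2 Ω (fun x => ∑ i ∈ s, F i x) = ∑ i ∈ s, toL2 Ω (F i) := by
  classical
  induction s using Finset.induction_on with
  | empty => simpa using toL2_zero
  | insert i s hi ih =>
    have hF' : ∀ k ∈ s, CoeffC0 Ω (F k) := fun k hk => hF k (Finset.mem_insert_of_mem hk)
    simp_rw [Finset.sum_insert hi]
    rw [toL2_add (hF i (Finset.mem_insert_self i s)) (CoeffC0.sum hF'), ih hF']

theorem coeFn_mulL (hc : CoeffC0 Ω c) (u : L2 Ω) :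
    mulL Ω c u =ᵐ[volume.restrict Ω] fun x => c x * u x := by
  rw [mulL, dif_pos (hc.memLp ∞), ContinuousLinearMap.holderL_apply_apply]
  filter_upwards [ContinuousLinearMap.coeFn_holder (r := 2) (ContinuousLinearMap.mul ℝ ℝ)
    ((hc.memLp ∞).toLp c) u, MemLp.coeFn_toLp (hc.memLp ∞)] with x h1 h2
  rw [h1, h2, ContinuousLinearMap.mul_apply']

theorem toL2_mul (hc : CoeffC0 Ω c) (hf : CoeffC0 Ω f) :
    toL2 Ω (fun x => c x * f x) = mulL Ω c (toL2 Ω f) := by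
  refine Lp.ext ?_
  filter_upwards [(hc.mul hf).coeFn_toL2, coeFn_mulL hc (toL2 Ω f), hf.coeFn_toL2] with x h1 h2 h3
  rw [h1, h2, h3]

theorem inner_mulL_left (hc : CoeffC0 Ω c) (u v : L2 Ω) :
    ⟪mulL Ω c u, v⟫ = ⟪u, mulL Ω c v⟫ := by
  rw [L2.inner_def, L2.inner_def]
  refine integral_congr_ae ?_
  filter_upwards [coeFn_mulL hc u, coeFn_mulL hc v] with x h1 h2
  rw [h1, h2]
  simp only [RCLike.inner_apply, conj_trivial]
  ring

theorem inner_toL2 (hf : CoeffC0 Ω f) (hg : CoeffC0 Ω g) :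
    ⟪toL2 Ω f, toL2 Ω g⟫ = ∫ x in Ω, f x * g x := by
  rw [L2.inner_def]
  refine integral_congr_ae ?_
  filter_upwards [hf.coeFn_toL2, hg.coeFn_toL2] with x h1 h2
  rw [h1, h2]
  simp only [RCLike.inner_apply, conj_trivial]
  ring

theorem inner_mulL_toL2 (hc : CoeffC0 Ω c) (hf : CoeffC0 Ω f) (hg : CoeffC0 Ω g) :
    ⟪mulL Ω c (toL2 Ω f), toL2 Ω g⟫ = ∫ x in Ω, c x * f x * g x := by
  rw [← toL2_mul hc hf, inner_toL2 (hc.mul hf) hg]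

theorem norm_toL2_sq (hf : CoeffC0 Ω f) : ‖toL2 Ω f‖ ^ 2 = ∫ x in Ω, f x ^ 2 := by
  rw [← real_inner_self_eq_norm_sq, inner_toL2 hf hf]
  simp only [sq]

theorem eq_zero_of_toL2_eq_zero (hf : CoeffC0 Ω f) (h : toL2 Ω f = 0) : ∀ x ∈ Ω, f x = 0 := by
  have hae : f =ᵐ[volume.restrict Ω] fun _ => 0 := by
    have h2 := hf.coeFn_toL2
    rw [h] at h2
    exact h2.symm.trans (Lp.coeFn_zero _ _ _)
  exact Measure.eqOn_open_of_ae_eq hae hΩ.isOpen hf.1 continuousOn_const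

theorem toL2_pd_mul (hc : CoeffC1 Ω c) (hf : CoeffC1 Ω f) :
    toL2 Ω (pd j fun x => c x * f x) = mulL Ω (pd j c) (toL2 Ω f) + mulL Ω c (toL2 Ω (pd j f)) := by
  rw [← toL2_mul (hc.pd j) hf.c0, ← toL2_mul hc.c0 (hf.pd j),
    ← toL2_add ((hc.pd j).mul hf.c0) (hc.c0.mul (hf.pd j))]
  exact toL2_congr fun x hx => pd_mul (hc.differentiableAt hx) (hf.differentiableAt hx)

theorem toL2_pd_add (hf : CoeffC1 Ω f) (hg : CoeffC1 Ω g) :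
    toL2 Ω (pd j fun x => f x + g x) = toL2 Ω (pd j f) + toL2 Ω (pd j g) := by
  rw [← toL2_add (hf.pd j) (hg.pd j)]
  exact toL2_congr fun x hx => pd_add (hf.differentiableAt hx) (hg.differentiableAt hx)

theorem toL2_pd_sub (hf : CoeffC1 Ω f) (hg : CoeffC1 Ω g) :
    toL2 Ω (pd j fun x => f x - g x) = toL2 Ω (pd j f) - toL2 Ω (pd j g) := by
  rw [← toL2_sub (hf.pd j) (hg.pd j)]
  exact toL2_congr fun x hx => pd_sub (hf.differentiableAt hx) (hg.differentiableAt hx)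

theorem toL2_pd_sum {ι : Type*} {s : Finset ι} {F : ι → Space → ℝ}
    (hF : ∀ i ∈ s, CoeffC1 Ω (F i)) :
    toL2 Ω (pd j fun x => ∑ i ∈ s, F i x) = ∑ i ∈ s, toL2 Ω (pd j (F i)) := by
  rw [← toL2_sum fun i hi => (hF i hi).pd j]
  exact toL2_congr fun x hx => pd_sum fun i hi => (hF i hi).differentiableAt hx

/-- Integration by parts against a field that vanishes on the boundary; no regularity of the
boundary is needed. -/
theorem inner_toL2_pd (hf : CoeffC1 Ω f) {w : Space → ℝ} (hw : StaticField Ω w) (j : Fin 3) :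
    ⟪toL2 Ω (pd j f), toL2 Ω w⟫ = -⟪toL2 Ω f, toL2 Ω (pd j w)⟫ := by
  have h0 := (hf.staticField_mul hw).integral_pd j
  have hw1 := hw.c1
  rw [inner_toL2 (hf.pd j) hw1.c0, inner_toL2 hf.c0 (hw1.pd j), eq_neg_iff_add_eq_zero,
    ← integral_add ((hf.pd j).mul hw1.c0).integrableOn (hf.c0.mul (hw1.pd j)).integrableOn, ← h0]
  refine setIntegral_congr_fun hΩ.isOpen.measurableSet fun x hx => ?_
  rw [← pd_mul (hf.differentiableAt hx) (hw1.differentiableAt hx)]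
  exact pd_congr hΩ.isOpen (fun y hy => (indicator_of_mem hy fun x => f x * w x).symm) hx

/-- Dominated convergence in `L²(Ω)`. -/
theorem tendsto_toL2 {ι : Type*} {l : Filter ι} [l.IsCountablyGenerated] {F : ι → Space → ℝ}
    {M : ℝ} (hF : ∀ᶠ n in l, ContinuousOn (F n) Ω) (hf : CoeffC0 Ω f)
    (hM : ∀ᶠ n in l, ∀ x ∈ Ω, |F n x| ≤ M) (hlim : ∀ x ∈ Ω, Tendsto (fun n => F n x) l (𝓝 (f x))) :
    Tendsto (fun n => toL2 Ω (F n)) l (𝓝 (toL2 Ω f)) := by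
  obtain ⟨K, hK⟩ := hf.2
  rw [tendsto_iff_norm_sub_tendsto_zero]
  have hsq : Tendsto (fun n => ∫ x in Ω, (F n x - f x) ^ 2) l (𝓝 0) := by
    have h0 : (0 : ℝ) = ∫ x in Ω, (0 : ℝ) := by simp
    rw [h0]
    refine tendsto_integral_filter_of_dominated_convergence (fun _ => (M + K) ^ 2) ?_ ?_
      (integrable_const _) ?_
    · filter_upwards [hF] with n hn
      exact ((hn.sub hf.1).pow 2).aestronglyMeasurable hΩ.isOpen.measurableSet
    · filter_upwards [hM] with n hn
      refine ae_restrict_of_forall_mem hΩ.isOpen.measurableSet fun x hx => ?_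
      have h1 : |F n x - f x| ≤ M + K := (abs_sub _ _).trans (add_le_add (hn x hx) (hK x hx))
      rw [Real.norm_eq_abs, abs_pow]
      gcongr
    · refine ae_restrict_of_forall_mem hΩ.isOpen.measurableSet fun x hx => ?_
      have := ((hlim x hx).sub_const (f x)).pow 2
      simpa using this
  have heq : (fun n => ‖toL2 Ω (F n) - toL2 Ω f‖) =ᶠ[l]
      fun n => Real.sqrt (∫ x in Ω, (F n x - f x) ^ 2) := by
    filter_upwards [hF, hM] with n h1 h2
    have hn : CoeffC0 Ω (F n) := ⟨h1, M, h2⟩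
    rw [← toL2_sub hn hf, ← norm_toL2_sq (hn.sub hf), Real.sqrt_sq (norm_nonneg _)]
  refine Tendsto.congr' heq.symm ?_
  simpa [Function.comp_def] using (Real.continuous_sqrt.tendsto 0).comp hsq

theorem continuousOn_toL2 {S : Set ℝ} {F : ℝ → Space → ℝ} {M : ℝ}
    (hF : ∀ t ∈ S, ContinuousOn (F t) Ω) (hM : ∀ t ∈ S, ∀ x ∈ Ω, |F t x| ≤ M)
    (hlim : ∀ x ∈ Ω, ContinuousOn (fun t => F t x) S) :
    ContinuousOn (fun t => toL2 Ω (F t)) S := fun t ht =>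
  tendsto_toL2 (eventually_nhdsWithin_of_forall hF) ⟨hF t ht, M, hM t ht⟩
    (eventually_nhdsWithin_of_forall hM) fun x hx => hlim x hx t ht

/-- Differentiation in `L²(Ω)` with respect to time. -/
theorem hasDerivWithinAt_toL2 {S : Set ℝ} (hS : Convex ℝ S) {F F' : ℝ → Space → ℝ} {M : ℝ}
    (hF : ∀ t ∈ S, CoeffC0 Ω (F t)) (hF' : ∀ t ∈ S, ContinuousOn (F' t) Ω)
    (hM : ∀ t ∈ S, ∀ x ∈ Ω, |F' t x| ≤ M)
    (hd : ∀ x ∈ Ω, ∀ t ∈ S, HasDerivWithinAt (fun s => F s x) (F' t x) S t) {t : ℝ} (ht : t ∈ S) :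
    HasDerivWithinAt (fun s => toL2 Ω (F s)) (toL2 Ω (F' t)) S t := by
  rw [hasDerivWithinAt_iff_tendsto_slope]
  have hmem : ∀ᶠ s in 𝓝[S \ {t}] t, s ∈ S := by
    filter_upwards [self_mem_nhdsWithin] with s hs using hs.1
  have hb : ∀ s ∈ S, ∀ x ∈ Ω, |(s - t)⁻¹ * (F s x - F t x)| ≤ M := by
    intro s hs x hx
    have h1 := hS.norm_image_sub_le_of_norm_hasDerivWithin_le (hd x hx) (fun r hr => hM r hr x hx)
      ht hs
    have hM0 : 0 ≤ M := (abs_nonneg _).trans (hM t ht x hx)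
    rw [Real.norm_eq_abs, Real.norm_eq_abs] at h1
    rw [abs_mul, abs_inv]
    rcases (abs_nonneg (s - t)).eq_or_lt with h0 | h0
    · rw [← h0]; simpa using hM0
    · rw [inv_mul_le_iff₀ h0]; linarith
  have key : Tendsto (fun s => toL2 Ω (fun x => (s - t)⁻¹ * (F s x - F t x))) (𝓝[S \ {t}] t)
      (𝓝 (toL2 Ω (F' t))) := by
    refine tendsto_toL2 (M := M) ?_ ⟨hF' t ht, M, hM t ht⟩ ?_ fun x hx => ?_
    · filter_upwards [hmem] with s hs
      exact continuousOn_const.mul ((hF s hs).1.sub (hF t ht).1)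
    · filter_upwards [hmem] with s hs using hb s hs
    · have := hasDerivWithinAt_iff_tendsto_slope.1 (hd x hx t ht)
      simpa [slope_fun_def, slope] using this
  refine key.congr' ?_
  filter_upwards [hmem] with s hs
  rw [toL2_const_mul _ ((hF s hs).sub (hF t ht)), toL2_sub (hF s hs) (hF t ht)]
  simp [slope]

end

/-! ### Regularity in space and time -/

section
variable {Ω : Set Space} {I : Set ℝ} {f : ℝ → Space → ℝ} {t : ℝ} {x : Space}

theorem contDiffOn_slice {n : WithTop ℕ∞}
    (hf : ContDiffOn ℝ n (fun p : ℝ × Space => f p.1 p.2) (I ×ˢ Ω)) (ht : t ∈ I) :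
    ContDiffOn ℝ n (f t) Ω :=
  hf.comp (f := fun y : Space => (t, y)) (contDiffOn_const.prodMk contDiffOn_id)
    fun _ hy => ⟨ht, hy⟩

theorem continuousOn_time {g : ℝ → Space → ℝ} {B : Set Space}
    (hg : ContinuousOn (fun p : ℝ × Space => g p.1 p.2) (I ×ˢ B)) (hx : x ∈ B) :
    ContinuousOn (fun s => g s x) I :=
  hg.comp (f := fun s : ℝ => (s, x)) (by fun_prop) fun s hs => ⟨hs, hx⟩

theorem continuousOn_space {g : ℝ → Space → ℝ} {B : Set Space}
    (hg : ContinuousOn (fun p : ℝ × Space => g p.1 p.2) (I ×ˢ B)) (ht : t ∈ I) :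
    ContinuousOn (g t) B :=
  hg.comp (f := fun y : Space => (t, y)) (by fun_prop) fun y hy => ⟨ht, hy⟩

theorem LocBdd.at (h : LocBdd I Ω f) (ht : t ∈ I) : ∃ M, ∀ x ∈ Ω, |f t x| ≤ M := by
  obtain ⟨M, hM⟩ := h {t} (by simpa using ht) isCompact_singleton
  exact ⟨M, hM t rfl⟩

theorem hasDerivWithinAt_dt
    (hf : DifferentiableOn ℝ (fun p : ℝ × Space => f p.1 p.2) (I ×ˢ Ω)) (ht : t ∈ I) (hx : x ∈ Ω) :
    HasDerivWithinAt (fun s => f s x) (dt I f t x) I t := by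
  have h1 : DifferentiableWithinAt ℝ (fun s => f s x) I t :=
    (hf (t, x) ⟨ht, hx⟩).comp (f := fun s : ℝ => (s, x)) t
      (differentiableWithinAt_id.prodMk (differentiableWithinAt_const x)) fun s hs => ⟨hs, hx⟩
  exact h1.hasDerivWithinAt

theorem dt_eq_fderivWithin (hI : UniqueDiffOn ℝ I)
    (hf : DifferentiableOn ℝ (fun p : ℝ × Space => f p.1 p.2) (I ×ˢ Ω)) (ht : t ∈ I) (hx : x ∈ Ω) :
    dt I f t x = fderivWithin ℝ (fun p : ℝ × Space => f p.1 p.2) (I ×ˢ Ω) (t, x) (1, 0) := by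
  have h1 : HasDerivWithinAt (fun s : ℝ => (s, x)) ((1 : ℝ), (0 : Space)) I t :=
    (hasDerivWithinAt_id t I).prodMk (hasDerivWithinAt_const t I x)
  have h2 := (hf (t, x) ⟨ht, hx⟩).hasFDerivWithinAt.comp_hasDerivWithinAt (f := fun s : ℝ => (s, x))
    t h1 fun s hs => ⟨hs, hx⟩
  exact h2.derivWithin (hI t ht)

variable [hΩ : BoundedOpen Ω]

theorem uniqueDiffOn_prod (hI : UniqueDiffOn ℝ I) : UniqueDiffOn ℝ (I ×ˢ Ω) :=
  hI.prod hΩ.isOpen.uniqueDiffOn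

theorem pd_eq_fderivWithin
    (hf : DifferentiableOn ℝ (fun p : ℝ × Space => f p.1 p.2) (I ×ˢ Ω)) (ht : t ∈ I) (hx : x ∈ Ω)
    (j : Fin 3) :
    pd j (f t) x = fderivWithin ℝ (fun p : ℝ × Space => f p.1 p.2) (I ×ˢ Ω) (t, x)
      (0, EuclideanSpace.single j 1) := by
  have h1 : HasFDerivWithinAt (fun y : Space => (t, y))
      ((0 : Space →L[ℝ] ℝ).prod (ContinuousLinearMap.id ℝ Space)) Ω x :=
    (hasFDerivWithinAt_const t x Ω).prodMk (hasFDerivWithinAt_id x Ω)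
  have h2 := (hf (t, x) ⟨ht, hx⟩).hasFDerivWithinAt.comp (f := fun y : Space => (t, y))
    x h1 fun y hy => ⟨ht, hy⟩
  have h3 := h2.hasFDerivAt (hΩ.isOpen.mem_nhds hx)
  have h4 : fderiv ℝ (f t) x = _ := h3.fderiv
  rw [pd, h4]
  simp

theorem contDiffOn_dt {n m : WithTop ℕ∞} (hmn : m + 1 ≤ n) (hI : UniqueDiffOn ℝ I)
    (hf : ContDiffOn ℝ n (fun p : ℝ × Space => f p.1 p.2) (I ×ˢ Ω)) :
    ContDiffOn ℝ m (fun p : ℝ × Space => dt I f p.1 p.2) (I ×ˢ Ω) := by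
  have hn : n ≠ 0 := by rintro rfl; simp at hmn
  refine ((hf.fderivWithin (uniqueDiffOn_prod hI) hmn).clm_apply
    (contDiffOn_const (c := ((1 : ℝ), (0 : Space))))).congr fun p hp => ?_
  exact dt_eq_fderivWithin hI (hf.differentiableOn hn) hp.1 hp.2

theorem contDiffOn_pd {n m : WithTop ℕ∞} (hmn : m + 1 ≤ n) (hI : UniqueDiffOn ℝ I)
    (hf : ContDiffOn ℝ n (fun p : ℝ × Space => f p.1 p.2) (I ×ˢ Ω)) (j : Fin 3) :
    ContDiffOn ℝ m (fun p : ℝ × Space => pd j (f p.1) p.2) (I ×ˢ Ω) := by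
  have hn : n ≠ 0 := by rintro rfl; simp at hmn
  refine ((hf.fderivWithin (uniqueDiffOn_prod hI) hmn).clm_apply
    (contDiffOn_const (c := ((0 : ℝ), EuclideanSpace.single j (1 : ℝ))))).congr fun p hp => ?_
  exact pd_eq_fderivWithin (hf.differentiableOn hn) hp.1 hp.2 j

theorem pd_comm {h : Space → ℝ} (hh : ContDiffOn ℝ 2 h Ω) (hx : x ∈ Ω) (i j : Fin 3) :
    pd j (pd i h) x = pd i (pd j h) x := by
  have hc : ContDiffAt ℝ 2 h x := hh.contDiffAt (hΩ.isOpen.mem_nhds hx)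
  have hd : DifferentiableAt ℝ (fderiv ℝ h) x :=
    (hc.fderiv_right (m := 1) (by norm_num)).differentiableAt one_ne_zero
  have hs := hc.isSymmSndFDerivAt (by simp)
  have e : ∀ k l : Fin 3, pd l (pd k h) x =
      fderiv ℝ (fderiv ℝ h) x (EuclideanSpace.single l 1) (EuclideanSpace.single k 1) := by
    intro k l
    have : HasFDerivAt (pd k h)
        ((ContinuousLinearMap.apply ℝ ℝ (EuclideanSpace.single k (1 : ℝ))).comp
          (fderiv ℝ (fderiv ℝ h) x)) x :=
      (ContinuousLinearMap.apply ℝ ℝ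
        (EuclideanSpace.single k (1 : ℝ))).hasFDerivAt.comp x hd.hasFDerivAt
    rw [pd, this.fderiv]
    rfl
  rw [e, e]
  exact hs _ _

theorem exists_bound_of_continuousOn_closure
    (hf : ContinuousOn (fun p : ℝ × Space => f p.1 p.2) (I ×ˢ closure Ω)) {S : Set ℝ}
    (hS : S ⊆ I) (hSc : IsCompact S) : ∃ M, ∀ t ∈ S, ∀ x ∈ Ω, |f t x| ≤ M := by
  obtain ⟨M, hM⟩ := (hSc.prod hΩ.isBounded.isCompact_closure).exists_bound_of_continuousOn
    (hf.mono (prod_mono hS subset_rfl))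
  exact ⟨M, fun t ht x hx => hM (t, x) ⟨ht, subset_closure hx⟩⟩

theorem MechRegular.c1 (hf : MechRegular I Ω f) (ht : t ∈ I) : CoeffC1 Ω (f t) := by
  obtain ⟨M, hM⟩ := exists_bound_of_continuousOn_closure hf.cont (S := {t}) (by simpa using ht)
    isCompact_singleton
  have h1 := (contDiffOn_slice hf.diff ht).of_le (m := 1) (by norm_num)
  exact .of_pd h1 ⟨h1.continuousOn, M, hM t rfl⟩ fun j => (hf.bdd_dx j).at ht

theorem MechRegular.c1_pd (hI : UniqueDiffOn ℝ I) (hf : MechRegular I Ω f) (ht : t ∈ I)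
    (j : Fin 3) : CoeffC1 Ω (pd j (f t)) := by
  have h1 := contDiffOn_slice (f := fun t => pd j (f t))
    (contDiffOn_pd (m := 1) (by norm_num) hI hf.diff j) ht
  exact .of_pd h1 ⟨h1.continuousOn, (hf.bdd_dx j).at ht⟩ fun k => (hf.bdd_dxx j k).at ht

theorem MechRegular.c1_dt (hI : UniqueDiffOn ℝ I) (hf : MechRegular I Ω f) (ht : t ∈ I) :
    CoeffC1 Ω (dt I f t) := by
  have h1 := contDiffOn_slice (contDiffOn_dt (m := 1) (by norm_num) hI hf.diff) ht
  exact .of_pd h1 ⟨h1.continuousOn, hf.bdd_dt.at ht⟩ fun k => (hf.bdd_dtx k).at ht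

theorem MechRegular.c0_dtt (hI : UniqueDiffOn ℝ I) (hf : MechRegular I Ω f) (ht : t ∈ I) :
    CoeffC0 Ω (dt I (dt I f) t) := by
  have h1 := contDiffOn_slice (contDiffOn_dt (m := 0) (by norm_num) hI
    (contDiffOn_dt (m := 1) (by norm_num) hI hf.diff)) ht
  exact ⟨h1.continuousOn, hf.bdd_dtt.at ht⟩

theorem ThermRegular.c1 (hf : ThermRegular I Ω f) (ht : t ∈ I) : CoeffC1 Ω (f t) := by
  obtain ⟨M, hM⟩ := exists_bound_of_continuousOn_closure hf.cont (S := {t}) (by simpa using ht)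
    isCompact_singleton
  have h1 := contDiffOn_slice hf.diff ht
  exact .of_pd h1 ⟨h1.continuousOn, M, hM t rfl⟩ fun j => (hf.bdd_dx j).at ht

theorem ThermRegular.c1_pd (hf : ThermRegular I Ω f) (ht : t ∈ I)
    (j : Fin 3) : CoeffC1 Ω (pd j (f t)) := by
  have h1 : ContDiffOn ℝ 1 (pd j (f t)) Ω :=
    ((hf.diff_space t ht).fderiv_of_isOpen hΩ.isOpen (m := 1) (by norm_num)).clm_apply
      contDiffOn_const
  exact .of_pd h1 ⟨h1.continuousOn, (hf.bdd_dx j).at ht⟩ fun k => (hf.bdd_dxx j k).at ht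

theorem ThermRegular.c0_dt (hI : UniqueDiffOn ℝ I) (hf : ThermRegular I Ω f) (ht : t ∈ I) :
    CoeffC0 Ω (dt I f t) := by
  have h1 := contDiffOn_slice (contDiffOn_dt (m := 0) (by norm_num) hI hf.diff) ht
  exact ⟨h1.continuousOn, hf.bdd_dt.at ht⟩

variable {p q : ℝ}

theorem MechRegular.continuousOn_toL2 (hf : MechRegular I Ω f) (hS : Icc p q ⊆ I) :
    ContinuousOn (fun t => toL2 Ω (f t)) (Icc p q) := by
  obtain ⟨M, hM⟩ := exists_bound_of_continuousOn_closure hf.cont hS isCompact_Icc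
  exact DoublePorosity.continuousOn_toL2 (fun t ht => (hf.c1 (hS ht)).c0.1) hM fun x hx =>
    (continuousOn_time hf.cont (subset_closure hx)).mono hS

theorem MechRegular.continuousOn_toL2_pd (hI : UniqueDiffOn ℝ I) (hf : MechRegular I Ω f)
    (hS : Icc p q ⊆ I) (j : Fin 3) :
    ContinuousOn (fun t => toL2 Ω (pd j (f t))) (Icc p q) := by
  obtain ⟨M, hM⟩ := hf.bdd_dx j _ hS isCompact_Icc
  exact DoublePorosity.continuousOn_toL2 (fun t ht => (hf.c1_pd hI (hS ht) j).c0.1) hM fun x hx =>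
    (continuousOn_time (g := fun t => pd j (f t))
      (contDiffOn_pd (m := 0) (by norm_num) hI hf.diff j).continuousOn hx).mono hS

theorem MechRegular.hasDerivWithinAt_toL2 (hI : UniqueDiffOn ℝ I) (hf : MechRegular I Ω f)
    (hS : Icc p q ⊆ I) (ht : t ∈ Icc p q) :
    HasDerivWithinAt (fun s => toL2 Ω (f s)) (toL2 Ω (dt I f t)) (Icc p q) t := by
  obtain ⟨M, hM⟩ := hf.bdd_dt _ hS isCompact_Icc
  exact DoublePorosity.hasDerivWithinAt_toL2 (convex_Icc p q) (fun t ht => (hf.c1 (hS ht)).c0)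
    (fun t ht => (hf.c1_dt hI (hS ht)).c0.1) hM
    (fun x hx t ht => (hasDerivWithinAt_dt (hf.diff.differentiableOn two_ne_zero)
      (hS ht) hx).mono hS) ht

theorem MechRegular.hasDerivWithinAt_toL2_dt (hI : UniqueDiffOn ℝ I) (hf : MechRegular I Ω f)
    (hS : Icc p q ⊆ I) (ht : t ∈ Icc p q) :
    HasDerivWithinAt (fun s => toL2 Ω (dt I f s)) (toL2 Ω (dt I (dt I f) t)) (Icc p q) t := by
  obtain ⟨M, hM⟩ := hf.bdd_dtt _ hS isCompact_Icc
  exact DoublePorosity.hasDerivWithinAt_toL2 (convex_Icc p q)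
    (fun t ht => (hf.c1_dt hI (hS ht)).c0) (fun t ht => (hf.c0_dtt hI (hS ht)).1) hM
    (fun x hx t ht => (hasDerivWithinAt_dt
      ((contDiffOn_dt (m := 1) (by norm_num) hI hf.diff).differentiableOn one_ne_zero)
      (hS ht) hx).mono hS) ht

theorem ThermRegular.continuousOn_toL2 (hf : ThermRegular I Ω f) (hS : Icc p q ⊆ I) :
    ContinuousOn (fun t => toL2 Ω (f t)) (Icc p q) := by
  obtain ⟨M, hM⟩ := exists_bound_of_continuousOn_closure hf.cont hS isCompact_Icc
  exact DoublePorosity.continuousOn_toL2 (fun t ht => (hf.c1 (hS ht)).c0.1) hM fun x hx =>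
    (continuousOn_time hf.cont (subset_closure hx)).mono hS

theorem ThermRegular.continuousOn_toL2_pd (hI : UniqueDiffOn ℝ I) (hf : ThermRegular I Ω f)
    (hS : Icc p q ⊆ I) (j : Fin 3) :
    ContinuousOn (fun t => toL2 Ω (pd j (f t))) (Icc p q) := by
  obtain ⟨M, hM⟩ := hf.bdd_dx j _ hS isCompact_Icc
  exact DoublePorosity.continuousOn_toL2 (fun t ht => (hf.c1_pd (hS ht) j).c0.1) hM fun x hx =>
    (continuousOn_time (g := fun t => pd j (f t))
      (contDiffOn_pd (m := 0) (by norm_num) hI hf.diff j).continuousOn hx).mono hS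

theorem ThermRegular.hasDerivWithinAt_toL2 (hI : UniqueDiffOn ℝ I) (hf : ThermRegular I Ω f)
    (hS : Icc p q ⊆ I) (ht : t ∈ Icc p q) :
    HasDerivWithinAt (fun s => toL2 Ω (f s)) (toL2 Ω (dt I f t)) (Icc p q) t := by
  obtain ⟨M, hM⟩ := hf.bdd_dt _ hS isCompact_Icc
  exact DoublePorosity.hasDerivWithinAt_toL2 (convex_Icc p q) (fun t ht => (hf.c1 (hS ht)).c0)
    (fun t ht => (hf.c0_dt hI (hS ht)).1) hM
    (fun x hx t ht => (hasDerivWithinAt_dt (hf.diff.differentiableOn one_ne_zero)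
      (hS ht) hx).mono hS) ht

end

/-! ### Spaces and bilinear forms of the system -/

section spaces
variable (Ω : Set Space)

/-- Pairs of an `L²` function and three further `L²` functions, candidates for its partial derivatives.
This and the following product spaces carry the maximum norm. -/
def JetSpace := L2 Ω × (Fin 3 → L2 Ω)

noncomputable instance : NormedAddCommGroup (JetSpace Ω) :=
  inferInstanceAs (NormedAddCommGroup (L2 Ω × (Fin 3 → L2 Ω)))

noncomputable instance : NormedSpace ℝ (JetSpace Ω) :=
  inferInstanceAs (NormedSpace ℝ (L2 Ω × (Fin 3 → L2 Ω)))

instance : CompleteSpace (JetSpace Ω) :=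
  inferInstanceAs (CompleteSpace (L2 Ω × (Fin 3 → L2 Ω)))

/-- The space of the mechanical fields `u`, `φ`, `ψ` and their gradients. -/
def MechSpace := (Fin 3 → JetSpace Ω) × JetSpace Ω × JetSpace Ω

noncomputable instance : NormedAddCommGroup (MechSpace Ω) :=
  inferInstanceAs (NormedAddCommGroup ((Fin 3 → JetSpace Ω) × JetSpace Ω × JetSpace Ω))

noncomputable instance : NormedSpace ℝ (MechSpace Ω) :=
  inferInstanceAs (NormedSpace ℝ ((Fin 3 → JetSpace Ω) × JetSpace Ω × JetSpace Ω))

instance : CompleteSpace (MechSpace Ω) :=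
  inferInstanceAs (CompleteSpace ((Fin 3 → JetSpace Ω) × JetSpace Ω × JetSpace Ω))

/-- The space of the velocities of the mechanical fields. -/
def VelSpace := (Fin 3 → L2 Ω) × L2 Ω × L2 Ω

noncomputable instance : NormedAddCommGroup (VelSpace Ω) :=
  inferInstanceAs (NormedAddCommGroup ((Fin 3 → L2 Ω) × L2 Ω × L2 Ω))

noncomputable instance : NormedSpace ℝ (VelSpace Ω) :=
  inferInstanceAs (NormedSpace ℝ ((Fin 3 → L2 Ω) × L2 Ω × L2 Ω))

/-- The space of the thermal fields `θ`, `T` and their gradients. -/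
def ThermSpace := JetSpace Ω × (Fin 3 → JetSpace Ω)

noncomputable instance : NormedAddCommGroup (ThermSpace Ω) :=
  inferInstanceAs (NormedAddCommGroup (JetSpace Ω × (Fin 3 → JetSpace Ω)))

noncomputable instance : NormedSpace ℝ (ThermSpace Ω) :=
  inferInstanceAs (NormedSpace ℝ (JetSpace Ω × (Fin 3 → JetSpace Ω)))

instance : CompleteSpace (ThermSpace Ω) :=
  inferInstanceAs (CompleteSpace (JetSpace Ω × (Fin 3 → JetSpace Ω)))

variable {Ω}

/-- The function underlying a jet. -/
noncomputable def jetVal : JetSpace Ω →L[ℝ] L2 Ω :=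
  ContinuousLinearMap.fst ℝ (L2 Ω) (Fin 3 → L2 Ω)

/-- The `j`-th partial derivative of a jet. -/
noncomputable def jetGrad (j : Fin 3) : JetSpace Ω →L[ℝ] L2 Ω :=
  (ContinuousLinearMap.proj (R := ℝ) (φ := fun _ : Fin 3 => L2 Ω) j).comp
    (ContinuousLinearMap.snd ℝ (L2 Ω) (Fin 3 → L2 Ω))

/-- The displacement component `u_i`. -/
noncomputable def mechU (i : Fin 3) : MechSpace Ω →L[ℝ] JetSpace Ω :=
  (ContinuousLinearMap.proj (R := ℝ) (φ := fun _ : Fin 3 => JetSpace Ω) i).comp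
    (ContinuousLinearMap.fst ℝ (Fin 3 → JetSpace Ω) (JetSpace Ω × JetSpace Ω))

/-- The volume fraction `φ`. -/
noncomputable def mechPhi : MechSpace Ω →L[ℝ] JetSpace Ω :=
  (ContinuousLinearMap.fst ℝ (JetSpace Ω) (JetSpace Ω)).comp
    (ContinuousLinearMap.snd ℝ (Fin 3 → JetSpace Ω) (JetSpace Ω × JetSpace Ω))

/-- The volume fraction `ψ`. -/
noncomputable def mechPsi : MechSpace Ω →L[ℝ] JetSpace Ω :=
  (ContinuousLinearMap.snd ℝ (JetSpace Ω) (JetSpace Ω)).comp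
    (ContinuousLinearMap.snd ℝ (Fin 3 → JetSpace Ω) (JetSpace Ω × JetSpace Ω))

/-- The velocity of `u_i`. -/
noncomputable def velU (i : Fin 3) : VelSpace Ω →L[ℝ] L2 Ω :=
  (ContinuousLinearMap.proj (R := ℝ) (φ := fun _ : Fin 3 => L2 Ω) i).comp
    (ContinuousLinearMap.fst ℝ (Fin 3 → L2 Ω) (L2 Ω × L2 Ω))

/-- The velocity of `φ`. -/
noncomputable def velPhi : VelSpace Ω →L[ℝ] L2 Ω :=
  (ContinuousLinearMap.fst ℝ (L2 Ω) (L2 Ω)).comp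
    (ContinuousLinearMap.snd ℝ (Fin 3 → L2 Ω) (L2 Ω × L2 Ω))

/-- The velocity of `ψ`. -/
noncomputable def velPsi : VelSpace Ω →L[ℝ] L2 Ω :=
  (ContinuousLinearMap.snd ℝ (L2 Ω) (L2 Ω)).comp
    (ContinuousLinearMap.snd ℝ (Fin 3 → L2 Ω) (L2 Ω × L2 Ω))

/-- The temperature `θ`. -/
noncomputable def thermTheta : ThermSpace Ω →L[ℝ] JetSpace Ω :=
  ContinuousLinearMap.fst ℝ (JetSpace Ω) (Fin 3 → JetSpace Ω)

/-- The microtemperature `T_i`. -/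
noncomputable def thermT (i : Fin 3) : ThermSpace Ω →L[ℝ] JetSpace Ω :=
  (ContinuousLinearMap.proj (R := ℝ) (φ := fun _ : Fin 3 => JetSpace Ω) i).comp
    (ContinuousLinearMap.snd ℝ (JetSpace Ω) (Fin 3 → JetSpace Ω))

/-- The element of `VelSpace Ω` with the given components. -/
noncomputable def velMk (a : Fin 3 → L2 Ω) (b c : L2 Ω) : VelSpace Ω := (a, b, c)

/-- The values of the mechanical fields, without their gradients. -/
noncomputable def mechVal : MechSpace Ω →L[ℝ] VelSpace Ω :=
  (ContinuousLinearMap.pi fun i => jetVal.comp (mechU i)).prod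
    ((jetVal.comp mechPhi).prod (jetVal.comp mechPsi))

variable (Ω)

/-- A function together with its gradient. -/
noncomputable def jet (f : Space → ℝ) : JetSpace Ω :=
  (toL2 Ω f, fun j => toL2 Ω (pd j f))

/-- The jets of a displacement `v` and of volume fractions `f`, `g`. -/
noncomputable def mechJet (v : Fin 3 → Space → ℝ) (f g : Space → ℝ) : MechSpace Ω :=
  (fun i => jet Ω (v i), jet Ω f, jet Ω g)

/-- The jets of a temperature `θ` and of microtemperatures `T`. -/
noncomputable def thermJet (θ : Space → ℝ) (T : Fin 3 → Space → ℝ) : ThermSpace Ω :=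
  (jet Ω θ, fun i => jet Ω (T i))

variable {Ω} {v : Fin 3 → Space → ℝ} {f g : Space → ℝ}

theorem jetVal_jet : jetVal (jet Ω f) = toL2 Ω f := rfl
theorem jetGrad_jet (j : Fin 3) : jetGrad j (jet Ω f) = toL2 Ω (pd j f) := rfl
theorem mechU_mechJet (i : Fin 3) : mechU i (mechJet Ω v f g) = jet Ω (v i) := rfl
theorem mechPhi_mechJet : mechPhi (mechJet Ω v f g) = jet Ω f := rfl
theorem mechPsi_mechJet : mechPsi (mechJet Ω v f g) = jet Ω g := rfl
theorem thermTheta_thermJet : thermTheta (thermJet Ω f v) = jet Ω f := rfl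
theorem thermT_thermJet (i : Fin 3) : thermT i (thermJet Ω f v) = jet Ω (v i) := rfl
theorem velU_mk (i : Fin 3) (a : Fin 3 → L2 Ω) (b c : L2 Ω) : velU i (velMk a b c) = a i := rfl
theorem velPhi_mk (a : Fin 3 → L2 Ω) (b c : L2 Ω) : velPhi (velMk a b c) = b := rfl
theorem velPsi_mk (a : Fin 3 → L2 Ω) (b c : L2 Ω) : velPsi (velMk a b c) = c := rfl
theorem mechVal_mechJet : mechVal (mechJet Ω v f g) =
    velMk (fun i => toL2 Ω (v i)) (toL2 Ω f) (toL2 Ω g) := rfl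

end spaces

section norms
variable {A B : Type*} [NormedAddCommGroup A] [NormedAddCommGroup B]

theorem prod_norm_sq_le (a : A × B) : ‖a‖ ^ 2 ≤ ‖a.1‖ ^ 2 + ‖a.2‖ ^ 2 := by
  rw [Prod.norm_def]
  rcases max_cases ‖a.1‖ ‖a.2‖ with h | h <;> rw [h.1] <;>
    linarith [sq_nonneg ‖a.1‖, sq_nonneg ‖a.2‖]

theorem pi_norm_sq_le {ι : Type*} [Fintype ι] (a : ι → A) : ‖a‖ ^ 2 ≤ ∑ i, ‖a i‖ ^ 2 := by
  have h0 : 0 ≤ ∑ i, ‖a i‖ ^ 2 := Finset.sum_nonneg fun i _ => sq_nonneg _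
  have h : ‖a‖ ≤ Real.sqrt (∑ i, ‖a i‖ ^ 2) := by
    refine (pi_norm_le_iff_of_nonneg (Real.sqrt_nonneg _)).2 fun i => ?_
    refine Real.le_sqrt_of_sq_le ?_
    exact Finset.single_le_sum (f := fun i => ‖a i‖ ^ 2) (fun i _ => sq_nonneg _)
      (Finset.mem_univ i)
  calc ‖a‖ ^ 2 ≤ Real.sqrt (∑ i, ‖a i‖ ^ 2) ^ 2 := by gcongr
    _ = _ := Real.sq_sqrt h0

end norms

section
variable {Ω : Set Space}

/-- The form `(a, b) ↦ ∫_Ω c (S a) (T b)`. -/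
noncomputable def pairing {A B : Type*} [NormedAddCommGroup A] [NormedSpace ℝ A]
    [NormedAddCommGroup B] [NormedSpace ℝ B] (c : Space → ℝ) (S : A →L[ℝ] L2 Ω)
    (T : B →L[ℝ] L2 Ω) : A →L[ℝ] B →L[ℝ] ℝ :=
  (innerSL ℝ).bilinearComp ((mulL Ω c).comp S) T

theorem pairing_apply {A B : Type*} [NormedAddCommGroup A] [NormedSpace ℝ A]
    [NormedAddCommGroup B] [NormedSpace ℝ B] (c : Space → ℝ) (S : A →L[ℝ] L2 Ω)
    (T : B →L[ℝ] L2 Ω) (a : A) (b : B) : pairing c S T a b = ⟪mulL Ω c (S a), T b⟫ := rfl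

variable (Ω) in
/-- Inertia. -/
noncomputable def Coeffs.inertia (c : Coeffs) : VelSpace Ω →L[ℝ] VelSpace Ω →L[ℝ] ℝ :=
  (∑ i, pairing c.rho (velU i) (velU i)) + pairing c.k1 velPhi velPhi + pairing c.k2 velPsi velPsi

/-- The symmetric part of `γ`, which is all that the internal energy sees; `γ` itself need not be
symmetric. -/
noncomputable def Coeffs.gammaSymm (c : Coeffs) (i j : Fin 3) (x : Space) : ℝ :=
  (1 / 2) * (c.gamma i j x + c.gamma j i x)

/-- The skew part of `γ`. -/
noncomputable def Coeffs.gammaSkew (c : Coeffs) (i j : Fin 3) (x : Space) : ℝ :=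
  (1 / 2) * (c.gamma i j x - c.gamma j i x)

variable (Ω) in
/-- The symmetric bilinear form whose quadratic form is the internal energy. -/
noncomputable def Coeffs.elastic (c : Coeffs) : MechSpace Ω →L[ℝ] MechSpace Ω →L[ℝ] ℝ :=
  (∑ i, ∑ j, ∑ k, ∑ l,
      pairing (c.C i j k l) ((jetGrad l).comp (mechU k)) ((jetGrad j).comp (mechU i)))
    + (∑ i, ∑ j, pairing (c.B i j) (jetVal.comp mechPhi) ((jetGrad j).comp (mechU i)))
    + (∑ i, ∑ j, pairing (c.D i j) (jetVal.comp mechPsi) ((jetGrad j).comp (mechU i)))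
    + (∑ i, ∑ j, pairing (c.alpha i j) ((jetGrad i).comp mechPhi) ((jetGrad j).comp mechPhi))
    + (∑ i, ∑ j, pairing (c.b i j) ((jetGrad i).comp mechPsi) ((jetGrad j).comp mechPhi))
    + (∑ i, ∑ j, pairing (c.b i j) ((jetGrad i).comp mechPhi) ((jetGrad j).comp mechPsi))
    + (∑ i, ∑ j, pairing (c.gammaSymm i j) ((jetGrad i).comp mechPsi) ((jetGrad j).comp mechPsi))
    + (∑ i, ∑ j, pairing (c.B i j) ((jetGrad j).comp (mechU i)) (jetVal.comp mechPhi))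
    + (∑ i, ∑ j, pairing (c.D i j) ((jetGrad j).comp (mechU i)) (jetVal.comp mechPsi))
    + pairing c.alpha1 (jetVal.comp mechPhi) (jetVal.comp mechPhi)
    + pairing c.alpha3 (jetVal.comp mechPsi) (jetVal.comp mechPhi)
    + pairing c.alpha3 (jetVal.comp mechPhi) (jetVal.comp mechPsi)
    + pairing c.alpha2 (jetVal.comp mechPsi) (jetVal.comp mechPsi)

variable (Ω) in
/-- The contribution of the skew part of `γ`, which is of lower order (`sum_gammaSkew_weak`). -/
noncomputable def Coeffs.skew (c : Coeffs) : MechSpace Ω →L[ℝ] VelSpace Ω →L[ℝ] ℝ :=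
  -∑ i, ∑ j, pairing (pd j (c.gammaSkew i j)) ((jetGrad i).comp mechPsi) velPsi

variable (Ω) in
/-- The force exerted by the thermal on the mechanical fields. -/
noncomputable def Coeffs.coupling (c : Coeffs) : ThermSpace Ω →L[ℝ] VelSpace Ω →L[ℝ] ℝ :=
  -(∑ i, ∑ j, pairing (pd j (c.beta i j)) (jetVal.comp thermTheta) (velU i))
    - (∑ i, ∑ j, pairing (c.beta i j) ((jetGrad j).comp thermTheta) (velU i))
    - (∑ j, ∑ i, pairing (pd j (c.N i j)) (jetVal.comp (thermT i)) velPhi)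
    - (∑ j, ∑ i, pairing (c.N i j) ((jetGrad j).comp (thermT i)) velPhi)
    + pairing c.gamma1 (jetVal.comp thermTheta) velPhi
    - (∑ j, ∑ i, pairing (pd j (c.M i j)) (jetVal.comp (thermT i)) velPsi)
    - (∑ j, ∑ i, pairing (c.M i j) ((jetGrad j).comp (thermT i)) velPsi)
    + pairing c.gamma2 (jetVal.comp thermTheta) velPsi

variable (Ω) in
/-- Heat capacity. -/
noncomputable def Coeffs.capacity (c : Coeffs) : ThermSpace Ω →L[ℝ] ThermSpace Ω →L[ℝ] ℝ :=
  pairing c.a (jetVal.comp thermTheta) (jetVal.comp thermTheta)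
    + ∑ i, ∑ j, pairing (c.P i j) (jetVal.comp (thermT j)) (jetVal.comp (thermT i))

variable (Ω) in
/-- Dissipation by heat conduction. -/
noncomputable def Coeffs.dissipation (c : Coeffs) : ThermSpace Ω →L[ℝ] ThermSpace Ω →L[ℝ] ℝ :=
  (1 / c.T0) • ((∑ i, ∑ j, pairing (c.kappa i j) ((jetGrad j).comp thermTheta)
        ((jetGrad i).comp thermTheta))
      + ∑ i, ∑ j, pairing (c.L i j) (jetVal.comp (thermT j)) ((jetGrad i).comp thermTheta))
    + (∑ i, ∑ j, ∑ r, ∑ s,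
        pairing (c.A j i r s) ((jetGrad r).comp (thermT s)) ((jetGrad j).comp (thermT i)))
    + (∑ i, ∑ j, pairing (c.R i j) (jetVal.comp (thermT j)) (jetVal.comp (thermT i)))
    + ∑ i, ∑ j, pairing (c.lam i j) ((jetGrad j).comp thermTheta) (jetVal.comp (thermT i))

end

section
variable {Ω : Set Space} (c : Coeffs)

theorem Coeffs.inertia_apply (v w : VelSpace Ω) : c.inertia Ω v w =
    (∑ i, ⟪mulL Ω c.rho (velU i v), velU i w⟫) + ⟪mulL Ω c.k1 (velPhi v), velPhi w⟫
      + ⟪mulL Ω c.k2 (velPsi v), velPsi w⟫ := by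
  simp only [Coeffs.inertia, add_apply, sum_apply, pairing_apply]

theorem Coeffs.elastic_apply (z w : MechSpace Ω) : c.elastic Ω z w =
    (∑ i, ∑ j, ∑ k, ∑ l,
      ⟪mulL Ω (c.C i j k l) (jetGrad l (mechU k z)), jetGrad j (mechU i w)⟫)
    + (∑ i, ∑ j, ⟪mulL Ω (c.B i j) (jetVal (mechPhi z)), jetGrad j (mechU i w)⟫)
    + (∑ i, ∑ j, ⟪mulL Ω (c.D i j) (jetVal (mechPsi z)), jetGrad j (mechU i w)⟫)
    + (∑ i, ∑ j, ⟪mulL Ω (c.alpha i j) (jetGrad i (mechPhi z)), jetGrad j (mechPhi w)⟫)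
    + (∑ i, ∑ j, ⟪mulL Ω (c.b i j) (jetGrad i (mechPsi z)), jetGrad j (mechPhi w)⟫)
    + (∑ i, ∑ j, ⟪mulL Ω (c.b i j) (jetGrad i (mechPhi z)), jetGrad j (mechPsi w)⟫)
    + (∑ i, ∑ j, ⟪mulL Ω (c.gammaSymm i j) (jetGrad i (mechPsi z)), jetGrad j (mechPsi w)⟫)
    + (∑ i, ∑ j, ⟪mulL Ω (c.B i j) (jetGrad j (mechU i z)), jetVal (mechPhi w)⟫)
    + (∑ i, ∑ j, ⟪mulL Ω (c.D i j) (jetGrad j (mechU i z)), jetVal (mechPsi w)⟫)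
    + ⟪mulL Ω c.alpha1 (jetVal (mechPhi z)), jetVal (mechPhi w)⟫
    + ⟪mulL Ω c.alpha3 (jetVal (mechPsi z)), jetVal (mechPhi w)⟫
    + ⟪mulL Ω c.alpha3 (jetVal (mechPhi z)), jetVal (mechPsi w)⟫
    + ⟪mulL Ω c.alpha2 (jetVal (mechPsi z)), jetVal (mechPsi w)⟫ := by
  simp only [Coeffs.elastic, add_apply, sum_apply, pairing_apply, ContinuousLinearMap.comp_apply]

theorem Coeffs.skew_apply (z : MechSpace Ω) (w : VelSpace Ω) : c.skew Ω z w =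
    -∑ i, ∑ j, ⟪mulL Ω (pd j (c.gammaSkew i j)) (jetGrad i (mechPsi z)), velPsi w⟫ := by
  simp only [Coeffs.skew, neg_apply, sum_apply, pairing_apply, ContinuousLinearMap.comp_apply]

theorem Coeffs.coupling_apply (y : ThermSpace Ω) (w : VelSpace Ω) : c.coupling Ω y w =
    -(∑ i, ∑ j, ⟪mulL Ω (pd j (c.beta i j)) (jetVal (thermTheta y)), velU i w⟫)
    - (∑ i, ∑ j, ⟪mulL Ω (c.beta i j) (jetGrad j (thermTheta y)), velU i w⟫)
    - (∑ j, ∑ i, ⟪mulL Ω (pd j (c.N i j)) (jetVal (thermT i y)), velPhi w⟫)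
    - (∑ j, ∑ i, ⟪mulL Ω (c.N i j) (jetGrad j (thermT i y)), velPhi w⟫)
    + ⟪mulL Ω c.gamma1 (jetVal (thermTheta y)), velPhi w⟫
    - (∑ j, ∑ i, ⟪mulL Ω (pd j (c.M i j)) (jetVal (thermT i y)), velPsi w⟫)
    - (∑ j, ∑ i, ⟪mulL Ω (c.M i j) (jetGrad j (thermT i y)), velPsi w⟫)
    + ⟪mulL Ω c.gamma2 (jetVal (thermTheta y)), velPsi w⟫ := by
  simp only [Coeffs.coupling, add_apply, sub_apply, neg_apply, sum_apply, pairing_apply,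
    ContinuousLinearMap.comp_apply]

theorem Coeffs.capacity_apply (y η : ThermSpace Ω) : c.capacity Ω y η =
    ⟪mulL Ω c.a (jetVal (thermTheta y)), jetVal (thermTheta η)⟫
      + ∑ i, ∑ j, ⟪mulL Ω (c.P i j) (jetVal (thermT j y)), jetVal (thermT i η)⟫ := by
  simp only [Coeffs.capacity, add_apply, sum_apply, pairing_apply, ContinuousLinearMap.comp_apply]

theorem Coeffs.dissipation_apply (y η : ThermSpace Ω) : c.dissipation Ω y η =
    1 / c.T0 * ((∑ i, ∑ j, ⟪mulL Ω (c.kappa i j) (jetGrad j (thermTheta y)),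
          jetGrad i (thermTheta η)⟫)
        + ∑ i, ∑ j, ⟪mulL Ω (c.L i j) (jetVal (thermT j y)), jetGrad i (thermTheta η)⟫)
      + (∑ i, ∑ j, ∑ r, ∑ s,
          ⟪mulL Ω (c.A j i r s) (jetGrad r (thermT s y)), jetGrad j (thermT i η)⟫)
      + (∑ i, ∑ j, ⟪mulL Ω (c.R i j) (jetVal (thermT j y)), jetVal (thermT i η)⟫)
      + ∑ i, ∑ j, ⟪mulL Ω (c.lam i j) (jetGrad j (thermTheta y)), jetVal (thermT i η)⟫ := by
  simp only [Coeffs.dissipation, add_apply, smul_apply, smul_eq_mul, sum_apply, pairing_apply,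
    ContinuousLinearMap.comp_apply]

end

/-! ### Weak balance equations at a fixed time -/

section
variable {Ω : Set Space} [hΩ : BoundedOpen Ω]

/-- The regularity, at a fixed time, that the divergence theorem needs. -/
structure SpaceRegular (Ω : Set Space) (U : Fields) (t : ℝ) : Prop where
  u : ∀ i, CoeffC1 Ω (U.u i t)
  u_pd : ∀ i j, CoeffC1 Ω (pd j (U.u i t))
  phi : CoeffC1 Ω (U.phi t)
  phi_pd : ∀ j, CoeffC1 Ω (pd j (U.phi t))
  psi : CoeffC1 Ω (U.psi t)
  psi_pd : ∀ j, CoeffC1 Ω (pd j (U.psi t))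
  psi_comm : ∀ i j, ∀ x ∈ Ω, pd j (pd i (U.psi t)) x = pd i (pd j (U.psi t)) x
  theta : CoeffC1 Ω (U.theta t)
  theta_pd : ∀ j, CoeffC1 Ω (pd j (U.theta t))
  T : ∀ i, CoeffC1 Ω (U.T i t)
  T_pd : ∀ i j, CoeffC1 Ω (pd j (U.T i t))

theorem Fields.Regular.spaceRegular {U : Fields} {I : Set ℝ} (hI : UniqueDiffOn ℝ I)
    (h : U.Regular I Ω) {t : ℝ} (ht : t ∈ I) : SpaceRegular Ω U t where
  u i := (h.u i).c1 ht
  u_pd i j := (h.u i).c1_pd hI ht j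
  phi := h.phi.c1 ht
  phi_pd j := h.phi.c1_pd hI ht j
  psi := h.psi.c1 ht
  psi_pd j := h.psi.c1_pd hI ht j
  psi_comm i j _ hx := pd_comm (contDiffOn_slice h.psi.diff ht) hx i j
  theta := h.theta.c1 ht
  theta_pd j := h.theta.c1_pd ht j
  T i := (h.T i).c1 ht
  T_pd i j := (h.T i).c1_pd ht j

variable {c : Coeffs} {U : Fields} {t : ℝ} {w : Space → ℝ}

/-- The derivative of `v` in a product `c v_{,j} w` is moved to the other factors. -/
theorem inner_mulL_toL2_pd {d v : Space → ℝ} (hd : CoeffC1 Ω d) (hv : CoeffC1 Ω v)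
    (hw : StaticField Ω w) (j : Fin 3) :
    ⟪mulL Ω d (toL2 Ω (pd j v)), toL2 Ω w⟫ =
      -⟪mulL Ω (pd j d) (toL2 Ω w), toL2 Ω v⟫ - ⟪mulL Ω d (toL2 Ω (pd j w)), toL2 Ω v⟫ := by
  have h := inner_toL2_pd (hd.mul hv) hw j
  rw [toL2_pd_mul hd hv, toL2_mul hd.c0 hv.c0, inner_add_left, inner_mulL_left (hd.pd j),
    inner_mulL_left hd.c0 (toL2 Ω v)] at h
  rw [real_inner_comm (toL2 Ω v) (mulL Ω (pd j d) (toL2 Ω w)),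
    real_inner_comm (toL2 Ω v) (mulL Ω d (toL2 Ω (pd j w)))]
  linarith

set_option maxHeartbeats 2000000 in
/-- Weak form of the divergence of a flux with components
`F_j = p_{ij} f_{,i} + q_{ij} g_{,i} - n_{ij} T_i`. -/
theorem inner_toL2_div {p q n : Fin 3 → Fin 3 → Space → ℝ} {f g : Space → ℝ}
    {T : Fin 3 → Space → ℝ}
    (hp : ∀ i j, CoeffC1 Ω (p i j)) (hq : ∀ i j, CoeffC1 Ω (q i j)) (hn : ∀ i j, CoeffC1 Ω (n i j))
    (hf : ∀ i, CoeffC1 Ω (pd i f)) (hg : ∀ i, CoeffC1 Ω (pd i g)) (hT : ∀ i, CoeffC1 Ω (T i))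
    (hw : StaticField Ω w) :
    CoeffC0 Ω (fun x => ∑ j, pd j (fun x => ∑ i, (p i j x * pd i f x + q i j x * pd i g x
        - n i j x * T i x)) x) ∧
    ⟪toL2 Ω (fun x => ∑ j, pd j (fun x => ∑ i, (p i j x * pd i f x + q i j x * pd i g x
        - n i j x * T i x)) x), toL2 Ω w⟫ =
      -(∑ i, ∑ j, ⟪mulL Ω (p i j) (toL2 Ω (pd i f)), toL2 Ω (pd j w)⟫)
      - (∑ i, ∑ j, ⟪mulL Ω (q i j) (toL2 Ω (pd i g)), toL2 Ω (pd j w)⟫)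
      - (∑ j, ∑ i, ⟪mulL Ω (pd j (n i j)) (toL2 Ω (T i)), toL2 Ω w⟫)
      - (∑ j, ∑ i, ⟪mulL Ω (n i j) (toL2 Ω (pd j (T i))), toL2 Ω w⟫) := by
  have h1 : ∀ i j, CoeffC1 Ω fun x => p i j x * pd i f x + q i j x * pd i g x := fun i j =>
    ((hp i j).mul (hf i)).add ((hq i j).mul (hg i))
  have h2 : ∀ i j, CoeffC1 Ω fun x => n i j x * T i x := fun i j => (hn i j).mul (hT i)
  have hF : ∀ j, CoeffC1 Ω fun x => ∑ i, (p i j x * pd i f x + q i j x * pd i g x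
      - n i j x * T i x) := fun j => .sum fun i _ => (h1 i j).sub (h2 i j)
  refine ⟨.sum fun j _ => (hF j).pd j, ?_⟩
  rw [toL2_sum fun j _ => (hF j).pd j, sum_inner,
    Finset.sum_comm (f := fun i j => ⟪mulL Ω (p i j) (toL2 Ω (pd i f)), toL2 Ω (pd j w)⟫),
    Finset.sum_comm (f := fun i j => ⟪mulL Ω (q i j) (toL2 Ω (pd i g)), toL2 Ω (pd j w)⟫),
    ← Finset.sum_neg_distrib, ← Finset.sum_sub_distrib, ← Finset.sum_sub_distrib,
    ← Finset.sum_sub_distrib]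
  refine Finset.sum_congr rfl fun j _ => ?_
  have e : ∀ i, ⟪toL2 Ω (pd j fun x => p i j x * pd i f x + q i j x * pd i g x
      - n i j x * T i x), toL2 Ω w⟫ =
      -⟪mulL Ω (p i j) (toL2 Ω (pd i f)), toL2 Ω (pd j w)⟫
      - ⟪mulL Ω (q i j) (toL2 Ω (pd i g)), toL2 Ω (pd j w)⟫
      - ⟪mulL Ω (pd j (n i j)) (toL2 Ω (T i)), toL2 Ω w⟫
      - ⟪mulL Ω (n i j) (toL2 Ω (pd j (T i))), toL2 Ω w⟫ := by
    intro i
    rw [toL2_pd_sub (h1 i j) (h2 i j), toL2_pd_mul (hn i j) (hT i), inner_sub_left,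
      inner_toL2_pd (h1 i j) hw, toL2_add ((hp i j).c0.mul (hf i).c0) ((hq i j).c0.mul (hg i).c0),
      toL2_mul (hp i j).c0 (hf i).c0, toL2_mul (hq i j).c0 (hg i).c0, inner_add_left,
      inner_add_left]
    ring
  rw [toL2_pd_sum fun i _ => (h1 i j).sub (h2 i j), sum_inner, Finset.sum_congr rfl fun i _ => e i]
  simp only [Finset.sum_sub_distrib, Finset.sum_neg_distrib]

set_option maxHeartbeats 2000000 in
theorem momentum_weak (hc : c.Regular Ω) (h : SpaceRegular Ω U t) (i : Fin 3) {a : Space → ℝ}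
    (ha : CoeffC0 Ω a) (heq : ∀ x ∈ Ω, c.rho x * a x = ∑ j, pd j (c.stress U i j t) x)
    (hw : StaticField Ω w) :
    ⟪mulL Ω c.rho (toL2 Ω a), toL2 Ω w⟫ =
      -(∑ j, ∑ k, ∑ l, ⟪mulL Ω (c.C i j k l) (toL2 Ω (pd l (U.u k t))), toL2 Ω (pd j w)⟫)
      - (∑ j, ⟪mulL Ω (c.B i j) (toL2 Ω (U.phi t)), toL2 Ω (pd j w)⟫)
      - (∑ j, ⟪mulL Ω (c.D i j) (toL2 Ω (U.psi t)), toL2 Ω (pd j w)⟫)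
      - (∑ j, ⟪mulL Ω (pd j (c.beta i j)) (toL2 Ω (U.theta t)), toL2 Ω w⟫)
      - (∑ j, ⟪mulL Ω (c.beta i j) (toL2 Ω (pd j (U.theta t))), toL2 Ω w⟫) := by
  have hC0 : ∀ j k l, CoeffC1 Ω fun x => c.C i j k l x * pd l (U.u k t) x := fun j k l =>
    (hc.C i j k l).mul (h.u_pd k l)
  have hC1 : ∀ j k, CoeffC1 Ω fun x => ∑ l, c.C i j k l x * pd l (U.u k t) x := fun j k =>
    .sum fun l _ => hC0 j k l
  have hC2 : ∀ j, CoeffC1 Ω fun x => ∑ k, ∑ l, c.C i j k l x * pd l (U.u k t) x := fun j =>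
    .sum fun k _ => hC1 j k
  have hB : ∀ j, CoeffC1 Ω fun x => c.B i j x * U.phi t x := fun j => (hc.B i j).mul h.phi
  have hD : ∀ j, CoeffC1 Ω fun x => c.D i j x * U.psi t x := fun j => (hc.D i j).mul h.psi
  have hb : ∀ j, CoeffC1 Ω fun x => c.beta i j x * U.theta t x := fun j =>
    (hc.beta i j).mul h.theta
  have hS : ∀ j, CoeffC1 Ω fun x => (∑ k, ∑ l, c.C i j k l x * pd l (U.u k t) x)
      + c.B i j x * U.phi t x + c.D i j x * U.psi t x := fun j => ((hC2 j).add (hB j)).add (hD j)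
  have hstress : ∀ j, CoeffC1 Ω (c.stress U i j t) := fun j => (hS j).sub (hb j)
  rw [← toL2_mul hc.rho ha, toL2_congr heq, toL2_sum fun j _ => (hstress j).pd j, sum_inner,
    ← Finset.sum_neg_distrib, ← Finset.sum_sub_distrib, ← Finset.sum_sub_distrib,
    ← Finset.sum_sub_distrib, ← Finset.sum_sub_distrib]
  refine Finset.sum_congr rfl fun j _ => ?_
  have e : toL2 Ω (pd j (c.stress U i j t)) = _ := toL2_pd_sub (hS j) (hb j)
  rw [e, inner_sub_left, inner_toL2_pd (hS j) hw,
    toL2_add ((hC2 j).add (hB j)).c0 (hD j).c0, toL2_add (hC2 j).c0 (hB j).c0,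
    toL2_sum fun k _ => (hC1 j k).c0, toL2_mul (hc.B i j).c0 h.phi.c0,
    toL2_mul (hc.D i j).c0 h.psi.c0, toL2_pd_mul (hc.beta i j) h.theta]
  simp only [inner_add_left, sum_inner]
  have e2 : ∀ k, ⟪toL2 Ω (fun x => ∑ l, c.C i j k l x * pd l (U.u k t) x), toL2 Ω (pd j w)⟫ =
      ∑ l, ⟪mulL Ω (c.C i j k l) (toL2 Ω (pd l (U.u k t))), toL2 Ω (pd j w)⟫ := by
    intro k
    rw [toL2_sum fun l _ => (hC0 j k l).c0, sum_inner]
    exact Finset.sum_congr rfl fun l _ => by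
      rw [toL2_mul (hc.C i j k l).c0 (h.u_pd k l).c0]
  rw [Finset.sum_congr rfl fun k _ => e2 k]
  ring

set_option maxHeartbeats 2000000 in
/-- The terms of zero order in the balance of equilibrated forces. -/
theorem inner_toL2_balance {F a p r s e : Space → ℝ} {k : Space → ℝ}
    {B : Fin 3 → Fin 3 → Space → ℝ}
    (hB : ∀ i j, CoeffC1 Ω (B i j)) (hp : CoeffC0 Ω p) (hr : CoeffC0 Ω r) (hs : CoeffC0 Ω s)
    (hk : CoeffC0 Ω k) (h : SpaceRegular Ω U t) (ha : CoeffC0 Ω a) (hF : CoeffC0 Ω F)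
    (heq : ∀ x ∈ Ω, k x * a x = F x - (∑ i, ∑ j, B i j x * pd j (U.u i t) x)
      - p x * U.phi t x - r x * U.psi t x + s x * U.theta t x) :
    ⟪mulL Ω k (toL2 Ω a), toL2 Ω e⟫ = ⟪toL2 Ω F, toL2 Ω e⟫
      - (∑ i, ∑ j, ⟪mulL Ω (B i j) (toL2 Ω (pd j (U.u i t))), toL2 Ω e⟫)
      - ⟪mulL Ω p (toL2 Ω (U.phi t)), toL2 Ω e⟫ - ⟪mulL Ω r (toL2 Ω (U.psi t)), toL2 Ω e⟫
      + ⟪mulL Ω s (toL2 Ω (U.theta t)), toL2 Ω e⟫ := by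
  have h1 : ∀ i j, CoeffC0 Ω fun x => B i j x * pd j (U.u i t) x := fun i j =>
    (hB i j).c0.mul (h.u_pd i j).c0
  have h2 : ∀ i, CoeffC0 Ω fun x => ∑ j, B i j x * pd j (U.u i t) x := fun i =>
    .sum fun j _ => h1 i j
  have h3 : CoeffC0 Ω fun x => ∑ i, ∑ j, B i j x * pd j (U.u i t) x := .sum fun i _ => h2 i
  have h4 := hp.mul h.phi.c0
  have h5 := hr.mul h.psi.c0
  have h6 := hs.mul h.theta.c0
  rw [← toL2_mul hk ha, toL2_congr heq, toL2_add (((hF.sub h3).sub h4).sub h5) h6,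
    toL2_sub ((hF.sub h3).sub h4) h5, toL2_sub (hF.sub h3) h4, toL2_sub hF h3,
    toL2_mul hp h.phi.c0, toL2_mul hr h.psi.c0, toL2_mul hs h.theta.c0,
    toL2_sum fun i _ => h2 i]
  simp only [inner_add_left, inner_sub_left, sum_inner]
  have e1 : ∀ i, ⟪toL2 Ω (fun x => ∑ j, B i j x * pd j (U.u i t) x), toL2 Ω e⟫ =
      ∑ j, ⟪mulL Ω (B i j) (toL2 Ω (pd j (U.u i t))), toL2 Ω e⟫ := by
    intro i
    rw [toL2_sum fun j _ => h1 i j, sum_inner]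
    exact Finset.sum_congr rfl fun j _ => by rw [toL2_mul (hB i j).c0 (h.u_pd i j).c0]
  rw [Finset.sum_congr rfl fun i _ => e1 i]

theorem phi_weak (hc : c.Regular Ω) (h : SpaceRegular Ω U t) {a : Space → ℝ}
    (ha : CoeffC0 Ω a) (heq : ∀ x ∈ Ω, c.k1 x * a x =
      (∑ j, pd j (c.sigma U j t) x) - (∑ i, ∑ j, c.B i j x * pd j (U.u i t) x)
        - c.alpha1 x * U.phi t x - c.alpha3 x * U.psi t x + c.gamma1 x * U.theta t x)
    (hw : StaticField Ω w) :
    ⟪mulL Ω c.k1 (toL2 Ω a), toL2 Ω w⟫ =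
      -(∑ i, ∑ j, ⟪mulL Ω (c.alpha i j) (toL2 Ω (pd i (U.phi t))), toL2 Ω (pd j w)⟫)
      - (∑ i, ∑ j, ⟪mulL Ω (c.b i j) (toL2 Ω (pd i (U.psi t))), toL2 Ω (pd j w)⟫)
      - (∑ j, ∑ i, ⟪mulL Ω (pd j (c.N i j)) (toL2 Ω (U.T i t)), toL2 Ω w⟫)
      - (∑ j, ∑ i, ⟪mulL Ω (c.N i j) (toL2 Ω (pd j (U.T i t))), toL2 Ω w⟫)
      - (∑ i, ∑ j, ⟪mulL Ω (c.B i j) (toL2 Ω (pd j (U.u i t))), toL2 Ω w⟫)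
      - ⟪mulL Ω c.alpha1 (toL2 Ω (U.phi t)), toL2 Ω w⟫
      - ⟪mulL Ω c.alpha3 (toL2 Ω (U.psi t)), toL2 Ω w⟫
      + ⟪mulL Ω c.gamma1 (toL2 Ω (U.theta t)), toL2 Ω w⟫ := by
  have h1 := inner_toL2_div hc.alpha hc.b hc.N h.phi_pd h.psi_pd h.T hw
  rw [inner_toL2_balance hc.B hc.alpha1 hc.alpha3 hc.gamma1 hc.k1 h ha h1.1 heq, h1.2]

theorem Coeffs.Regular.gammaSkew (hc : c.Regular Ω) (i j : Fin 3) :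
    CoeffC1 Ω (c.gammaSkew i j) :=
  (CoeffC1.const _).mul ((hc.gamma i j).sub (hc.gamma j i))

theorem Coeffs.Regular.gammaSymm (hc : c.Regular Ω) (i j : Fin 3) :
    CoeffC1 Ω (c.gammaSymm i j) :=
  (CoeffC1.const _).mul ((hc.gamma i j).add (hc.gamma j i))

/-- A skew coefficient in the principal part is of lower order, because second derivatives
commute. -/
theorem sum_gammaSkew_weak (hc : c.Regular Ω) (h : SpaceRegular Ω U t) (hw : StaticField Ω w) :
    ∑ i, ∑ j, ⟪mulL Ω (c.gammaSkew i j) (toL2 Ω (pd i (U.psi t))), toL2 Ω (pd j w)⟫ =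
      -∑ i, ∑ j, ⟪mulL Ω (pd j (c.gammaSkew i j)) (toL2 Ω (pd i (U.psi t))), toL2 Ω w⟫ := by
  have e : ∀ i j, ⟪mulL Ω (c.gammaSkew i j) (toL2 Ω (pd i (U.psi t))), toL2 Ω (pd j w)⟫ =
      -⟪mulL Ω (pd j (c.gammaSkew i j)) (toL2 Ω (pd i (U.psi t))), toL2 Ω w⟫
        - ⟪mulL Ω (c.gammaSkew i j) (toL2 Ω (pd j (pd i (U.psi t)))), toL2 Ω w⟫ := by
    intro i j
    have := inner_toL2_pd ((hc.gammaSkew i j).mul (h.psi_pd i)) hw j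
    rw [toL2_pd_mul (hc.gammaSkew i j) (h.psi_pd i), toL2_mul (hc.gammaSkew i j).c0 (h.psi_pd i).c0,
      inner_add_left] at this
    linarith
  have e0 : ∑ i, ∑ j, ⟪mulL Ω (c.gammaSkew i j) (toL2 Ω (pd j (pd i (U.psi t)))), toL2 Ω w⟫ = 0 := by
    have hs : ∀ i j, ⟪mulL Ω (c.gammaSkew i j) (toL2 Ω (pd j (pd i (U.psi t)))), toL2 Ω w⟫ =
        -⟪mulL Ω (c.gammaSkew j i) (toL2 Ω (pd i (pd j (U.psi t)))), toL2 Ω w⟫ := by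
      intro i j
      rw [← toL2_mul (hc.gammaSkew i j).c0 ((h.psi_pd i).pd j),
        ← toL2_mul (hc.gammaSkew j i).c0 ((h.psi_pd j).pd i), ← inner_neg_left,
        ← toL2_neg ((hc.gammaSkew j i).c0.mul ((h.psi_pd j).pd i))]
      congr 1
      refine toL2_congr fun x hx => ?_
      rw [h.psi_comm i j x hx, Coeffs.gammaSkew, Coeffs.gammaSkew]
      ring
    have h2 : ∑ i, ∑ j, ⟪mulL Ω (c.gammaSkew i j) (toL2 Ω (pd j (pd i (U.psi t)))), toL2 Ω w⟫ =
        -∑ i, ∑ j, ⟪mulL Ω (c.gammaSkew i j) (toL2 Ω (pd j (pd i (U.psi t)))), toL2 Ω w⟫ := by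
      conv_lhs => rw [Finset.sum_comm]
      simp only [← Finset.sum_neg_distrib]
      exact Finset.sum_congr rfl fun i _ => Finset.sum_congr rfl fun j _ => hs j i
    linarith
  simp only [e, Finset.sum_sub_distrib, Finset.sum_neg_distrib, e0, sub_zero]

theorem psi_weak (hc : c.Regular Ω) (h : SpaceRegular Ω U t) {a : Space → ℝ}
    (ha : CoeffC0 Ω a) (heq : ∀ x ∈ Ω, c.k2 x * a x =
      (∑ j, pd j (c.tau U j t) x) - (∑ i, ∑ j, c.D i j x * pd j (U.u i t) x)
        - c.alpha3 x * U.phi t x - c.alpha2 x * U.psi t x + c.gamma2 x * U.theta t x)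
    (hw : StaticField Ω w) :
    ⟪mulL Ω c.k2 (toL2 Ω a), toL2 Ω w⟫ =
      -(∑ i, ∑ j, ⟪mulL Ω (c.b i j) (toL2 Ω (pd i (U.phi t))), toL2 Ω (pd j w)⟫)
      - (∑ i, ∑ j, ⟪mulL Ω (c.gammaSymm i j) (toL2 Ω (pd i (U.psi t))), toL2 Ω (pd j w)⟫)
      + (∑ i, ∑ j, ⟪mulL Ω (pd j (c.gammaSkew i j)) (toL2 Ω (pd i (U.psi t))), toL2 Ω w⟫)
      - (∑ j, ∑ i, ⟪mulL Ω (pd j (c.M i j)) (toL2 Ω (U.T i t)), toL2 Ω w⟫)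
      - (∑ j, ∑ i, ⟪mulL Ω (c.M i j) (toL2 Ω (pd j (U.T i t))), toL2 Ω w⟫)
      - (∑ i, ∑ j, ⟪mulL Ω (c.D i j) (toL2 Ω (pd j (U.u i t))), toL2 Ω w⟫)
      - ⟪mulL Ω c.alpha3 (toL2 Ω (U.phi t)), toL2 Ω w⟫
      - ⟪mulL Ω c.alpha2 (toL2 Ω (U.psi t)), toL2 Ω w⟫
      + ⟪mulL Ω c.gamma2 (toL2 Ω (U.theta t)), toL2 Ω w⟫ := by
  have h1 := inner_toL2_div hc.b hc.gamma hc.M h.phi_pd h.psi_pd h.T hw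
  have h2 : ∀ i j, ⟪mulL Ω (c.gamma i j) (toL2 Ω (pd i (U.psi t))), toL2 Ω (pd j w)⟫ =
      ⟪mulL Ω (c.gammaSymm i j) (toL2 Ω (pd i (U.psi t))), toL2 Ω (pd j w)⟫
        + ⟪mulL Ω (c.gammaSkew i j) (toL2 Ω (pd i (U.psi t))), toL2 Ω (pd j w)⟫ := by
    intro i j
    rw [← toL2_mul (hc.gamma i j).c0 (h.psi_pd i).c0,
      ← toL2_mul (hc.gammaSymm i j).c0 (h.psi_pd i).c0,
      ← toL2_mul (hc.gammaSkew i j).c0 (h.psi_pd i).c0, ← inner_add_left,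
      ← toL2_add ((hc.gammaSymm i j).c0.mul (h.psi_pd i).c0)
        ((hc.gammaSkew i j).c0.mul (h.psi_pd i).c0)]
    congr 1
    refine toL2_congr fun x _ => ?_
    rw [Coeffs.gammaSymm, Coeffs.gammaSkew]
    ring
  rw [inner_toL2_balance hc.D hc.alpha3 hc.alpha2 hc.gamma2 hc.k2 h ha h1.1 heq, h1.2]
  simp only [h2, Finset.sum_add_distrib, sum_gammaSkew_weak hc h hw]
  ring

variable {σ : ℝ}

set_option maxHeartbeats 2000000 in
theorem heat_weak (hc : c.Regular Ω) (h : SpaceRegular Ω U t) {dθ dφ dψ : Space → ℝ}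
    {du : Fin 3 → Space → ℝ} (hdθ : CoeffC0 Ω dθ) (hdφ : CoeffC0 Ω dφ) (hdψ : CoeffC0 Ω dψ)
    (hdu : ∀ i, CoeffC1 Ω (du i))
    (heq : ∀ x ∈ Ω, c.a x * dθ x = -(∑ i, ∑ j, c.beta i j x * pd j (du i) x)
        - c.gamma1 x * dφ x - c.gamma2 x * dψ x
        - σ * (1 / c.T0) * ∑ i, pd i (c.heatFlux U i t) x)
    (hw : StaticField Ω w) :
    ⟪mulL Ω c.a (toL2 Ω dθ), toL2 Ω w⟫ =
      (∑ i, ∑ j, ⟪mulL Ω (pd j (c.beta i j)) (toL2 Ω w), toL2 Ω (du i)⟫)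
      + (∑ i, ∑ j, ⟪mulL Ω (c.beta i j) (toL2 Ω (pd j w)), toL2 Ω (du i)⟫)
      - ⟪mulL Ω c.gamma1 (toL2 Ω w), toL2 Ω dφ⟫ - ⟪mulL Ω c.gamma2 (toL2 Ω w), toL2 Ω dψ⟫
      + σ * (1 / c.T0 * (
        (∑ i, ∑ j, ⟪mulL Ω (c.kappa i j) (toL2 Ω (pd j (U.theta t))), toL2 Ω (pd i w)⟫)
        + ∑ i, ∑ j, ⟪mulL Ω (c.L i j) (toL2 Ω (U.T j t)), toL2 Ω (pd i w)⟫)) := by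
  have hq0 : ∀ i j, CoeffC1 Ω fun x => c.kappa i j x * pd j (U.theta t) x := fun i j =>
    (hc.kappa i j).mul (h.theta_pd j)
  have hq1 : ∀ i j, CoeffC1 Ω fun x => c.L i j x * U.T j t x := fun i j => (hc.L i j).mul (h.T j)
  have hq : ∀ i, CoeffC1 Ω (c.heatFlux U i t) := fun i =>
    .sum fun j _ => (hq0 i j).add (hq1 i j)
  have hb0 : ∀ i j, CoeffC0 Ω fun x => c.beta i j x * pd j (du i) x := fun i j =>
    (hc.beta i j).c0.mul ((hdu i).pd j)
  have hb1 : ∀ i, CoeffC0 Ω fun x => ∑ j, c.beta i j x * pd j (du i) x := fun i =>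
    .sum fun j _ => hb0 i j
  have hb : CoeffC0 Ω fun x => ∑ i, ∑ j, c.beta i j x * pd j (du i) x := .sum fun i _ => hb1 i
  have h4 := hc.gamma1.mul hdφ
  have h5 := hc.gamma2.mul hdψ
  have h6 : CoeffC0 Ω fun x => ∑ i, pd i (c.heatFlux U i t) x := .sum fun i _ => (hq i).pd i
  rw [← toL2_mul hc.a hdθ, toL2_congr heq,
    toL2_sub ((hb.neg.sub h4).sub h5) ((CoeffC0.const _).mul h6), toL2_sub (hb.neg.sub h4) h5,
    toL2_sub hb.neg h4, toL2_neg hb, toL2_const_mul _ h6, toL2_mul hc.gamma1 hdφ,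
    toL2_mul hc.gamma2 hdψ, toL2_sum fun i _ => hb1 i, toL2_sum fun i _ => (hq i).pd i]
  simp only [inner_sub_left, inner_neg_left, sum_inner, real_inner_smul_left]
  have e1 : ∀ i, ⟪toL2 Ω (fun x => ∑ j, c.beta i j x * pd j (du i) x), toL2 Ω w⟫ =
      -(∑ j, ⟪mulL Ω (pd j (c.beta i j)) (toL2 Ω w), toL2 Ω (du i)⟫)
        - (∑ j, ⟪mulL Ω (c.beta i j) (toL2 Ω (pd j w)), toL2 Ω (du i)⟫) := by
    intro i
    rw [toL2_sum fun j _ => hb0 i j, sum_inner, ← Finset.sum_neg_distrib,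
      ← Finset.sum_sub_distrib]
    exact Finset.sum_congr rfl fun j _ => by
      rw [toL2_mul (hc.beta i j).c0 ((hdu i).pd j), inner_mulL_toL2_pd (hc.beta i j) (hdu i) hw]
  have e2 : ∀ i, ⟪toL2 Ω (pd i (c.heatFlux U i t)), toL2 Ω w⟫ =
      -(∑ j, ⟪mulL Ω (c.kappa i j) (toL2 Ω (pd j (U.theta t))), toL2 Ω (pd i w)⟫)
        - (∑ j, ⟪mulL Ω (c.L i j) (toL2 Ω (U.T j t)), toL2 Ω (pd i w)⟫) := by
    intro i
    rw [inner_toL2_pd (hq i) hw]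
    have e3 : toL2 Ω (c.heatFlux U i t) = _ :=
      toL2_sum fun j _ => ((hq0 i j).add (hq1 i j)).c0
    rw [e3, sum_inner, ← Finset.sum_neg_distrib, ← Finset.sum_neg_distrib,
      ← Finset.sum_sub_distrib]
    refine Finset.sum_congr rfl fun j _ => ?_
    rw [toL2_add (hq0 i j).c0 (hq1 i j).c0, toL2_mul (hc.kappa i j).c0 (h.theta_pd j).c0,
      toL2_mul (hc.L i j).c0 (h.T j).c0, inner_add_left]
    ring
  rw [inner_mulL_left hc.gamma1 (toL2 Ω dφ), inner_mulL_left hc.gamma2 (toL2 Ω dψ),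
    real_inner_comm (mulL Ω c.gamma1 (toL2 Ω w)), real_inner_comm (mulL Ω c.gamma2 (toL2 Ω w))]
  simp only [e1, e2, Finset.sum_sub_distrib, Finset.sum_neg_distrib]
  ring

set_option maxHeartbeats 2000000 in
theorem micro_weak (hc : c.Regular Ω) (h : SpaceRegular Ω U t) (i : Fin 3) {dφ dψ : Space → ℝ}
    {dT : Fin 3 → Space → ℝ} (hdT : ∀ i, CoeffC0 Ω (dT i)) (hdφ : CoeffC1 Ω dφ)
    (hdψ : CoeffC1 Ω dψ)
    (heq : ∀ x ∈ Ω, (∑ j, c.P i j x * dT j x) =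
      -(σ * ∑ j, pd j (c.fluxMoment U j i t) x)
        + σ * (∑ j, c.R i j x * U.T j t x) + σ * (∑ j, c.lam i j x * pd j (U.theta t) x)
        - (∑ j, c.N i j x * pd j dφ x) - (∑ j, c.M i j x * pd j dψ x))
    (hw : StaticField Ω w) :
    ∑ j, ⟪mulL Ω (c.P i j) (toL2 Ω (dT j)), toL2 Ω w⟫ =
      σ * ((∑ j, ∑ r, ∑ s,
          ⟪mulL Ω (c.A j i r s) (toL2 Ω (pd r (U.T s t))), toL2 Ω (pd j w)⟫)
        + (∑ j, ⟪mulL Ω (c.R i j) (toL2 Ω (U.T j t)), toL2 Ω w⟫)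
        + ∑ j, ⟪mulL Ω (c.lam i j) (toL2 Ω (pd j (U.theta t))), toL2 Ω w⟫)
      + (∑ j, ⟪mulL Ω (pd j (c.N i j)) (toL2 Ω w), toL2 Ω dφ⟫)
      + (∑ j, ⟪mulL Ω (c.N i j) (toL2 Ω (pd j w)), toL2 Ω dφ⟫)
      + (∑ j, ⟪mulL Ω (pd j (c.M i j)) (toL2 Ω w), toL2 Ω dψ⟫)
      + (∑ j, ⟪mulL Ω (c.M i j) (toL2 Ω (pd j w)), toL2 Ω dψ⟫) := by
  have hA0 : ∀ j r s, CoeffC1 Ω fun x => c.A j i r s x * pd r (U.T s t) x := fun j r s =>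
    (hc.A j i r s).mul (h.T_pd s r)
  have hA1 : ∀ j r, CoeffC1 Ω fun x => ∑ s, c.A j i r s x * pd r (U.T s t) x := fun j r =>
    .sum fun s _ => hA0 j r s
  have hA : ∀ j, CoeffC1 Ω (c.fluxMoment U j i t) := fun j => .sum fun r _ => hA1 j r
  have hP : ∀ j, CoeffC0 Ω fun x => c.P i j x * dT j x := fun j => (hc.P i j).mul (hdT j)
  have hR : ∀ j, CoeffC0 Ω fun x => c.R i j x * U.T j t x := fun j => (hc.R i j).mul (h.T j).c0
  have hl : ∀ j, CoeffC0 Ω fun x => c.lam i j x * pd j (U.theta t) x := fun j =>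
    (hc.lam i j).mul (h.theta_pd j).c0
  have hN : ∀ j, CoeffC0 Ω fun x => c.N i j x * pd j dφ x := fun j =>
    (hc.N i j).c0.mul (hdφ.pd j)
  have hM : ∀ j, CoeffC0 Ω fun x => c.M i j x * pd j dψ x := fun j =>
    (hc.M i j).c0.mul (hdψ.pd j)
  have sA : CoeffC0 Ω fun x => ∑ j, pd j (c.fluxMoment U j i t) x := .sum fun j _ => (hA j).pd j
  have sA' : CoeffC0 Ω fun x => σ * ∑ j, pd j (c.fluxMoment U j i t) x := (CoeffC0.const _).mul sA
  have sR : CoeffC0 Ω fun x => ∑ j, c.R i j x * U.T j t x := .sum fun j _ => hR j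
  have sR' : CoeffC0 Ω fun x => σ * ∑ j, c.R i j x * U.T j t x := (CoeffC0.const _).mul sR
  have sl : CoeffC0 Ω fun x => ∑ j, c.lam i j x * pd j (U.theta t) x := .sum fun j _ => hl j
  have sl' : CoeffC0 Ω fun x => σ * ∑ j, c.lam i j x * pd j (U.theta t) x :=
    (CoeffC0.const _).mul sl
  have sN : CoeffC0 Ω fun x => ∑ j, c.N i j x * pd j dφ x := .sum fun j _ => hN j
  have sM : CoeffC0 Ω fun x => ∑ j, c.M i j x * pd j dψ x := .sum fun j _ => hM j
  have eP : ∑ j, ⟪mulL Ω (c.P i j) (toL2 Ω (dT j)), toL2 Ω w⟫ =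
      ⟪toL2 Ω (fun x => ∑ j, c.P i j x * dT j x), toL2 Ω w⟫ := by
    rw [toL2_sum fun j _ => hP j, sum_inner]
    exact Finset.sum_congr rfl fun j _ => by rw [toL2_mul (hc.P i j) (hdT j)]
  rw [eP, toL2_congr heq, toL2_sub (((sA'.neg.add sR').add sl').sub sN) sM,
    toL2_sub ((sA'.neg.add sR').add sl') sN, toL2_add (sA'.neg.add sR') sl',
    toL2_add sA'.neg sR', toL2_neg sA', toL2_const_mul _ sA, toL2_const_mul _ sR,
    toL2_const_mul _ sl, toL2_sum fun j _ => hR j, toL2_sum fun j _ => hl j,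
    toL2_sum fun j _ => hN j, toL2_sum fun j _ => hM j, toL2_sum fun j _ => (hA j).pd j]
  simp only [inner_sub_left, inner_add_left, inner_neg_left, sum_inner, real_inner_smul_left]
  have eA : ∀ j, ⟪toL2 Ω (pd j (c.fluxMoment U j i t)), toL2 Ω w⟫ =
      -∑ r, ∑ s, ⟪mulL Ω (c.A j i r s) (toL2 Ω (pd r (U.T s t))), toL2 Ω (pd j w)⟫ := by
    intro j
    rw [inner_toL2_pd (hA j) hw]
    have e3 : toL2 Ω (c.fluxMoment U j i t) = _ := toL2_sum fun r _ => (hA1 j r).c0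
    rw [e3, sum_inner]
    congr 1
    refine Finset.sum_congr rfl fun r _ => ?_
    rw [toL2_sum fun s _ => (hA0 j r s).c0, sum_inner]
    exact Finset.sum_congr rfl fun s _ => by
      rw [toL2_mul (hc.A j i r s).c0 (h.T_pd s r).c0]
  have eR : ∀ j, toL2 Ω (fun x => c.R i j x * U.T j t x) = _ := fun j =>
    toL2_mul (hc.R i j) (h.T j).c0
  have el : ∀ j, toL2 Ω (fun x => c.lam i j x * pd j (U.theta t) x) = _ := fun j =>
    toL2_mul (hc.lam i j) (h.theta_pd j).c0
  have eN : ∀ j, ⟪toL2 Ω (fun x => c.N i j x * pd j dφ x), toL2 Ω w⟫ =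
      -⟪mulL Ω (pd j (c.N i j)) (toL2 Ω w), toL2 Ω dφ⟫
        - ⟪mulL Ω (c.N i j) (toL2 Ω (pd j w)), toL2 Ω dφ⟫ := fun j => by
    rw [toL2_mul (hc.N i j).c0 (hdφ.pd j), inner_mulL_toL2_pd (hc.N i j) hdφ hw j]
  have eM : ∀ j, ⟪toL2 Ω (fun x => c.M i j x * pd j dψ x), toL2 Ω w⟫ =
      -⟪mulL Ω (pd j (c.M i j)) (toL2 Ω w), toL2 Ω dψ⟫
        - ⟪mulL Ω (c.M i j) (toL2 Ω (pd j w)), toL2 Ω dψ⟫ := fun j => by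
    rw [toL2_mul (hc.M i j).c0 (hdψ.pd j), inner_mulL_toL2_pd (hc.M i j) hdψ hw j]
  simp only [eA, eR, el, eN, eM, Finset.sum_sub_distrib, Finset.sum_neg_distrib]
  ring

end

/-! ### Admissible jets and the Poincaré inequality -/

section static
variable {Ω : Set Space} {f g : Space → ℝ}

theorem StaticField.zero : StaticField Ω fun _ => 0 :=
  ⟨continuousOn_const, fun _ _ => rfl, contDiffOn_const, fun j => ⟨0, fun x _ => by simp [pd]⟩⟩

variable [hΩ : BoundedOpen Ω]

theorem pd_const_mul (a : ℝ) {x : Space} (hf : DifferentiableAt ℝ f x) (j : Fin 3) :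
    pd j (fun y => a * f y) x = a * pd j f x := by
  rw [pd, pd, fderiv_const_mul hf]
  rfl

theorem CoeffC1.const_mul (a : ℝ) (hf : CoeffC1 Ω f) : CoeffC1 Ω fun x => a * f x :=
  (CoeffC1.const a).mul hf

theorem StaticField.add (hf : StaticField Ω f) (hg : StaticField Ω g) :
    StaticField Ω fun x => f x + g x :=
  ⟨hf.cont.add hg.cont, fun x hx => by simp only [hf.null x hx, hg.null x hx, add_zero],
    hf.diff.add hg.diff, fun j => ((hf.c1.add hg.c1).pd j).2⟩

theorem StaticField.const_mul (a : ℝ) (hf : StaticField Ω f) :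
    StaticField Ω fun x => a * f x :=
  ⟨continuousOn_const.mul hf.cont, fun x hx => by simp only [hf.null x hx, mul_zero],
    contDiffOn_const.mul hf.diff, fun j => ((hf.c1.const_mul a).pd j).2⟩

theorem jet_zero : jet Ω (fun _ => 0) = 0 := by
  refine Prod.ext toL2_zero (funext fun j => ?_)
  exact (toL2_congr fun x _ => by simp [pd]).trans toL2_zero

theorem jet_add (hf : CoeffC1 Ω f) (hg : CoeffC1 Ω g) :
    jet Ω (fun x => f x + g x) = jet Ω f + jet Ω g :=
  Prod.ext (toL2_add hf.c0 hg.c0) (funext fun _ => toL2_pd_add hf hg)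

theorem jet_sub (hf : CoeffC1 Ω f) (hg : CoeffC1 Ω g) :
    jet Ω (fun x => f x - g x) = jet Ω f - jet Ω g :=
  Prod.ext (toL2_sub hf.c0 hg.c0) (funext fun _ => toL2_pd_sub hf hg)

theorem jet_const_mul (a : ℝ) (hf : CoeffC1 Ω f) :
    jet Ω (fun x => a * f x) = a • jet Ω f :=
  Prod.ext (toL2_const_mul a hf.c0) (funext fun j =>
    (toL2_congr fun _ hx => pd_const_mul a (hf.differentiableAt hx) j).trans
      (toL2_const_mul a (hf.pd j)))

variable (Ω) in
/-- The mechanical jets of admissible static fields. -/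
noncomputable def staticMech : Submodule ℝ (MechSpace Ω) where
  carrier := {h | ∃ (v : Fin 3 → Space → ℝ) (f g : Space → ℝ), (∀ i, StaticField Ω (v i)) ∧
    StaticField Ω f ∧ StaticField Ω g ∧ h = mechJet Ω v f g}
  zero_mem' := ⟨fun _ _ => 0, fun _ => 0, fun _ => 0, fun _ => .zero, .zero, .zero,
    (Prod.ext (funext fun _ => jet_zero) (Prod.ext jet_zero jet_zero)).symm⟩
  add_mem' := by
    rintro _ _ ⟨v, f, g, hv, hf, hg, rfl⟩ ⟨v', f', g', hv', hf', hg', rfl⟩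
    exact ⟨_, _, _, fun i => (hv i).add (hv' i), hf.add hf', hg.add hg',
      (Prod.ext (funext fun i => jet_add (hv i).c1 (hv' i).c1)
        (Prod.ext (jet_add hf.c1 hf'.c1) (jet_add hg.c1 hg'.c1))).symm⟩
  smul_mem' := by
    rintro a _ ⟨v, f, g, hv, hf, hg, rfl⟩
    exact ⟨_, _, _, fun i => (hv i).const_mul a, hf.const_mul a, hg.const_mul a,
      (Prod.ext (funext fun i => jet_const_mul a (hv i).c1)
        (Prod.ext (jet_const_mul a hf.c1) (jet_const_mul a hg.c1))).symm⟩

variable (Ω) in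
/-- The thermal jets of admissible static fields. -/
noncomputable def staticTherm : Submodule ℝ (ThermSpace Ω) where
  carrier := {h | ∃ (θ : Space → ℝ) (T : Fin 3 → Space → ℝ), StaticField Ω θ ∧
    (∀ i, StaticField Ω (T i)) ∧ h = thermJet Ω θ T}
  zero_mem' := ⟨fun _ => 0, fun _ _ => 0, .zero, fun _ => .zero,
    (Prod.ext jet_zero (funext fun _ => jet_zero)).symm⟩
  add_mem' := by
    rintro _ _ ⟨θ, T, hθ, hT, rfl⟩ ⟨θ', T', hθ', hT', rfl⟩
    exact ⟨_, _, hθ.add hθ', fun i => (hT i).add (hT' i),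
      (Prod.ext (jet_add hθ.c1 hθ'.c1) (funext fun i => jet_add (hT i).c1 (hT' i).c1)).symm⟩
  smul_mem' := by
    rintro a _ ⟨θ, T, hθ, hT, rfl⟩
    exact ⟨_, _, hθ.const_mul a, fun i => (hT i).const_mul a,
      (Prod.ext (jet_const_mul a hθ.c1) (funext fun i => jet_const_mul a (hT i).c1)).symm⟩

end static

section integrals
variable {Ω : Set Space} {F G f g d : Space → ℝ} {r s : ℝ}

variable (Ω) in
/-- `F` is continuous and bounded on `Ω`, and `r` is its integral over `Ω`. -/
structure HasInt (F : Space → ℝ) (r : ℝ) : Prop where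
  c0 : CoeffC0 Ω F
  eq : r = ∫ x in Ω, F x

theorem HasInt.const_mul (a : ℝ) (hF : HasInt Ω F r) : HasInt Ω (fun x => a * F x) (a * r) :=
  ⟨(CoeffC0.const a).mul hF.c0, by rw [integral_const_mul, hF.eq]⟩

variable [hΩ : BoundedOpen Ω]

theorem HasInt.inner (hd : CoeffC0 Ω d) (hf : CoeffC0 Ω f) (hg : CoeffC0 Ω g) :
    HasInt Ω (fun x => d x * f x * g x) ⟪mulL Ω d (toL2 Ω f), toL2 Ω g⟫ :=
  ⟨(hd.mul hf).mul hg, inner_mulL_toL2 hd hf hg⟩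

theorem HasInt.norm_sq (hf : CoeffC0 Ω f) : HasInt Ω (fun x => f x ^ 2) (‖toL2 Ω f‖ ^ 2) :=
  ⟨(hf.mul hf).congr fun x _ => sq (f x), norm_toL2_sq hf⟩

theorem HasInt.add (hF : HasInt Ω F r) (hG : HasInt Ω G s) :
    HasInt Ω (fun x => F x + G x) (r + s) :=
  ⟨hF.c0.add hG.c0, by rw [integral_add hF.c0.integrableOn hG.c0.integrableOn, hF.eq, hG.eq]⟩

theorem HasInt.sum {ι : Type*} {S : Finset ι} {F : ι → Space → ℝ} {r : ι → ℝ}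
    (h : ∀ i, HasInt Ω (F i) (r i)) : HasInt Ω (fun x => ∑ i ∈ S, F i x) (∑ i ∈ S, r i) :=
  ⟨.sum fun i _ => (h i).c0, by
    rw [integral_finsetSum _ fun i _ => (h i).c0.integrableOn]
    exact Finset.sum_congr rfl fun i _ => (h i).eq⟩

theorem HasInt.le (hF : HasInt Ω F r) (hG : HasInt Ω G s) (h : ∀ x ∈ Ω, F x ≤ G x) : r ≤ s := by
  rw [hF.eq, hG.eq]
  exact setIntegral_mono_on hF.c0.integrableOn hG.c0.integrableOn hΩ.isOpen.measurableSet h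

theorem HasInt.eq_of_congr (hF : HasInt Ω F r) (h : ∀ x ∈ Ω, F x = G x) : r = ∫ x in Ω, G x := by
  rw [hF.eq]
  exact setIntegral_congr_fun hΩ.isOpen.measurableSet h

theorem mul_norm_sq_le_inner_mulL (hd : CoeffC0 Ω d) (hf : CoeffC0 Ω f) (h : ∀ x ∈ Ω, r ≤ d x) :
    r * ‖toL2 Ω f‖ ^ 2 ≤ ⟪mulL Ω d (toL2 Ω f), toL2 Ω f⟫ :=
  ((HasInt.norm_sq hf).const_mul r).le (.inner hd hf hf) fun x hx => by
    nlinarith [mul_le_mul_of_nonneg_right (h x hx) (mul_self_nonneg (f x))]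

theorem inner_mulL_comm (hd : CoeffC0 Ω d) (u v : L2 Ω) :
    ⟪mulL Ω d u, v⟫ = ⟪mulL Ω d v, u⟫ := by
  rw [inner_mulL_left hd, real_inner_comm]

/-- The Poincaré inequality. -/
theorem exists_poincare : ∃ k : ℝ, 0 ≤ k ∧ ∀ v, StaticField Ω v →
    ‖toL2 Ω v‖ ^ 2 ≤ k * ‖toL2 Ω (pd 0 v)‖ ^ 2 := by
  obtain ⟨R, hR⟩ := hΩ.isBounded.exists_norm_le
  have hb : ∀ x ∈ Ω, |x 0| ≤ R := fun x hx =>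
    (PiLp.norm_apply_le x 0).trans (hR x hx)
  have hpd : ∀ (j : Fin 3) (x : Space), pd j (fun y : Space => y 0) x =
      (EuclideanSpace.single j (1 : ℝ)) 0 := by
    intro j x
    have h : HasFDerivAt (fun y : Space => y 0) (EuclideanSpace.proj (0 : Fin 3) : Space →L[ℝ] ℝ) x :=
      (EuclideanSpace.proj (0 : Fin 3) : Space →L[ℝ] ℝ).hasFDerivAt
    rw [pd, h.fderiv]
    rfl
  have hx : CoeffC1 Ω fun y : Space => y 0 := by
    have h1 : ContDiffOn ℝ 1 (fun y : Space => y 0) Ω :=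
      (EuclideanSpace.proj (0 : Fin 3) : Space →L[ℝ] ℝ).contDiff.contDiffOn
    exact .of_pd h1 ⟨h1.continuousOn, R, hb⟩ fun j => ⟨_, fun x _ => by rw [hpd j x]⟩
  refine ⟨4 * R ^ 2, by positivity, fun v hv => ?_⟩
  have h := inner_toL2_pd (hx.mul hv.c1) hv 0
  have e : toL2 Ω (pd 0 fun x : Space => x 0 * v x) =
      toL2 Ω v + mulL Ω (fun y : Space => y 0) (toL2 Ω (pd 0 v)) := by
    rw [← toL2_mul hx.c0 (hv.c1.pd 0), ← toL2_add hv.c1.c0 (hx.c0.mul (hv.c1.pd 0))]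
    refine toL2_congr fun x hxΩ => ?_
    rw [pd_mul (hx.differentiableAt hxΩ) (hv.c1.differentiableAt hxΩ), hpd]
    simp
  rw [e, inner_add_left, real_inner_self_eq_norm_sq, toL2_mul hx.c0 hv.c1.c0,
    inner_mulL_comm hx.c0 (toL2 Ω v)] at h
  -- `- 2 x v v' ≤ v ^ 2 / 2 + 2 R ^ 2 v' ^ 2`
  have h2 := ((HasInt.inner hx.c0 (hv.c1.pd 0) hv.c1.c0).const_mul (-2)).le
    (((HasInt.norm_sq hv.c1.c0).const_mul (1 / 2)).add
      ((HasInt.norm_sq (hv.c1.pd 0)).const_mul (2 * R ^ 2))) fun x hxΩ => by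
        have h3 : x 0 ^ 2 ≤ R ^ 2 := sq_le_sq' (abs_le.1 (hb x hxΩ)).1 (abs_le.1 (hb x hxΩ)).2
        nlinarith [sq_nonneg (v x + 2 * (x 0 * pd 0 v x)),
          mul_le_mul_of_nonneg_right h3 (sq_nonneg (pd 0 v x))]
  linarith

end integrals

section norms
variable {Ω : Set Space} {v : Fin 3 → Space → ℝ} {f g : Space → ℝ}

theorem norm_jet_sq_le : ‖jet Ω f‖ ^ 2 ≤ ‖toL2 Ω f‖ ^ 2 + ∑ j, ‖toL2 Ω (pd j f)‖ ^ 2 :=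
  (prod_norm_sq_le (jet Ω f : L2 Ω × (Fin 3 → L2 Ω))).trans
    (add_le_add le_rfl (pi_norm_sq_le _))

theorem norm_mechJet_sq_le :
    ‖mechJet Ω v f g‖ ^ 2 ≤ (∑ i, ‖jet Ω (v i)‖ ^ 2) + (‖jet Ω f‖ ^ 2 + ‖jet Ω g‖ ^ 2) :=
  (prod_norm_sq_le (mechJet Ω v f g : (Fin 3 → JetSpace Ω) × JetSpace Ω × JetSpace Ω)).trans
    (add_le_add (pi_norm_sq_le _) (prod_norm_sq_le _))

theorem norm_thermJet_sq_le :
    ‖thermJet Ω f v‖ ^ 2 ≤ ‖jet Ω f‖ ^ 2 + ∑ i, ‖jet Ω (v i)‖ ^ 2 :=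
  (prod_norm_sq_le (thermJet Ω f v : JetSpace Ω × (Fin 3 → JetSpace Ω))).trans
    (add_le_add le_rfl (pi_norm_sq_le _))

theorem norm_velMk_sq_le (a : Fin 3 → L2 Ω) (b c : L2 Ω) :
    ‖velMk a b c‖ ^ 2 ≤ (∑ i, ‖a i‖ ^ 2) + (‖b‖ ^ 2 + ‖c‖ ^ 2) :=
  (prod_norm_sq_le ((a, b, c) : (Fin 3 → L2 Ω) × L2 Ω × L2 Ω)).trans
    (add_le_add (pi_norm_sq_le _) (prod_norm_sq_le _))

end norms

/-! ### Symmetry and coercivity of the forms -/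

section
variable {Ω : Set Space} {c : Coeffs}

theorem Coeffs.capacity_nonneg_at (hp : c.Positive Ω) {x : Space} (hx : x ∈ Ω) (ξ : Fin 3 → ℝ) :
    0 ≤ ∑ i, ∑ j, c.P i j x * ξ j * ξ i := by
  obtain ⟨r, hr, h⟩ := hp.P
  have h1 : 0 ≤ r * ∑ i, ξ i ^ 2 := by positivity
  have h2 := h1.trans (h x hx ξ)
  simpa only [mul_right_comm] using h2

variable [hΩ : BoundedOpen Ω]

theorem sum_comm_pairs (f : Fin 3 → Fin 3 → Fin 3 → Fin 3 → ℝ) :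
    ∑ i, ∑ j, ∑ k, ∑ l, f i j k l = ∑ i, ∑ j, ∑ k, ∑ l, f k l i j := by
  have h : ∀ f : Fin 3 → Fin 3 → Fin 3 → Fin 3 → ℝ, ∑ i, ∑ j, ∑ k, ∑ l, f i j k l =
      ∑ p : Fin 3 × Fin 3, ∑ q : Fin 3 × Fin 3, f p.1 p.2 q.1 q.2 := fun f => by
    simp only [Fintype.sum_prod_type]
  rw [h, h fun i j k l => f k l i j, Finset.sum_comm]

theorem Coeffs.inertia_symm (hc : c.Regular Ω) (v w : VelSpace Ω) :
    c.inertia Ω v w = c.inertia Ω w v := by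
  rw [Coeffs.inertia_apply, Coeffs.inertia_apply, inner_mulL_comm hc.k1, inner_mulL_comm hc.k2]
  simp only [inner_mulL_comm hc.rho (velU _ v)]

theorem Coeffs.capacity_symm (hc : c.Regular Ω) (hs : c.Symmetric Ω) (y η : ThermSpace Ω) :
    c.capacity Ω y η = c.capacity Ω η y := by
  have e : ∀ i j, ⟪mulL Ω (c.P i j) (jetVal (thermT j y)), jetVal (thermT i η)⟫ =
      ⟪mulL Ω (c.P j i) (jetVal (thermT i η)), jetVal (thermT j y)⟫ := fun i j => by
    rw [inner_mulL_comm (hc.P i j), mulL_congr fun x hx => hs.P x hx i j]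
  rw [Coeffs.capacity_apply, Coeffs.capacity_apply, inner_mulL_comm hc.a]
  simp only [e]
  rw [Finset.sum_comm]

theorem Coeffs.elastic_symm (hc : c.Regular Ω) (hs : c.Symmetric Ω) (z w : MechSpace Ω) :
    c.elastic Ω z w = c.elastic Ω w z := by
  have eC : ∑ i, ∑ j, ∑ k, ∑ l,
      ⟪mulL Ω (c.C i j k l) (jetGrad l (mechU k z)), jetGrad j (mechU i w)⟫ =
      ∑ i, ∑ j, ∑ k, ∑ l,
        ⟪mulL Ω (c.C i j k l) (jetGrad l (mechU k w)), jetGrad j (mechU i z)⟫ := by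
    rw [sum_comm_pairs]
    refine Finset.sum_congr rfl fun i _ => Finset.sum_congr rfl fun j _ =>
      Finset.sum_congr rfl fun k _ => Finset.sum_congr rfl fun l _ => ?_
    rw [inner_mulL_comm (hc.C k l i j).c0, mulL_congr fun x hx => hs.C x hx k l i j]
  have eS : ∀ (m : Fin 3 → Fin 3 → Space → ℝ), (∀ i j, CoeffC0 Ω (m i j)) →
      (∀ x ∈ Ω, ∀ i j, m i j x = m j i x) → ∀ p q : JetSpace Ω,
      ∑ i, ∑ j, ⟪mulL Ω (m i j) (jetGrad i p), jetGrad j q⟫ =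
        ∑ i, ∑ j, ⟪mulL Ω (m i j) (jetGrad i q), jetGrad j p⟫ := by
    intro m hm hms p q
    rw [Finset.sum_comm]
    refine Finset.sum_congr rfl fun i _ => Finset.sum_congr rfl fun j _ => ?_
    rw [inner_mulL_comm (hm j i), mulL_congr fun x hx => hms x hx j i]
  have eB : ∀ (m : Fin 3 → Fin 3 → Space → ℝ), (∀ i j, CoeffC1 Ω (m i j)) →
      ∀ (p : MechSpace Ω) (q : L2 Ω),
      ∑ i, ∑ j, ⟪mulL Ω (m i j) q, jetGrad j (mechU i p)⟫ =
        ∑ i, ∑ j, ⟪mulL Ω (m i j) (jetGrad j (mechU i p)), q⟫ := fun m hm p q =>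
    Finset.sum_congr rfl fun i _ => Finset.sum_congr rfl fun j _ => inner_mulL_comm (hm i j).c0 _ _
  rw [c.elastic_apply z w, c.elastic_apply w z]
  linarith [eC, eB c.B hc.B w (jetVal (mechPhi z)), eB c.B hc.B z (jetVal (mechPhi w)),
    eB c.D hc.D w (jetVal (mechPsi z)), eB c.D hc.D z (jetVal (mechPsi w)),
    eS c.alpha (fun i j => (hc.alpha i j).c0) hs.alpha (mechPhi z) (mechPhi w),
    eS c.b (fun i j => (hc.b i j).c0) hs.b (mechPsi z) (mechPhi w),
    eS c.b (fun i j => (hc.b i j).c0) hs.b (mechPhi z) (mechPsi w),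
    eS c.gammaSymm (fun i j => (hc.gammaSymm i j).c0)
      (fun x _ i j => by rw [Coeffs.gammaSymm, Coeffs.gammaSymm, add_comm]) (mechPsi z) (mechPsi w),
    inner_mulL_comm hc.alpha1 (jetVal (mechPhi z)) (jetVal (mechPhi w)),
    inner_mulL_comm hc.alpha3 (jetVal (mechPsi z)) (jetVal (mechPhi w)),
    inner_mulL_comm hc.alpha3 (jetVal (mechPhi z)) (jetVal (mechPsi w)),
    inner_mulL_comm hc.alpha2 (jetVal (mechPsi z)) (jetVal (mechPsi w))]

theorem Coeffs.inertia_coercive (hc : c.Regular Ω) (hp : c.Positive Ω) :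
    ∃ r : ℝ, 0 < r ∧ ∀ w ∈ staticMech Ω,
      r * ‖mechVal w‖ ^ 2 ≤ c.inertia Ω (mechVal w) (mechVal w) := by
  obtain ⟨r1, h1, hr⟩ := hp.rho
  obtain ⟨r2, h2, hk1⟩ := hp.k1
  obtain ⟨r3, h3, hk2⟩ := hp.k2
  refine ⟨min r1 (min r2 r3), by positivity, ?_⟩
  rintro _ ⟨v, f, g, hv, hf, hg, rfl⟩
  set r := min r1 (min r2 r3)
  have hr0 : 0 < r := by positivity
  rw [mechVal_mechJet, Coeffs.inertia_apply, velPhi_mk, velPsi_mk]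
  simp only [velU_mk]
  have e1 := mul_norm_sq_le_inner_mulL (r := r) hc.k1 hf.c1.c0 fun x hx =>
    ((min_le_right _ _).trans (min_le_left _ _)).trans (hk1 x hx)
  have e2 := mul_norm_sq_le_inner_mulL (r := r) hc.k2 hg.c1.c0 fun x hx =>
    ((min_le_right _ _).trans (min_le_right _ _)).trans (hk2 x hx)
  have e3 : r * ∑ i, ‖toL2 Ω (v i)‖ ^ 2 ≤ ∑ i, ⟪mulL Ω c.rho (toL2 Ω (v i)), toL2 Ω (v i)⟫ := by
    rw [Finset.mul_sum]
    exact Finset.sum_le_sum fun i _ => mul_norm_sq_le_inner_mulL hc.rho (hv i).c1.c0 fun x hx =>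
      (min_le_left _ _).trans (hr x hx)
  have e4 := mul_le_mul_of_nonneg_left
    (norm_velMk_sq_le (fun i => toL2 Ω (v i)) (toL2 Ω f) (toL2 Ω g)) hr0.le
  linarith

/-- The form `elastic` evaluates to twice the internal energy. -/
theorem Coeffs.elastic_self (hc : c.Regular Ω) (hs : c.Symmetric Ω) {v : Fin 3 → Space → ℝ}
    {f g : Space → ℝ} (hv : ∀ i, CoeffC1 Ω (v i)) (hf : CoeffC1 Ω f) (hg : CoeffC1 Ω g) :
    c.elastic Ω (mechJet Ω v f g) (mechJet Ω v f g) = ∫ x in Ω, c.energy v f g x := by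
  have eC := HasInt.sum (S := Finset.univ) fun i : Fin 3 => HasInt.sum (S := Finset.univ)
    fun j : Fin 3 => HasInt.sum (S := Finset.univ) fun k : Fin 3 => HasInt.sum (S := Finset.univ)
    fun l : Fin 3 => HasInt.inner (hc.C i j k l).c0 ((hv k).pd l) ((hv i).pd j)
  have eB := HasInt.sum (S := Finset.univ) fun i : Fin 3 => HasInt.sum (S := Finset.univ)
    fun j : Fin 3 => HasInt.inner (hc.B i j).c0 hf.c0 ((hv i).pd j)
  have eD := HasInt.sum (S := Finset.univ) fun i : Fin 3 => HasInt.sum (S := Finset.univ)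
    fun j : Fin 3 => HasInt.inner (hc.D i j).c0 hg.c0 ((hv i).pd j)
  have ea := HasInt.sum (S := Finset.univ) fun i : Fin 3 => HasInt.sum (S := Finset.univ)
    fun j : Fin 3 => HasInt.inner (hc.alpha i j).c0 (hf.pd i) (hf.pd j)
  have eb := HasInt.sum (S := Finset.univ) fun i : Fin 3 => HasInt.sum (S := Finset.univ)
    fun j : Fin 3 => HasInt.inner (hc.b i j).c0 (hg.pd i) (hf.pd j)
  have eb' := HasInt.sum (S := Finset.univ) fun i : Fin 3 => HasInt.sum (S := Finset.univ)
    fun j : Fin 3 => HasInt.inner (hc.b i j).c0 (hf.pd i) (hg.pd j)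
  have eg := HasInt.sum (S := Finset.univ) fun i : Fin 3 => HasInt.sum (S := Finset.univ)
    fun j : Fin 3 => HasInt.inner (hc.gammaSymm i j).c0 (hg.pd i) (hg.pd j)
  have eB' := HasInt.sum (S := Finset.univ) fun i : Fin 3 => HasInt.sum (S := Finset.univ)
    fun j : Fin 3 => HasInt.inner (hc.B i j).c0 ((hv i).pd j) hf.c0
  have eD' := HasInt.sum (S := Finset.univ) fun i : Fin 3 => HasInt.sum (S := Finset.univ)
    fun j : Fin 3 => HasInt.inner (hc.D i j).c0 ((hv i).pd j) hg.c0
  have h := ((((((((((((eC.add eB).add eD).add ea).add eb).add eb').add eg).add eB').add eD').add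
    (.inner hc.alpha1 hf.c0 hf.c0)).add (.inner hc.alpha3 hg.c0 hf.c0)).add
    (.inner hc.alpha3 hf.c0 hg.c0)).add (.inner hc.alpha2 hg.c0 hg.c0))
  rw [Coeffs.elastic_apply]
  simp only [mechU_mechJet, mechPhi_mechJet, mechPsi_mechJet, jetVal_jet, jetGrad_jet]
  refine h.eq_of_congr fun x hx => ?_
  have sC : ∑ i, ∑ j, ∑ k, ∑ l, c.C i j k l x * pd l (v k) x * pd j (v i) x =
      ∑ i, ∑ j, ∑ k, ∑ l, c.C i j k l x * pd j (v i) x * pd l (v k) x := by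
    simp only [mul_right_comm]
  have sB : ∀ (m : Fin 3 → Fin 3 → Space → ℝ) (q : ℝ), ∑ i, ∑ j, m i j x * q * pd j (v i) x =
      ∑ i, ∑ j, m i j x * pd j (v i) x * q := fun m q => by
    simp only [mul_right_comm]
  have sb : ∑ i, ∑ j, c.b i j x * pd i g x * pd j f x =
      ∑ i, ∑ j, c.b i j x * pd i f x * pd j g x := by
    rw [Finset.sum_comm]
    simp only [hs.b x hx _ _, mul_right_comm]
  have sg : ∑ i, ∑ j, c.gammaSymm i j x * pd i g x * pd j g x =
      ∑ i, ∑ j, c.gamma i j x * pd i g x * pd j g x := by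
    simp only [Fin.sum_univ_three, Coeffs.gammaSymm]
    ring
  rw [sC, sB, sB, sb, sg, Coeffs.energy]
  ring

theorem Coeffs.elastic_coercive (hc : c.Regular Ω) (hs : c.Symmetric Ω) (hp : c.Positive Ω) :
    ∃ r : ℝ, 0 < r ∧ ∀ w ∈ staticMech Ω, r * ‖w‖ ^ 2 ≤ c.elastic Ω w w := by
  obtain ⟨r, hr0, hr⟩ := hp.energy
  obtain ⟨k, hk0, hk⟩ := exists_poincare (Ω := Ω)
  refine ⟨r / (1 + k), by positivity, ?_⟩
  rintro _ ⟨v, f, g, hv, hf, hg, rfl⟩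
  rw [Coeffs.elastic_self hc hs (fun i => (hv i).c1) hf.c1 hg.c1]
  refine le_trans ?_ (hr v f g hv hf hg)
  have e1 := HasInt.sum (S := Finset.univ) fun i : Fin 3 => HasInt.sum (S := Finset.univ)
    fun j : Fin 3 => HasInt.norm_sq ((hv i).c1.pd j)
  have e2 := HasInt.sum (S := Finset.univ) fun i : Fin 3 => HasInt.norm_sq (hf.c1.pd i)
  have e3 := HasInt.sum (S := Finset.univ) fun i : Fin 3 => HasInt.norm_sq (hg.c1.pd i)
  have e := (((e1.add e2).add e3).add (.norm_sq hf.c1.c0)).add (.norm_sq hg.c1.c0)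
  rw [← e.eq, div_mul_eq_mul_div, div_le_iff₀ (by positivity), mul_assoc]
  refine mul_le_mul_of_nonneg_left ?_ hr0.le
  have hu : ∀ i, ‖jet Ω (v i)‖ ^ 2 ≤ (1 + k) * ∑ j, ‖toL2 Ω (pd j (v i))‖ ^ 2 := fun i => by
    have h1 := norm_jet_sq_le (Ω := Ω) (f := v i)
    have h2 := Finset.single_le_sum (f := fun j => ‖toL2 Ω (pd j (v i))‖ ^ 2)
      (fun j _ => sq_nonneg _) (Finset.mem_univ 0)
    nlinarith [hk (v i) (hv i), mul_le_mul_of_nonneg_left h2 hk0]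
  have hu' := Finset.sum_le_sum fun i (_ : i ∈ Finset.univ) => hu i
  rw [← Finset.mul_sum] at hu'
  have h3 := norm_jet_sq_le (Ω := Ω) (f := f)
  have h4 := norm_jet_sq_le (Ω := Ω) (f := g)
  have h5 := norm_mechJet_sq_le (Ω := Ω) (v := v) (f := f) (g := g)
  have h6 : 0 ≤ k * ((∑ j, ‖toL2 Ω (pd j f)‖ ^ 2) + (∑ j, ‖toL2 Ω (pd j g)‖ ^ 2)
      + ‖toL2 Ω f‖ ^ 2 + ‖toL2 Ω g‖ ^ 2) := by positivity
  linarith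

section thermal
variable {θ : Space → ℝ} {T : Fin 3 → Space → ℝ}

theorem Coeffs.hasInt_capacity (hc : c.Regular Ω) (hθ : CoeffC1 Ω θ) (hT : ∀ i, CoeffC1 Ω (T i)) :
    HasInt Ω (fun x => c.a x * θ x * θ x + ∑ i, ∑ j, c.P i j x * T j x * T i x)
      (c.capacity Ω (thermJet Ω θ T) (thermJet Ω θ T)) := by
  rw [Coeffs.capacity_apply]
  simp only [thermTheta_thermJet, thermT_thermJet, jetVal_jet]
  exact (HasInt.inner hc.a hθ.c0 hθ.c0).add (.sum fun i => .sum fun j =>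
    .inner (hc.P i j) (hT j).c0 (hT i).c0)

theorem Coeffs.hasInt_dissipation (hc : c.Regular Ω) (hθ : CoeffC1 Ω θ)
    (hT : ∀ i, CoeffC1 Ω (T i)) :
    HasInt Ω (fun x => 1 / c.T0 * ((∑ i, ∑ j, c.kappa i j x * pd j θ x * pd i θ x)
          + ∑ i, ∑ j, c.L i j x * T j x * pd i θ x)
        + (∑ i, ∑ j, ∑ r, ∑ s, c.A j i r s x * pd r (T s) x * pd j (T i) x)
        + (∑ i, ∑ j, c.R i j x * T j x * T i x) + ∑ i, ∑ j, c.lam i j x * pd j θ x * T i x)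
      (c.dissipation Ω (thermJet Ω θ T) (thermJet Ω θ T)) := by
  rw [Coeffs.dissipation_apply]
  simp only [thermTheta_thermJet, thermT_thermJet, jetVal_jet, jetGrad_jet]
  exact ((((((HasInt.sum fun i => .sum fun j => .inner (hc.kappa i j).c0 (hθ.pd j) (hθ.pd i)).add
    (.sum fun i => .sum fun j => .inner (hc.L i j).c0 (hT j).c0 (hθ.pd i))).const_mul _).add
    (.sum fun i => .sum fun j => .sum fun r => .sum fun s =>
      .inner (hc.A j i r s).c0 ((hT s).pd r) ((hT i).pd j))).add
    (.sum fun i => .sum fun j => .inner (hc.R i j) (hT j).c0 (hT i).c0)).add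
    (.sum fun i => .sum fun j => .inner (hc.lam i j) (hθ.pd j) (hT i).c0))

end thermal

theorem Coeffs.capacity_nonneg (hc : c.Regular Ω) (hp : c.Positive Ω) :
    ∀ η ∈ staticTherm Ω, 0 ≤ c.capacity Ω η η := by
  rintro _ ⟨θ, T, hθ, hT, rfl⟩
  obtain ⟨r, hr, ha⟩ := hp.a
  have h0 : HasInt Ω (fun _ => 0) 0 := ⟨.const 0, by simp⟩
  refine h0.le (Coeffs.hasInt_capacity hc hθ.c1 fun i => (hT i).c1) fun x hx => ?_
  have h1 := Coeffs.capacity_nonneg_at hp hx fun i => T i x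
  have h2 : 0 ≤ c.a x * (θ x * θ x) := mul_nonneg (hr.le.trans (ha x hx)) (mul_self_nonneg _)
  linarith

theorem Coeffs.dissipation_coercive (hc : c.Regular Ω) (hs : c.Symmetric Ω) (hp : c.Positive Ω) :
    ∃ r : ℝ, 0 < r ∧ ∀ η ∈ staticTherm Ω,
      r * ‖η‖ ^ 2 ≤ c.dissipation Ω η η + c.capacity Ω η η := by
  obtain ⟨r1, h1, ha⟩ := hp.a
  obtain ⟨r2, h2, hq⟩ := hp.conduction
  obtain ⟨r3, h3, hA⟩ := hp.A
  have hT0 := hp.T0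
  have hr2 : 0 < 1 / c.T0 * r2 := by positivity
  refine ⟨min r1 (min (1 / c.T0 * r2) r3), by positivity, ?_⟩
  set r := min r1 (min (1 / c.T0 * r2) r3)
  have hr : 0 < r := by positivity
  have hr1 : r ≤ r1 := min_le_left _ _
  have hr2' : r ≤ 1 / c.T0 * r2 := (min_le_right _ _).trans (min_le_left _ _)
  have hr3 : r ≤ r3 := (min_le_right _ _).trans (min_le_right _ _)
  rintro _ ⟨θ, T, hθ, hT, rfl⟩
  have e1 : HasInt Ω (fun x => ∑ i, ∑ j, pd j (T i) x ^ 2) _ :=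
    .sum fun i => .sum fun j => .norm_sq ((hT i).c1.pd j)
  have e2 : HasInt Ω (fun x => ∑ i, pd i θ x ^ 2) _ := .sum fun i => .norm_sq (hθ.c1.pd i)
  have e3 : HasInt Ω (fun x => ∑ i, T i x ^ 2) _ := .sum fun i => .norm_sq (hT i).c1.c0
  have e4 : HasInt Ω (fun x => θ x ^ 2) _ := .norm_sq hθ.c1.c0
  have e := (((e1.add e2).add e3).add e4).const_mul r
  have hle := e.le ((Coeffs.hasInt_dissipation hc hθ.c1 fun i => (hT i).c1).add
    (Coeffs.hasInt_capacity hc hθ.c1 fun i => (hT i).c1)) fun x hx => by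
    have g1 := hq x hx (fun i => pd i θ x) (fun i => T i x)
    have g2 := hA x hx fun i j => pd j (T i) x
    have g3 := Coeffs.capacity_nonneg_at hp hx fun i => T i x
    have g4 := mul_le_mul_of_nonneg_right (hr1.trans (ha x hx)) (sq_nonneg (θ x))
    have s1 : ∑ i, ∑ j, c.L i j x * T j x * pd i θ x = ∑ i, ∑ j, c.L i j x * pd j θ x * T i x := by
      rw [Finset.sum_comm]
      refine Finset.sum_congr rfl fun i _ => Finset.sum_congr rfl fun j _ => ?_
      rw [hs.L x hx j i]
      ring
    have s3 : ∑ i, ∑ j, (c.L i j x + c.T0 * c.lam i j x) * pd j θ x * T i x =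
        (∑ i, ∑ j, c.L i j x * pd j θ x * T i x)
          + c.T0 * ∑ i, ∑ j, c.lam i j x * pd j θ x * T i x := by
      simp only [Finset.mul_sum, ← Finset.sum_add_distrib]
      exact Finset.sum_congr rfl fun i _ => Finset.sum_congr rfl fun j _ => by ring
    have s4 : ∀ (m : Fin 3 → Fin 3 → Space → ℝ) (ξ : Fin 3 → ℝ),
        ∑ i, ∑ j, m i j x * ξ i * ξ j = ∑ i, ∑ j, m i j x * ξ j * ξ i := fun m ξ => by
      simp only [mul_right_comm]
    have s5 : ∑ i, ∑ j, ∑ p, ∑ q, c.A j i p q x * pd j (T i) x * pd p (T q) x =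
        ∑ i, ∑ j, ∑ p, ∑ q, c.A j i p q x * pd p (T q) x * pd j (T i) x := by
      simp only [mul_right_comm]
    rw [s3, s4 c.kappa fun i => pd i θ x, s4 c.R fun i => T i x] at g1
    rw [s5] at g2
    have g5 := mul_le_mul_of_nonneg_left g1 (one_div_pos.2 hT0).le
    have g6 : r * ((∑ i, pd i θ x ^ 2) + ∑ i, T i x ^ 2) ≤
        1 / c.T0 * r2 * ((∑ i, pd i θ x ^ 2) + ∑ i, T i x ^ 2) :=
      mul_le_mul_of_nonneg_right hr2' (by positivity)
    have g7 : r * (∑ i, ∑ j, pd j (T i) x ^ 2) ≤ r3 * ∑ i, ∑ j, pd j (T i) x ^ 2 :=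
      mul_le_mul_of_nonneg_right hr3 (by positivity)
    have g8 : ∀ q : ℝ, 1 / c.T0 * (c.T0 * q) = q := fun q => by field_simp
    rw [mul_add (1 / c.T0), mul_add (1 / c.T0), mul_add (1 / c.T0), g8, g8] at g5
    rw [s1]
    linarith
  refine le_trans (mul_le_mul_of_nonneg_left ?_ hr.le) hle
  have n1 := norm_thermJet_sq_le (Ω := Ω) (f := θ) (v := T)
  have n2 := norm_jet_sq_le (Ω := Ω) (f := θ)
  have n3 := Finset.sum_le_sum fun i (_ : i ∈ Finset.univ) => norm_jet_sq_le (Ω := Ω) (f := T i)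
  rw [Finset.sum_add_distrib] at n3
  linarith

/-- The evolution problem of thermoelasticity with double porosity and microtemperatures. -/
noncomputable def Coeffs.forms (hc : c.Regular Ω) (hs : c.Symmetric Ω) (hp : c.Positive Ω) :
    EvolutionForms (MechSpace Ω) (VelSpace Ω) (ThermSpace Ω) where
  V := staticMech Ω
  VY := staticTherm Ω
  val := mechVal
  K := c.inertia Ω
  W := c.elastic Ω
  G := c.skew Ω
  b := c.coupling Ω
  Θ := c.capacity Ω
  D := c.dissipation Ω
  K_symm := Coeffs.inertia_symm hc
  W_symm := Coeffs.elastic_symm hc hs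
  Θ_symm := Coeffs.capacity_symm hc hs
  K_coercive := Coeffs.inertia_coercive hc hp
  W_coercive := Coeffs.elastic_coercive hc hs hp
  Θ_nonneg := Coeffs.capacity_nonneg hc hp
  D_coercive := Coeffs.dissipation_coercive hc hs hp

end

/-! ### Classical solutions as weak solutions -/

/-- Classical solutions of the backward (`σ = 1`) and of the forward (`σ = -1`) system. -/
structure IsSolution (σ : ℝ) (c : Coeffs) (Ω : Set Space) (I : Set ℝ) (U : Fields) : Prop where
  regular : U.Regular I Ω
  mechanical : MechanicalEqs c Ω I U
  heat : ∀ t ∈ I, ∀ x ∈ Ω,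
    c.a x * dt I U.theta t x =
      -(∑ i, ∑ j, c.beta i j x * pd j (dt I (U.u i) t) x)
        - c.gamma1 x * dt I U.phi t x - c.gamma2 x * dt I U.psi t x
        - σ * (1 / c.T0) * ∑ i, pd i (c.heatFlux U i t) x
  micro : ∀ t ∈ I, ∀ x ∈ Ω, ∀ i,
    (∑ j, c.P i j x * dt I (U.T j) t x) =
      -(σ * ∑ j, pd j (c.fluxMoment U j i t) x)
        + σ * (∑ j, c.R i j x * U.T j t x) + σ * (∑ j, c.lam i j x * pd j (U.theta t) x)
        - (∑ j, c.N i j x * pd j (dt I U.phi t) x) - (∑ j, c.M i j x * pd j (dt I U.psi t) x)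

section
variable {c : Coeffs} {Ω : Set Space} {I : Set ℝ} {U : Fields}

theorem BackwardSolution.isSolution (h : BackwardSolution c Ω I U) : IsSolution 1 c Ω I U where
  regular := h.regular
  mechanical := h.mechanical
  heat t ht x hx := by rw [h.heat t ht x hx]; ring
  micro t ht x hx i := by rw [h.micro t ht x hx i]; ring

theorem ForwardSolution.isSolution (h : ForwardSolution c Ω I U) : IsSolution (-1) c Ω I U where
  regular := h.regular
  mechanical := h.mechanical
  heat t ht x hx := by rw [h.heat t ht x hx]; ring
  micro t ht x hx i := by rw [h.micro t ht x hx i]; ring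

end

section
variable (Ω : Set Space)

/-- The mechanical fields at time `t` with their gradients. -/
noncomputable def Fields.mech (U : Fields) (t : ℝ) : MechSpace Ω :=
  mechJet Ω (fun i => U.u i t) (U.phi t) (U.psi t)

/-- The time derivatives of the mechanical fields at time `t`. -/
noncomputable def Fields.vel (U : Fields) (I : Set ℝ) (t : ℝ) : VelSpace Ω :=
  velMk (fun i => toL2 Ω (dt I (U.u i) t)) (toL2 Ω (dt I U.phi t)) (toL2 Ω (dt I U.psi t))

/-- The thermal fields at time `t` with their gradients. -/
noncomputable def Fields.therm (U : Fields) (t : ℝ) : ThermSpace Ω :=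
  thermJet Ω (U.theta t) fun i => U.T i t

theorem hasDerivWithinAt_velMk {S : Set ℝ} {t : ℝ} {f : Fin 3 → ℝ → L2 Ω} {g h : ℝ → L2 Ω}
    {f' : Fin 3 → L2 Ω} {g' h' : L2 Ω} (hf : ∀ i, HasDerivWithinAt (f i) (f' i) S t)
    (hg : HasDerivWithinAt g g' S t) (hh : HasDerivWithinAt h h' S t) :
    HasDerivWithinAt (fun s => velMk (fun i => f i s) (g s) (h s)) (velMk f' g' h') S t :=
  (hasDerivWithinAt_pi.2 hf).prodMk (hg.prodMk hh)

theorem hasDerivWithinAt_inner_mulL (d : Space → ℝ) {S : Set ℝ} {t : ℝ} {f : ℝ → L2 Ω} {f' : L2 Ω}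
    (hf : HasDerivWithinAt f f' S t) (g : L2 Ω) :
    HasDerivWithinAt (fun s => ⟪mulL Ω d (f s), g⟫) ⟪mulL Ω d f', g⟫ S t :=
  (((innerSL ℝ).flip g).comp (mulL Ω d)).hasFDerivAt.comp_hasDerivWithinAt t hf

end

section
variable {c : Coeffs} {Ω : Set Space} [hΩ : BoundedOpen Ω] {I : Set ℝ} {U : Fields} {σ p q : ℝ}

set_option maxHeartbeats 2000000 in
/-- The balance of momentum and of equilibrated forces, tested with a static field. -/
theorem IsSolution.momentum_eq (hI : UniqueDiffOn ℝ I) (hc : c.Regular Ω)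
    (h : IsSolution σ c Ω I U) {t : ℝ} (ht : t ∈ I) {w : MechSpace Ω} (hw : w ∈ staticMech Ω) :
    c.inertia Ω (velMk (fun i => toL2 Ω (dt I (dt I (U.u i)) t)) (toL2 Ω (dt I (dt I U.phi) t))
      (toL2 Ω (dt I (dt I U.psi) t))) (mechVal w) =
      -c.elastic Ω (U.mech Ω t) w - c.skew Ω (U.mech Ω t) (mechVal w)
        + c.coupling Ω (U.therm Ω t) (mechVal w) := by
  obtain ⟨w, f, g, hw, hf, hg, rfl⟩ := hw
  have hr := h.regular.spaceRegular hI ht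
  have hm := h.mechanical
  rw [c.inertia_apply, c.elastic_apply, c.skew_apply, c.coupling_apply]
  simp only [Fields.mech, Fields.therm, mechVal_mechJet, velU_mk, velPhi_mk, velPsi_mk,
    mechU_mechJet, mechPhi_mechJet, mechPsi_mechJet, jetVal_jet, jetGrad_jet, thermTheta_thermJet,
    thermT_thermJet]
  have h1 : ∀ i, _ := fun i => momentum_weak hc hr i ((h.regular.u i).c0_dtt hI ht)
    (fun x hx => hm.momentum t ht x hx i) (hw i)
  have h2 := phi_weak hc hr (h.regular.phi.c0_dtt hI ht) (hm.phi t ht) hf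
  have h3 := psi_weak hc hr (h.regular.psi.c0_dtt hI ht) (hm.psi t ht) hg
  have h4 := Finset.sum_congr (rfl : (Finset.univ : Finset (Fin 3)) = Finset.univ) fun i _ => h1 i
  simp only [Finset.sum_sub_distrib, Finset.sum_neg_distrib] at h4
  linarith

set_option maxHeartbeats 2000000 in
/-- The balance of energy and of its first moment, tested with a static field. -/
theorem IsSolution.heat_eq (hI : UniqueDiffOn ℝ I) (hc : c.Regular Ω)
    (h : IsSolution σ c Ω I U) {t : ℝ} (ht : t ∈ I) {η : Space → ℝ} {ζ : Fin 3 → Space → ℝ}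
    (hη : StaticField Ω η) (hζ : ∀ i, StaticField Ω (ζ i)) :
    ⟪mulL Ω c.a (toL2 Ω (dt I U.theta t)), toL2 Ω η⟫
      + (∑ i, ∑ j, ⟪mulL Ω (c.P i j) (toL2 Ω (dt I (U.T j) t)), toL2 Ω (ζ i)⟫)
      + c.coupling Ω (thermJet Ω η ζ) (U.vel Ω I t) =
      σ * c.dissipation Ω (U.therm Ω t) (thermJet Ω η ζ) := by
  have hr := h.regular.spaceRegular hI ht
  rw [c.dissipation_apply, c.coupling_apply]
  simp only [Fields.vel, Fields.therm, velU_mk, velPhi_mk, velPsi_mk,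
    jetVal_jet, jetGrad_jet, thermTheta_thermJet, thermT_thermJet]
  have h1 := heat_weak hc hr (h.regular.theta.c0_dt hI ht) (h.regular.phi.c1_dt hI ht).c0
    (h.regular.psi.c1_dt hI ht).c0 (fun i => (h.regular.u i).c1_dt hI ht) (h.heat t ht) hη
  have h2 : ∀ i, _ := fun i => micro_weak hc hr i (fun j => (h.regular.T j).c0_dt hI ht)
    (h.regular.phi.c1_dt hI ht) (h.regular.psi.c1_dt hI ht) (fun x hx => h.micro t ht x hx i) (hζ i)
  have h3 := Finset.sum_congr (rfl : (Finset.univ : Finset (Fin 3)) = Finset.univ) fun i _ => h2 i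
  simp only [Finset.sum_add_distrib, ← Finset.mul_sum] at h3
  rw [h1, h3, Finset.sum_comm
      (f := fun j i => ⟪mulL Ω (pd j (c.N i j)) (toL2 Ω (ζ i)), toL2 Ω (dt I U.phi t)⟫),
    Finset.sum_comm
      (f := fun j i => ⟪mulL Ω (c.N i j) (toL2 Ω (pd j (ζ i))), toL2 Ω (dt I U.phi t)⟫),
    Finset.sum_comm
      (f := fun j i => ⟪mulL Ω (pd j (c.M i j)) (toL2 Ω (ζ i)), toL2 Ω (dt I U.psi t)⟫),
    Finset.sum_comm
      (f := fun j i => ⟪mulL Ω (c.M i j) (toL2 Ω (pd j (ζ i))), toL2 Ω (dt I U.psi t)⟫)]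
  ring

/-- Classical solutions are weak solutions, whatever their boundary values. -/
theorem IsSolution.isWeakSolution (hI : UniqueDiffOn ℝ I) (hc : c.Regular Ω)
    (hs : c.Symmetric Ω) (hp : c.Positive Ω) (h : IsSolution σ c Ω I U) (hS : Icc p q ⊆ I) :
    IsWeakSolution (Coeffs.forms hc hs hp) σ (Icc p q) (U.mech Ω) (U.vel Ω I) (U.therm Ω) := by
  have hr := h.regular
  have hval : ∀ t ∈ Icc p q,
      HasDerivWithinAt (fun s => mechVal (U.mech Ω s)) (U.vel Ω I t) (Icc p q) t := fun t ht =>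
    hasDerivWithinAt_velMk Ω (fun i => (hr.u i).hasDerivWithinAt_toL2 hI hS ht)
      (hr.phi.hasDerivWithinAt_toL2 hI hS ht) (hr.psi.hasDerivWithinAt_toL2 hI hS ht)
  have jm : ∀ {f : ℝ → Space → ℝ}, MechRegular I Ω f →
      ContinuousOn (fun t => jet Ω (f t)) (Icc p q) := fun hf =>
    (hf.continuousOn_toL2 hS).prodMk (continuousOn_pi.2 fun j => hf.continuousOn_toL2_pd hI hS j)
  have jt : ∀ {f : ℝ → Space → ℝ}, ThermRegular I Ω f →
      ContinuousOn (fun t => jet Ω (f t)) (Icc p q) := fun hf =>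
    (hf.continuousOn_toL2 hS).prodMk (continuousOn_pi.2 fun j => hf.continuousOn_toL2_pd hI hS j)
  refine ⟨(continuousOn_pi.2 fun i => jm (hr.u i)).prodMk ((jm hr.phi).prodMk (jm hr.psi)),
    (jt hr.theta).prodMk (continuousOn_pi.2 fun i => jt (hr.T i)), hval, fun w hw t ht => ?_,
    fun η hη t ht => ?_⟩
  · have h1 := hasDerivWithinAt_velMk Ω (fun i => (hr.u i).hasDerivWithinAt_toL2_dt hI hS ht)
      (hr.phi.hasDerivWithinAt_toL2_dt hI hS ht) (hr.psi.hasDerivWithinAt_toL2_dt hI hS ht)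
    have h2 := ((c.inertia Ω).flip (mechVal w)).hasFDerivAt.comp_hasDerivWithinAt t h1
    exact h2.congr_deriv (h.momentum_eq hI hc (hS ht) hw)
  · obtain ⟨η, ζ, hη, hζ, rfl⟩ := hη
    have h1 : HasDerivWithinAt (fun s => c.capacity Ω (U.therm Ω s) (thermJet Ω η ζ))
        (⟪mulL Ω c.a (toL2 Ω (dt I U.theta t)), toL2 Ω η⟫
          + ∑ i, ∑ j, ⟪mulL Ω (c.P i j) (toL2 Ω (dt I (U.T j) t)), toL2 Ω (ζ i)⟫) (Icc p q) t := by
      simp only [Coeffs.capacity_apply]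
      exact (hasDerivWithinAt_inner_mulL Ω c.a (hr.theta.hasDerivWithinAt_toL2 hI hS ht) _).fun_add
        (.fun_sum fun i _ => .fun_sum fun j _ =>
          hasDerivWithinAt_inner_mulL Ω (c.P i j) ((hr.T j).hasDerivWithinAt_toL2 hI hS ht) _)
    have h2 := (c.coupling Ω (thermJet Ω η ζ)).hasFDerivAt.comp_hasDerivWithinAt t (hval t ht)
    exact (h1.fun_add h2).congr_deriv (h.heat_eq hI hc (hS ht) hη hζ)

end

/-! ### Uniqueness and reversal of time -/

section
variable {Ω : Set Space} {I : Set ℝ}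

theorem pd_zero (j : Fin 3) : pd j (fun _ => 0) = fun _ => 0 := by
  funext x
  simp [pd]

theorem dt_zero : dt I (fun _ _ => 0) = fun _ _ => 0 := by
  funext t x
  simp [dt]

theorem locBdd_zero : LocBdd I Ω fun _ _ => 0 := fun _ _ _ => ⟨0, fun _ _ _ _ => by simp⟩

theorem mechRegular_zero : MechRegular I Ω fun _ _ => 0 where
  cont := continuousOn_const
  diff := contDiffOn_const
  bdd_dt := by rw [dt_zero]; exact locBdd_zero
  bdd_dtt := by rw [dt_zero, dt_zero]; exact locBdd_zero
  bdd_dx j := by simp only [pd_zero]; exact locBdd_zero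
  bdd_dtx j := by simp only [dt_zero, pd_zero]; exact locBdd_zero
  bdd_dxx j k := by simp only [pd_zero]; exact locBdd_zero

theorem thermRegular_zero : ThermRegular I Ω fun _ _ => 0 where
  cont := continuousOn_const
  diff := contDiffOn_const
  diff_space _ _ := contDiffOn_const
  cont_dxx j k := by simp only [pd_zero]; exact continuousOn_const
  bdd_dt := by rw [dt_zero]; exact locBdd_zero
  bdd_dx j := by simp only [pd_zero]; exact locBdd_zero
  bdd_dxx j k := by simp only [pd_zero]; exact locBdd_zero

theorem nullFields_regular : nullFields.Regular I Ω :=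
  ⟨fun _ => mechRegular_zero, mechRegular_zero, mechRegular_zero, thermRegular_zero,
    fun _ => thermRegular_zero⟩

theorem nullFields_isSolution (σ : ℝ) (c : Coeffs) : IsSolution σ c Ω I nullFields := by
  have h1 : ∀ i j t, c.stress nullFields i j t = fun _ => 0 := fun i j t => funext fun x => by
    simp [Coeffs.stress, nullFields, pd_zero]
  have h2 : ∀ j t, c.sigma nullFields j t = fun _ => 0 := fun j t => funext fun x => by
    simp [Coeffs.sigma, nullFields, pd_zero]
  have h3 : ∀ j t, c.tau nullFields j t = fun _ => 0 := fun j t => funext fun x => by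
    simp [Coeffs.tau, nullFields, pd_zero]
  have h4 : ∀ i t, c.heatFlux nullFields i t = fun _ => 0 := fun i t => funext fun x => by
    simp [Coeffs.heatFlux, nullFields, pd_zero]
  have h5 : ∀ j i t, c.fluxMoment nullFields j i t = fun _ => 0 := fun j i t => funext fun x => by
    simp [Coeffs.fluxMoment, nullFields, pd_zero]
  refine ⟨nullFields_regular, ⟨?_, ?_, ?_⟩, ?_, ?_⟩ <;> intros <;>
    simp only [h1, h2, h3, h4, h5] <;> simp [nullFields, dt_zero, pd_zero]

theorem agreeAt_closure {U V : Fields} {t : ℝ} (h : ∀ x ∈ Ω, AgreeAt U V t x)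
    (h' : ∀ x ∈ frontier Ω, AgreeAt U V t x) :
    ∀ x ∈ closure Ω, AgreeAt U V t x := by
  intro x hx
  rw [closure_eq_self_union_frontier] at hx
  exact hx.elim (h x) (h' x)

theorem uniqueDiffOn_of_ordConnected (h : I.OrdConnected) (h' : I.Nontrivial) :
    UniqueDiffOn ℝ I := by
  obtain ⟨x, hx, y, hy, hxy⟩ := h'.exists_lt
  refine uniqueDiffOn_convex h.convex ?_
  exact (nonempty_Ioo.2 hxy).mono
    (interior_maximal (Ioo_subset_Icc_self.trans (h.out hx hy)) isOpen_Ioo)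

end

section
variable {Ω : Set Space} [hΩ : BoundedOpen Ω] {I : Set ℝ} {U V : Fields} {t : ℝ} {c : Coeffs}

theorem staticField_sub {f g : Space → ℝ} (hf : ContinuousOn f (closure Ω)) (hf1 : CoeffC1 Ω f)
    (hg : ContinuousOn g (closure Ω)) (hg1 : CoeffC1 Ω g) (h : ∀ x ∈ frontier Ω, f x = g x) :
    StaticField Ω fun x => f x - g x :=
  ⟨hf.sub hg, fun x hx => sub_eq_zero.2 (h x hx), hf1.1.sub hg1.1, fun j => ((hf1.sub hg1).pd j).2⟩

theorem mech_sub_mem (hU : U.Regular I Ω) (hV : V.Regular I Ω) (ht : t ∈ I)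
    (h : ∀ x ∈ frontier Ω, AgreeAt U V t x) : U.mech Ω t - V.mech Ω t ∈ staticMech Ω := by
  have hs : ∀ {f g : ℝ → Space → ℝ}, MechRegular I Ω f → MechRegular I Ω g →
      (∀ x ∈ frontier Ω, f t x = g t x) → StaticField Ω fun x => f t x - g t x :=
    fun hf hg h => staticField_sub (continuousOn_space hf.cont ht) (hf.c1 ht)
      (continuousOn_space hg.cont ht) (hg.c1 ht) h
  refine ⟨_, _, _, fun i => hs (hU.u i) (hV.u i) fun x hx => (h x hx).u i,
    hs hU.phi hV.phi fun x hx => (h x hx).phi, hs hU.psi hV.psi fun x hx => (h x hx).psi, ?_⟩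
  exact (Prod.ext (funext fun i => jet_sub ((hU.u i).c1 ht) ((hV.u i).c1 ht))
    (Prod.ext (jet_sub (hU.phi.c1 ht) (hV.phi.c1 ht)) (jet_sub (hU.psi.c1 ht) (hV.psi.c1 ht)))).symm

theorem therm_sub_mem (hU : U.Regular I Ω) (hV : V.Regular I Ω) (ht : t ∈ I)
    (h : ∀ x ∈ frontier Ω, AgreeAt U V t x) : U.therm Ω t - V.therm Ω t ∈ staticTherm Ω := by
  have hs : ∀ {f g : ℝ → Space → ℝ}, ThermRegular I Ω f → ThermRegular I Ω g →
      (∀ x ∈ frontier Ω, f t x = g t x) → StaticField Ω fun x => f t x - g t x :=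
    fun hf hg h => staticField_sub (continuousOn_space hf.cont ht) (hf.c1 ht)
      (continuousOn_space hg.cont ht) (hg.c1 ht) h
  refine ⟨_, _, hs hU.theta hV.theta fun x hx => (h x hx).theta,
    fun i => hs (hU.T i) (hV.T i) fun x hx => (h x hx).T i, ?_⟩
  exact (Prod.ext (jet_sub (hU.theta.c1 ht) (hV.theta.c1 ht))
    (funext fun i => jet_sub ((hU.T i).c1 ht) ((hV.T i).c1 ht))).symm

theorem jet_congr {f g : Space → ℝ} (h : ∀ x ∈ Ω, f x = g x) : jet Ω f = jet Ω g :=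
  Prod.ext (toL2_congr h)
    (funext fun _ => toL2_congr fun _ hx => pd_congr hΩ.isOpen h hx)

theorem eq_of_jet_eq {f g : Space → ℝ} (hf : CoeffC1 Ω f) (hg : CoeffC1 Ω g)
    (h : jet Ω f = jet Ω g) : ∀ x ∈ Ω, f x = g x := by
  intro x hx
  have h1 : toL2 Ω f = toL2 Ω g := congrArg jetVal h
  refine sub_eq_zero.1 (eq_zero_of_toL2_eq_zero (hf.c0.sub hg.c0) ?_ x hx)
  rw [toL2_sub hf.c0 hg.c0, h1, sub_self]

theorem mech_congr (h : ∀ x ∈ Ω, AgreeAt U V t x) : U.mech Ω t = V.mech Ω t :=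
  Prod.ext (funext fun i => jet_congr fun x hx => (h x hx).u i)
    (Prod.ext (jet_congr fun x hx => (h x hx).phi) (jet_congr fun x hx => (h x hx).psi))

theorem therm_congr (h : ∀ x ∈ Ω, AgreeAt U V t x) : U.therm Ω t = V.therm Ω t :=
  Prod.ext (jet_congr fun x hx => (h x hx).theta)
    (funext fun i => jet_congr fun x hx => (h x hx).T i)

theorem agreeAt_of_eq (hU : U.Regular I Ω) (hV : V.Regular I Ω) (ht : t ∈ I)
    (hm : U.mech Ω t = V.mech Ω t) (hT : U.therm Ω t = V.therm Ω t) :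
    ∀ x ∈ Ω, AgreeAt U V t x := fun x hx =>
  ⟨fun i => eq_of_jet_eq ((hU.u i).c1 ht) ((hV.u i).c1 ht) (congrArg (mechU i) hm) x hx,
    eq_of_jet_eq (hU.phi.c1 ht) (hV.phi.c1 ht) (congrArg mechPhi hm) x hx,
    eq_of_jet_eq (hU.psi.c1 ht) (hV.psi.c1 ht) (congrArg mechPsi hm) x hx,
    eq_of_jet_eq (hU.theta.c1 ht) (hV.theta.c1 ht) (congrArg thermTheta hT) x hx,
    fun i => eq_of_jet_eq ((hU.T i).c1 ht) ((hV.T i).c1 ht) (congrArg (thermT i) hT) x hx⟩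

/-- Uniqueness for the backward problem. -/
theorem agreeAt_of_sameInitialData (hc : c.Regular Ω) (hs : c.Symmetric Ω)
    (hp : c.Positive Ω) (hI : I.OrdConnected) (hI' : I.Nontrivial) (h0 : IsLeast I 0)
    (hU : IsSolution 1 c Ω I U) (hV : IsSolution 1 c Ω I V) (hi : SameInitialData Ω I U V)
    (hb : SameBoundaryData Ω I U V) : ∀ t ∈ I, ∀ x ∈ closure Ω, AgreeAt U V t x := by
  intro t ht
  refine agreeAt_closure ?_ (hb t ht)
  rcases (h0.2 ht).eq_or_lt with rfl | htpos
  · exact hi.fields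
  have hS : Icc 0 t ⊆ I := hI.out h0.1 ht
  have hu := uniqueDiffOn_of_ordConnected hI hI'
  have hw := (hU.isWeakSolution hu hc hs hp hS).sub (hV.isWeakSolution hu hc hs hp hS)
  have hvel : U.vel Ω I 0 = V.vel Ω I 0 := by
    rw [Fields.vel, Fields.vel, toL2_congr hi.dphi, toL2_congr hi.dpsi,
      funext fun i => toL2_congr fun x hx => hi.du x hx i]
  obtain ⟨h1, h2⟩ := hw.eq_zero htpos
    (fun s hs => mech_sub_mem hU.regular hV.regular (hS hs) (hb s (hS hs)))
    (fun s hs => therm_sub_mem hU.regular hV.regular (hS hs) (hb s (hS hs)))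
    (sub_eq_zero.2 (mech_congr hi.fields)) (sub_eq_zero.2 hvel)
    (sub_eq_zero.2 (therm_congr hi.fields)) t ⟨htpos.le, le_rfl⟩
  exact agreeAt_of_eq hU.regular hV.regular ht (sub_eq_zero.1 h1) (sub_eq_zero.1 h2)

/-- Reversal of time reduces the impossibility of localization to uniqueness for the backward
problem. -/
theorem agreeAt_nullFields_of_eventually {t₀ : ℝ} (hc : c.Regular Ω) (hs : c.Symmetric Ω)
    (hp : c.Positive Ω) (hI : I.OrdConnected) (ht₀ : t₀ ∈ interior I)
    (hU : IsSolution (-1) c Ω I U) (hb : SameBoundaryData Ω I U nullFields)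
    (hv : ∀ t ∈ I, t₀ ≤ t → ∀ x ∈ Ω, AgreeAt U nullFields t x) :
    ∀ t ∈ I, ∀ x ∈ closure Ω, AgreeAt U nullFields t x := by
  intro t ht
  refine agreeAt_closure ?_ (hb t ht)
  rcases le_or_gt t₀ t with h | h
  · exact hv t ht h
  have hmem : t₀ ∈ I := interior_subset ht₀
  have hS : Icc t t₀ ⊆ I := hI.out ht hmem
  have hu : UniqueDiffOn ℝ I := uniqueDiffOn_convex hI.convex ⟨t₀, ht₀⟩
  -- the velocities at `t₀` are determined by the vanishing values at later times
  have hdt : ∀ {f : ℝ → Space → ℝ}, MechRegular I Ω f →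
      (∀ s ∈ I, t₀ ≤ s → ∀ x ∈ Ω, f s x = 0) → toL2 Ω (dt I f t₀) = 0 := by
    intro f hf hf0
    rw [← toL2_zero]
    refine toL2_congr fun x hx => ?_
    have h1 := (hasDerivWithinAt_dt (hf.diff.differentiableOn two_ne_zero) hmem hx).mono
      (inter_subset_right (s := Ici t₀))
    have h2 : HasDerivWithinAt (fun s => f s x) 0 (Ici t₀ ∩ I) t₀ :=
      (hasDerivWithinAt_const t₀ (Ici t₀ ∩ I) (0 : ℝ)).congr (fun s hs => hf0 s hs.2 hs.1 x hx)
        (hf0 t₀ hmem le_rfl x hx)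
    exact ((uniqueDiffWithinAt_Ici t₀).inter (mem_interior_iff_mem_nhds.1 ht₀)).eq_deriv _ h1 h2
  have hr := hU.regular
  have hvel : U.vel Ω I t₀ = 0 := by
    rw [Fields.vel, hdt hr.phi fun s h1 h2 x hx => (hv s h1 h2 x hx).phi,
      hdt hr.psi fun s h1 h2 x hx => (hv s h1 h2 x hx).psi,
      funext fun i => hdt (hr.u i) fun s h1 h2 x hx => (hv s h1 h2 x hx).u i]
    rfl
  have hm0 : ∀ s, nullFields.mech Ω s = 0 := fun s =>
    Prod.ext (funext fun _ => jet_zero) (Prod.ext jet_zero jet_zero)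
  have hT0 : ∀ s, nullFields.therm Ω s = 0 := fun s =>
    Prod.ext jet_zero (funext fun _ => jet_zero)
  have hw := (hU.isWeakSolution hu hc hs hp hS).reverse
  rw [neg_neg] at hw
  have hrev : ∀ s ∈ Icc 0 (t₀ - t), t₀ - s ∈ I := fun s hs =>
    hS ⟨by linarith [hs.2], by linarith [hs.1]⟩
  have hmem_mech : ∀ s ∈ I, U.mech Ω s ∈ staticMech Ω := fun s hs => by
    simpa only [hm0, sub_zero] using mech_sub_mem hr nullFields_regular hs (hb s hs)
  have hmem_therm : ∀ s ∈ I, U.therm Ω s ∈ staticTherm Ω := fun s hs => by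
    simpa only [hT0, sub_zero] using therm_sub_mem hr nullFields_regular hs (hb s hs)
  obtain ⟨h1, h2⟩ := hw.eq_zero (sub_pos.2 h)
    (fun s hs => hmem_mech _ (hrev s hs)) (fun s hs => hmem_therm _ (hrev s hs))
    (by simpa only [sub_zero, hm0] using mech_congr (hv t₀ hmem le_rfl))
    (by simp only [sub_zero, hvel, neg_zero])
    (by simpa only [sub_zero, hT0] using therm_congr (hv t₀ hmem le_rfl))
    (t₀ - t) ⟨(sub_pos.2 h).le, le_rfl⟩
  rw [sub_sub_cancel] at h1 h2
  exact agreeAt_of_eq hr nullFields_regular ht (h1.trans (hm0 t).symm) (h2.trans (hT0 t).symm)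

end

end DoublePorosity

theorem mainTheorem1
    (Ω : Set DoublePorosity.Space) (hopen : IsOpen Ω) (hbdd : Bornology.IsBounded Ω)
    (c : DoublePorosity.Coeffs)
    (hreg : c.Regular Ω) (hsymm : c.Symmetric Ω) (hpos : c.Positive Ω) :
    -- the backward problem with null data has only the null solution
    (∀ (I : Set ℝ), I.OrdConnected → I.Nontrivial → IsLeast I 0 →
      ∀ U : DoublePorosity.Fields,
        DoublePorosity.BackwardSolution c Ω I U →
        DoublePorosity.SameInitialData Ω I U DoublePorosity.nullFields →
        DoublePorosity.SameBoundaryData Ω I U DoublePorosity.nullFields →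
        ∀ t ∈ I, ∀ x ∈ closure Ω, DoublePorosity.AgreeAt U DoublePorosity.nullFields t x) ∧
    -- solutions of the backward problem are determined by their initial and boundary data
    (∀ (I : Set ℝ), I.OrdConnected → I.Nontrivial → IsLeast I 0 →
      ∀ U V : DoublePorosity.Fields,
        DoublePorosity.BackwardSolution c Ω I U →
        DoublePorosity.BackwardSolution c Ω I V →
        DoublePorosity.SameInitialData Ω I U V →
        DoublePorosity.SameBoundaryData Ω I U V →
        ∀ t ∈ I, ∀ x ∈ closure Ω, DoublePorosity.AgreeAt U V t x) ∧
    -- a solution of the forward problem that vanishes after a finite time vanishes always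
    (∀ (J : Set ℝ), J.OrdConnected → ∀ t₀ ∈ interior J,
      ∀ U : DoublePorosity.Fields,
        DoublePorosity.ForwardSolution c Ω J U →
        DoublePorosity.SameBoundaryData Ω J U DoublePorosity.nullFields →
        (∀ t ∈ J, t₀ ≤ t → ∀ x ∈ Ω, DoublePorosity.AgreeAt U DoublePorosity.nullFields t x) →
        ∀ t ∈ J, ∀ x ∈ closure Ω, DoublePorosity.AgreeAt U DoublePorosity.nullFields t x) := by
  have : DoublePorosity.BoundedOpen Ω := ⟨hopen, hbdd⟩
  exact ⟨fun I h1 h2 h3 U hU hi hb =>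
      DoublePorosity.agreeAt_of_sameInitialData hreg hsymm hpos h1 h2 h3 hU.isSolution
        (DoublePorosity.nullFields_isSolution 1 c) hi hb,
    fun I h1 h2 h3 U V hU hV hi hb =>
      DoublePorosity.agreeAt_of_sameInitialData hreg hsymm hpos h1 h2 h3 hU.isSolution
        hV.isSolution hi hb,
    fun J h1 t₀ h2 U hU hb hv =>
      DoublePorosity.agreeAt_nullFields_of_eventually hreg hsymm hpos h1 h2 hU.isSolution hb hv⟩
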